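/- Let $\mathcal{O}$ be a set and let $\mathcal{C}=\mathsf{Cat}_{\mathcal{O}}$ be the category of small categories with object set $\mathcal{O}$ and functors which are the identity on objects. Write $\mathsf{Gpd}^1\mathcal{C}=\mathsf{Gpd}\,\mathcal{C}$ for the category of internal groupoids in $\mathcal{C}$ and $\mathsf{Gpd}^n\mathcal{C}=\mathsf{Gpd}(\mathsf{Gpd}^{n-1}\mathcal{C})$ for that of $n$-fold groupoids in $\mathcal{C}$, which are identified with their multinerves ($n$-fold simplicial objects in $\mathcal{C}$); an $n$-fold groupoid in $\mathsf{Cat}_{\mathcal{O}}$ is the same thing as a category with object set $\mathcal{O}$ enriched in $n$-fold groupoids (with respect to the cartesian product). Let $Q\in\mathsf{Gpd}\,\mathcal{C}$ (a track category) with object of objects $Q_0$, and let $M$ be a $Q$-module: an abelian group object $\rho:M\to Q$ (with unit section $\phi:Q\to M$ and addition $\mu:M\times_Q M\to M$) in the slice over $Q$ of the category of internal groupoids with object of objects $Q_0$ and maps that are the identity on $Q_0$. Let $d^{(n)}Q\in\mathsf{Gpd}^n\mathcal{C}$ be $Q$ regarded as an $n$-fold groupoid which is discrete (constant) in the other $n-1$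 directions. Define inductively abelian group objects $\rho^{(n)}:E^{(n)}(Q,M)\to d^{(n)}Q$ over $d^{(n)}Q$ as follows: $E^{(1)}(Q,M)=M$, and, for $n\ge 2$, $E^{(n)}(Q,M)$ is the groupoid object in $\mathsf{Gpd}^{n-1}\mathcal{C}$ with object of objects $d^{(n-1)}Q$, object of arrows $E^{(n-1)}(Q,M)$, source and target both equal to $\rho^{(n-1)}$, identities given by the unit section $\phi^{(n-1)}$, and composition given by the addition $\mu^{(n-1)}$; its projection to $d^{(n)}Q$ is induced by $\rho^{(n-1)}$ and its fibrewise addition is induced levelwise by $\mu^{(n-1)}$. Then for each $n\ge 2$: (a) $E^{(n)}(Q,M)$ is an $n$-fold groupoid in $\mathsf{Cat}_{\mathcal{O}}$, i.e. a category with object set $\mathcal{O}$ enriched in $n$-fold groupoids. (b) $E^{(n)}(Q,M)$ is an abelian group object in $(\mathsf{Gpd}^n\mathcal{C},d^{(n-1)}Q)/d^{(n)}Q$, the slice over $d^{(n)}Q$ of the category of groupoids in $\mathsf{Gpd}^{n-1}\mathcal{C}$ with object of objects $d^{(n-1)}Q$, with the unit and addition described above. (c) $E^{(n)}(Q,M)$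 is an Eilenberg–Mac Lane object of type $(M,n)$ over $Q$. That is, let $DE$ be the simplicial category with object set $\mathcal{O}$ given by the diagonal of the multinerve of $E=E^{(n)}(Q,M)$, and let $p:DE\to Q$ be induced by $\rho^{(n)}$ (where $Q$ is identified with its nerve). Then the mapping spaces $DE(a,b)$ are Kan complexes; $p$ has a section; $p$ induces an isomorphism from the fundamental track category $\hat\pi_1 DE$ (the fundamental groupoids of the mapping spaces) to $Q$; $\pi_i(DE(a,b),x)=0$ for all $a,b\in\mathcal{O}$, all vertices $x$ and all $i\ge 2$ with $i\ne n$; and $\pi_n DE\cong M$ as $Q$-modules, i.e. there are isomorphisms from the groups $\pi_n(DE(a,b),x)$ to the groups of arrows of $M$ over the identity of $p(x)$, compatible with the actions of the arrows of the groupoids $Q(a,b)$ (by transport along edges in $DE(a,b)$, and by conjugation by $\phi$ in $M$) and with composition in the $\mathsf{Cat}_{\mathcal{O}}$ direction. -/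

import Mathlib

open CategoryTheory Limits Opposite MonoidalCategory CartesianMonoidalCategory MonObj

attribute [local instance] Over.cartesianMonoidalCategory Over.braidedCategory

universe v w u

noncomputable section

/-! ### Small categories with a fixed set of objects -/

/-- A small category with set of objects `O`. -/
structure CatO (O : Type u) : Type (u + 1) where
  Hom : O → O → Type u
  id : ∀ a, Hom a a
  comp : ∀ {a b c}, Hom a b → Hom b c → Hom a c
  id_comp : ∀ {a b} (f : Hom a b), comp (id a) f = f
  comp_id : ∀ {a b} (f : Hom a b), comp f (id b) = f
  assoc : ∀ {a b c d} (f : Hom a b) (g : Hom b c) (h : Hom c d),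
    comp (comp f g) h = comp f (comp g h)

namespace CatO

/-- A functor between categories with object set `O` which is the identity on objects. -/
@[ext]
structure Functor {O : Type u} (C D : CatO O) : Type u where
  map : ∀ {a b}, C.Hom a b → D.Hom a b
  map_id : ∀ a, map (C.id a) = D.id a
  map_comp : ∀ {a b c} (f : C.Hom a b) (g : C.Hom b c), map (C.comp f g) = D.comp (map f) (map g)

instance (O : Type u) : Category.{u} (CatO O) where
  Hom := CatO.Functor
  id C := ⟨fun f => f, fun _ => rfl, fun _ _ => rfl⟩
  comp F G := ⟨fun f => G.map (F.map f), fun a => by rw [F.map_id, G.map_id],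
    fun f g => by rw [F.map_comp, G.map_comp]⟩

/-- The action of a morphism of `CatO O` on arrows. -/
def mapHom {O : Type u} {C D : CatO O} (F : C ⟶ D) {a b : O} (f : C.Hom a b) : D.Hom a b :=
  Functor.map F f

@[simp] lemma mapHom_id {O : Type u} (C : CatO O) {a b : O} (f : C.Hom a b) :
    mapHom (𝟙 C) f = f := rfl

@[simp] lemma mapHom_comp {O : Type u} {C D E : CatO O} (F : C ⟶ D) (G : D ⟶ E) {a b : O}
    (f : C.Hom a b) : mapHom (F ≫ G) f = mapHom G (mapHom F f) := rfl

lemma hom_ext' {O : Type u} {C D : CatO O} {F G : C ⟶ D}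
    (h : ∀ {a b : O} (f : C.Hom a b), mapHom F f = mapHom G f) : F = G := by
  apply Functor.ext
  funext a b f
  exact h f

/-- The functor sending a category with object set `O` to its set of arrows from `a` to `b`. -/
def homFunctor {O : Type u} (a b : O) : CatO O ⥤ Type u where
  obj C := C.Hom a b
  map F := ↾(mapHom F)

/-- The arrows of the fibre product: pairs of arrows with the same image. -/
def fibreProduct {O : Type u} {A B X : CatO O} (F : A ⟶ X) (G : B ⟶ X) : CatO O where
  Hom a b := {p : A.Hom a b × B.Hom a b // mapHom F p.1 = mapHom G p.2}
  id a := ⟨(A.id a, B.id a), (Functor.map_id F a).trans (Functor.map_id G a).symm⟩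
  comp p q := ⟨(A.comp p.1.1 q.1.1, B.comp p.1.2 q.1.2),
    ((Functor.map_comp F _ _).trans (congrArg₂ X.comp p.2 q.2)).trans
      (Functor.map_comp G _ _).symm⟩
  id_comp _ := Subtype.ext (Prod.ext (A.id_comp _) (B.id_comp _))
  comp_id _ := Subtype.ext (Prod.ext (A.comp_id _) (B.comp_id _))
  assoc _ _ _ := Subtype.ext (Prod.ext (A.assoc _ _ _) (B.assoc _ _ _))

lemma isPullback_fibreProduct {O : Type u} {A B X : CatO O} (F : A ⟶ X) (G : B ⟶ X) :
    IsPullback (P := fibreProduct F G)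
      (⟨fun p => p.1.1, fun _ => rfl, fun _ _ => rfl⟩ : CatO.Functor (fibreProduct F G) A)
      (⟨fun p => p.1.2, fun _ => rfl, fun _ _ => rfl⟩ : CatO.Functor (fibreProduct F G) B) F G where
  w := hom_ext' fun p => p.2
  isLimit' := ⟨PullbackCone.IsLimit.mk _
    (fun s => (⟨fun t => ⟨(mapHom s.fst t, mapHom s.snd t),
        congrArg (fun (H : s.pt ⟶ X) => mapHom H t) s.condition⟩,
      fun a => Subtype.ext (Prod.ext (Functor.map_id s.fst a) (Functor.map_id s.snd a)),
      fun f g => Subtype.ext (Prod.ext (Functor.map_comp s.fst f g)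
        (Functor.map_comp s.snd f g))⟩ : CatO.Functor s.pt (fibreProduct F G)))
    (fun _ => rfl) (fun _ => rfl)
    (fun s _ h₁ h₂ => hom_ext' fun t => Subtype.ext (Prod.ext
      (congrArg (fun (H : s.pt ⟶ A) => mapHom H t) h₁)
      (congrArg (fun (H : s.pt ⟶ B) => mapHom H t) h₂)))⟩

instance (O : Type u) : HasPullbacks (CatO O) :=
  @hasPullbacks_of_hasLimit_cospan _ _ fun {_ _ _ F G} =>
    (isPullback_fibreProduct F G).hasPullback

end CatO

/-! ### Fibre powers -/

/-- Chosen fibre powers `A ×_X ⋯ ×_X A` of morphisms `p : A ⟶ X`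
(the `0`-th fibre power is `X`). -/
class FibrePowers (𝒟 : Type w) [Category.{v} 𝒟] where
  pow {A X : 𝒟} (p : A ⟶ X) (k : ℕ) : 𝒟
  base {A X : 𝒟} (p : A ⟶ X) (k : ℕ) : pow p k ⟶ X
  proj {A X : 𝒟} (p : A ⟶ X) (k : ℕ) (i : Fin k) : pow p k ⟶ A
  proj_comp {A X : 𝒟} (p : A ⟶ X) (k : ℕ) (i : Fin k) : proj p k i ≫ p = base p k
  lift {A X : 𝒟} (p : A ⟶ X) (k : ℕ) {T : 𝒟} (x : T ⟶ X) (f : Fin k → (T ⟶ A))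
    (h : ∀ i, f i ≫ p = x) : T ⟶ pow p k
  lift_base {A X : 𝒟} (p : A ⟶ X) (k : ℕ) {T : 𝒟} (x : T ⟶ X) (f : Fin k → (T ⟶ A))
    (h : ∀ i, f i ≫ p = x) : lift p k x f h ≫ base p k = x
  lift_proj {A X : 𝒟} (p : A ⟶ X) (k : ℕ) {T : 𝒟} (x : T ⟶ X) (f : Fin k → (T ⟶ A))
    (h : ∀ i, f i ≫ p = x) (i : Fin k) : lift p k x f h ≫ proj p k i = f i
  hom_ext {A X : 𝒟} (p : A ⟶ X) (k : ℕ) {T : 𝒟} {f g : T ⟶ pow p k}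
    (h₀ : f ≫ base p k = g ≫ base p k) (h : ∀ i, f ≫ proj p k i = g ≫ proj p k i) : f = g

attribute [simp] FibrePowers.lift_base FibrePowers.lift_proj FibrePowers.proj_comp

@[simp] lemma FibrePowers.lift_base_assoc {𝒟 : Type w} [Category.{v} 𝒟] [FibrePowers 𝒟]
    {A X T Z : 𝒟} (p : A ⟶ X) (k : ℕ) (x : T ⟶ X) (f : Fin k → (T ⟶ A)) (h : ∀ i, f i ≫ p = x)
    (g : X ⟶ Z) : lift p k x f h ≫ base p k ≫ g = x ≫ g := by
  rw [← Category.assoc, lift_base]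

@[simp] lemma FibrePowers.lift_proj_assoc {𝒟 : Type w} [Category.{v} 𝒟] [FibrePowers 𝒟]
    {A X T Z : 𝒟} (p : A ⟶ X) (k : ℕ) (x : T ⟶ X) (f : Fin k → (T ⟶ A)) (h : ∀ i, f i ≫ p = x)
    (i : Fin k) (g : A ⟶ Z) : lift p k x f h ≫ proj p k i ≫ g = f i ≫ g := by
  rw [← Category.assoc, lift_proj]

/-- Fibre powers of categories with a fixed object set, computed on arrows. -/
instance (O : Type u) : FibrePowers (CatO O) where
  pow {A X} p k :=
    { Hom a b := {t : X.Hom a b × (Fin k → A.Hom a b) // ∀ i, CatO.mapHom p (t.2 i) = t.1}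
      id a := ⟨(X.id a, fun _ => A.id a), fun _ => CatO.Functor.map_id p a⟩
      comp s t := ⟨(X.comp s.1.1 t.1.1, fun i => A.comp (s.1.2 i) (t.1.2 i)), fun i =>
        (CatO.Functor.map_comp p _ _).trans (congrArg₂ X.comp (s.2 i) (t.2 i))⟩
      id_comp _ := Subtype.ext (Prod.ext (X.id_comp _) (funext fun _ => A.id_comp _))
      comp_id _ := Subtype.ext (Prod.ext (X.comp_id _) (funext fun _ => A.comp_id _))
      assoc _ _ _ := Subtype.ext (Prod.ext (X.assoc _ _ _) (funext fun _ => A.assoc _ _ _)) }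
  base _ _ := ⟨fun t => t.1.1, fun _ => rfl, fun _ _ => rfl⟩
  proj _ _ i := ⟨fun t => t.1.2 i, fun _ => rfl, fun _ _ => rfl⟩
  proj_comp _ _ i := CatO.hom_ext' fun t => t.2 i
  lift {_ _} _ _ {T} x f h := ⟨fun t => ⟨(CatO.mapHom x t, fun i => CatO.mapHom (f i) t), fun i =>
      congrArg (fun (H : T ⟶ _) => CatO.mapHom H t) (h i)⟩,
    fun a => Subtype.ext (Prod.ext (CatO.Functor.map_id x a)
      (funext fun i => CatO.Functor.map_id (f i) a)),
    fun s t => Subtype.ext (Prod.ext (CatO.Functor.map_comp x s t)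
      (funext fun i => CatO.Functor.map_comp (f i) s t))⟩
  lift_base _ _ _ _ _ _ := rfl
  lift_proj _ _ _ _ _ _ _ := rfl
  hom_ext {_ _} _ _ {T _ _} h₀ h := CatO.hom_ext' fun t => Subtype.ext (Prod.ext
    (congrArg (fun (H : T ⟶ _) => CatO.mapHom H t) h₀)
    (funext fun i => congrArg (fun (H : T ⟶ _) => CatO.mapHom H t) (h i)))

/-- Fibre powers of simplicial objects, computed degreewise. -/
instance FibrePowers.simplicialObject (𝒟 : Type w) [Category.{v} 𝒟] [FibrePowers 𝒟] :
    FibrePowers (SimplicialObject 𝒟) where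
  pow {A X} p k :=
    { obj j := FibrePowers.pow (p.app j) k
      map {j j'} α := FibrePowers.lift (p.app j') k (FibrePowers.base (p.app j) k ≫ X.map α)
        (fun i => FibrePowers.proj (p.app j) k i ≫ A.map α) (fun i => by
          rw [Category.assoc, p.naturality, ← Category.assoc, FibrePowers.proj_comp])
      map_id j := FibrePowers.hom_ext _ _ (by simp) (by simp)
      map_comp α β := FibrePowers.hom_ext _ _
        (by simp) (by simp) }
  base p k := { app j := FibrePowers.base (p.app j) k }
  proj p k i := { app j := FibrePowers.proj (p.app j) k i }
  proj_comp p k i := by ext j; simp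
  lift {A X} p k {T} x f h :=
    { app j := FibrePowers.lift (p.app j) k (x.app j) (fun i => (f i).app j)
        (fun i => by rw [← h i]; rfl)
      naturality j j' α := FibrePowers.hom_ext _ _ (by simp) (by simp) }
  lift_base p k _ x f h := by ext j; simp
  lift_proj p k _ x f h i := by ext j; simp
  hom_ext {_ _} _ _ {_ _ _} h₀ h := by
    apply NatTrans.ext
    funext j
    exact FibrePowers.hom_ext _ _ (congrArg (fun H => NatTrans.app H j) h₀)
      (fun i => congrArg (fun H => NatTrans.app H j) (h i))

/-! ### Abelian group objects in slices and their deloopings -/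

/-- The lifts of `x : T ⟶ X` along `p : A ⟶ X`, i.e. the morphisms from `x` to `p` in the slice
over `X`. -/
abbrev LiftsAlong {𝒟 : Type w} [Category.{v} 𝒟] {A X T : 𝒟} (p : A ⟶ X) (x : T ⟶ X) : Type v :=
  {f : T ⟶ A // f ≫ p = x}

/-- Restriction of lifts along `t : T' ⟶ T`. -/
abbrev LiftsAlong.precomp {𝒟 : Type w} [Category.{v} 𝒟] {A X T T' : 𝒟} {p : A ⟶ X} {x : T ⟶ X}
    (t : T' ⟶ T) (f : LiftsAlong p x) : LiftsAlong p (t ≫ x) :=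
  ⟨t ≫ f.1, by rw [Category.assoc, f.2]⟩

/-- An abelian group object in the slice category over `X`, in terms of generalized elements:
an object `proj : obj ⟶ X` of the slice together with abelian group structures on
the sets of morphisms into it in the slice, compatible with precomposition. -/
structure AbelianOver {𝒟 : Type w} [Category.{v} 𝒟] (X : 𝒟) where
  obj : 𝒟
  proj : obj ⟶ X
  grp : ∀ {T : 𝒟} (x : T ⟶ X), AddCommGroup (LiftsAlong proj x)
  precomp_add : ∀ {T T' : 𝒟} (t : T' ⟶ T) {x : T ⟶ X} (f g : LiftsAlong proj x),
    (f + g).precomp t = f.precomp t + g.precomp t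

namespace AbelianOver

attribute [instance] AbelianOver.grp

variable {𝒟 : Type w} [Category.{v} 𝒟]

/-- The unit section `X ⟶ A` of an abelian group object `A` over `X`. -/
def unit {X : 𝒟} (A : AbelianOver X) : X ⟶ A.obj := (0 : LiftsAlong A.proj (𝟙 X)).1

/-- The abelian group object in the above sense given by an abelian group object of
the cartesian monoidal category `Over X`. -/
def ofOver [HasPullbacks 𝒟] {X : 𝒟} (M : Over X) [GrpObj M] [IsCommMonObj M] :
    AbelianOver X where
  obj := M.left
  proj := M.hom
  grp {T} x := Equiv.addCommGroup (β := Additive (Over.mk x ⟶ M))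
    { toFun f := Additive.ofMul (Over.homMk f.1 f.2)
      invFun f := ⟨f.toMul.left, Over.w f.toMul⟩
      left_inv _ := rfl
      right_inv _ := rfl }
  precomp_add {T T'} t x f g := Subtype.ext (by
    have h := MonObj.comp_mul (M := M) (Over.homMk (V := Over.mk x) t : Over.mk (t ≫ x) ⟶ _)
      (Over.homMk f.1 f.2) (Over.homMk g.1 g.2)
    exact congrArg CommaMorphism.left h)


/-- Restriction of lifts along `t : T' ⟶ T` as a homomorphism. -/
def precompHom {X : 𝒟} (A : AbelianOver X) {T T' : 𝒟} (t : T' ⟶ T) {x : T ⟶ X} {x' : T' ⟶ X}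
    (h : t ≫ x = x') : LiftsAlong A.proj x →+ LiftsAlong A.proj x' :=
  AddMonoidHom.mk' (fun f => ⟨t ≫ f.1, by rw [Category.assoc, f.2, h]⟩) (fun f g => by
    subst h
    exact A.precomp_add t f g)

lemma comp_sum {X : 𝒟} (A : AbelianOver X) {T T' : 𝒟} (t : T' ⟶ T) {x : T ⟶ X} {x' : T' ⟶ X}
    (h : t ≫ x = x') {J : Type} (s : Finset J) (f : J → LiftsAlong A.proj x) :
    t ≫ (∑ i ∈ s, f i).1 =
      (∑ i ∈ s, (⟨t ≫ (f i).1, by rw [Category.assoc, (f i).2, h]⟩ : LiftsAlong A.proj x')).1 := by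
  exact congrArg Subtype.val (map_sum (A.precompHom t h) f s)

/-- For `α : ⦋m⦌ ⟶ ⦋k⦌` the edges `i → i + 1` of `⦋k⦌` of which the edge
`α j → α (j + 1)` is composed. -/
def segment {m k : SimplexCategory} (α : m ⟶ k) (j : Fin m.len) : Finset (Fin k.len) :=
  Finset.univ.filter fun i => α.toOrderHom j.castSucc ≤ i.castSucc ∧
    i.castSucc < α.toOrderHom j.succ

lemma segment_id (m : SimplexCategory) (j : Fin m.len) : segment (𝟙 m) j = {j} := by
  ext i
  simp only [segment, Finset.mem_filter, Finset.mem_univ, true_and, Finset.mem_singleton]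
  change j.castSucc ≤ i.castSucc ∧ i.castSucc < j.succ ↔ i = j
  simp only [Fin.le_def, Fin.lt_def, Fin.ext_iff, Fin.val_castSucc, Fin.val_succ]
  omega

lemma sum_segment_comp {G : Type v} [AddCommMonoid G] {l m k : SimplexCategory} (β : l ⟶ m)
    (α : m ⟶ k) (j : Fin l.len) (g : Fin k.len → G) :
    ∑ i ∈ segment β j, ∑ i' ∈ segment α i, g i' = ∑ i' ∈ segment (β ≫ α) j, g i' := by
  rw [← Finset.sum_biUnion]
  · congr 1
    ext i'
    simp only [segment, Finset.mem_biUnion, Finset.mem_filter, Finset.mem_univ, true_and]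
    change _ ↔ α.toOrderHom (β.toOrderHom j.castSucc) ≤ i'.castSucc ∧
      i'.castSucc < α.toOrderHom (β.toOrderHom j.succ)
    constructor
    · rintro ⟨i, ⟨h₁, h₂⟩, h₃, h₄⟩
      exact ⟨(α.toOrderHom.monotone h₁).trans h₃,
        h₄.trans_le (α.toOrderHom.monotone (Fin.castSucc_lt_iff_succ_le.1 h₂))⟩
    · rintro ⟨h₁, h₂⟩
      obtain ⟨p, hp, hmax⟩ := (Finset.univ.filter fun p =>
        α.toOrderHom p ≤ i'.castSucc).exists_max_image id
        ⟨β.toOrderHom j.castSucc, by simpa using h₁⟩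
      simp only [Finset.mem_filter, Finset.mem_univ, true_and, id] at hp hmax
      have hlt : p < β.toOrderHom j.succ := by
        by_contra hc
        exact absurd ((α.toOrderHom.monotone (not_lt.1 hc)).trans hp) (not_le.2 h₂)
      obtain ⟨i, rfl⟩ := Fin.eq_castSucc_of_ne_last
        (ne_of_lt (hlt.trans_le (Fin.le_last _)))
      refine ⟨i, ⟨hmax _ h₁, hlt⟩, hp, ?_⟩
      by_contra hc
      have := hmax _ (not_lt.1 hc)
      exact absurd this (not_le.2 (Fin.castSucc_lt_succ))
  · intro i₁ _ i₂ _ hne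
    rw [Function.onFun, Finset.disjoint_left]
    intro i' h₁ h₂
    simp only [segment, Finset.mem_filter, Finset.mem_univ, true_and] at h₁ h₂
    rcases lt_or_gt_of_ne hne with h | h
    · exact absurd (h₁.2.trans_le ((α.toOrderHom.monotone (Fin.succ_le_castSucc_iff.2 h)).trans
        h₂.1)) (lt_irrefl _)
    · exact absurd (h₂.2.trans_le ((α.toOrderHom.monotone (Fin.succ_le_castSucc_iff.2 h)).trans
        h₁.1)) (lt_irrefl _)

variable [FibrePowers 𝒟]

/-- The `i`-th projection of a fibre power, as a generalized element over the base. -/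
def coord {X : 𝒟} (A : AbelianOver X) (k : ℕ) (i : Fin k) :
    LiftsAlong A.proj (FibrePowers.base A.proj k) :=
  ⟨FibrePowers.proj A.proj k i, FibrePowers.proj_comp _ _ _⟩

/-- The nerve of the internal groupoid `A ×_X A ⟶ A ⇉ X` attached to an abelian group object `A`
over `X`: source and target are both the projection `A ⟶ X`, the identities are given by the unit
section `X ⟶ A`, and composition is the addition. In degree `k` it is the `k`-fold fibre power
of `A` over `X`, and the simplicial operators add up the consecutive arrows. -/
def deloopObj {X : 𝒟} (A : AbelianOver X) : SimplicialObject 𝒟 where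
  obj k := FibrePowers.pow A.proj k.unop.len
  map {k m} α := FibrePowers.lift A.proj m.unop.len (FibrePowers.base A.proj k.unop.len)
    (fun j => (∑ i ∈ segment α.unop j, A.coord k.unop.len i).1)
    (fun j => (∑ i ∈ segment α.unop j, A.coord k.unop.len i).2)
  map_id k := FibrePowers.hom_ext _ _ (by simp) (fun j => by
    rw [FibrePowers.lift_proj, unop_id, segment_id, Finset.sum_singleton, Category.id_comp]
    rfl)
  map_comp {k m l} α β := FibrePowers.hom_ext _ _ (by simp) (fun j => by
    rw [FibrePowers.lift_proj, Category.assoc, FibrePowers.lift_proj, unop_comp,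
      ← sum_segment_comp, A.comp_sum _ (FibrePowers.lift_base _ _ _ _ _)]
    congr 1
    refine Finset.sum_congr rfl fun i _ => Subtype.ext ?_
    exact (FibrePowers.lift_proj A.proj m.unop.len (FibrePowers.base A.proj k.unop.len)
      (fun j => (∑ i' ∈ segment α.unop j, A.coord k.unop.len i').1)
      (fun j => (∑ i' ∈ segment α.unop j, A.coord k.unop.len i').2) i).symm)

/-- The projection of the delooping of `A` to the discrete internal groupoid on `X`. -/
def deloopProj {X : 𝒟} (A : AbelianOver X) :
    A.deloopObj ⟶ (SimplicialObject.const 𝒟).obj X where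
  app k := FibrePowers.base A.proj k.unop.len
  naturality k m α := by
    exact (FibrePowers.lift_base _ _ _ _ _).trans (Category.comp_id _).symm


/-- The components of a generalized element of the delooping. -/
def components {X : 𝒟} (A : AbelianOver X) {T : SimplicialObject 𝒟}
    (x : T ⟶ (SimplicialObject.const 𝒟).obj X) (f : LiftsAlong A.deloopProj x)
    (k : SimplexCategoryᵒᵖ) (i : Fin k.unop.len) :
    LiftsAlong (X := X) (T := T.obj k) A.proj (x.app k) :=
  A.precompHom (f.1.app k) (congrArg (fun H => NatTrans.app H k) f.2) (A.coord _ i)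

/-- The group of families of components of generalized elements of the delooping. -/
def componentsSubgroup {X : 𝒟} (A : AbelianOver X) {T : SimplicialObject 𝒟}
    (x : T ⟶ (SimplicialObject.const 𝒟).obj X) :
    AddSubgroup (∀ k : SimplexCategoryᵒᵖ, Fin k.unop.len →
      LiftsAlong (X := X) (T := T.obj k) A.proj (x.app k)) where
  carrier := {g | ∀ {k m : SimplexCategoryᵒᵖ} (α : k ⟶ m) (j : Fin m.unop.len),
    A.precompHom (T.map α) ((x.naturality α).trans (Category.comp_id _)) (g m j) =
      ∑ i ∈ segment α.unop j, g k i}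
  add_mem' {g g'} hg hg' {k m} α j := by
    simp only [Pi.add_apply, map_add, Finset.sum_add_distrib, hg α j, hg' α j]
  zero_mem' {k m} α j := by simp
  neg_mem' {g} hg {k m} α j := by
    simp only [Pi.neg_apply, map_neg, Finset.sum_neg_distrib, hg α j]

/-- A generalized element of the delooping amounts to its components. -/
def componentsEquiv {X : 𝒟} (A : AbelianOver X) {T : SimplicialObject 𝒟}
    (x : T ⟶ (SimplicialObject.const 𝒟).obj X) :
    LiftsAlong A.deloopProj x ≃ A.componentsSubgroup x where
  toFun f := ⟨A.components x f, fun {k m} α j => Subtype.ext (by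
    have h₁ : T.map α ≫ f.1.app m = f.1.app k ≫ A.deloopObj.map α := f.1.naturality α
    have h₂ : A.deloopObj.map α ≫ FibrePowers.proj A.proj m.unop.len j =
      (∑ i ∈ segment α.unop j, A.coord k.unop.len i).1 := FibrePowers.lift_proj _ _ _ _ _ _
    have h₃ : f.1.app k ≫ FibrePowers.base A.proj k.unop.len = x.app k :=
      congrArg (fun H => NatTrans.app H k) f.2
    exact (Category.assoc _ _ _).symm.trans
      ((congrArg (fun H => H ≫ FibrePowers.proj A.proj m.unop.len j) h₁).trans
      ((Category.assoc _ _ _).trans ((congrArg (fun H => f.1.app k ≫ H) h₂).trans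
      (A.comp_sum _ h₃ _ _)))))⟩
  invFun g := ⟨
    { app k := FibrePowers.lift A.proj k.unop.len (x.app k) (fun i => (g.1 k i).1)
        (fun i => (g.1 k i).2)
      naturality k m α := by
        refine FibrePowers.hom_ext A.proj m.unop.len ?_ fun j => ?_
        · exact (Category.assoc _ _ _).trans
            ((congrArg (fun H => T.map α ≫ H) (FibrePowers.lift_base A.proj _ _ _ _)).trans
            (((x.naturality α).trans (Category.comp_id _)).trans
            ((FibrePowers.lift_base A.proj k.unop.len _ _ _).symm.trans
            ((congrArg (fun H => _ ≫ H) (FibrePowers.lift_base A.proj _ _ _ _).symm).trans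
            (Category.assoc _ _ _).symm))))
        · refine (Category.assoc _ _ _).trans
            ((congrArg (fun H => T.map α ≫ H) (FibrePowers.lift_proj A.proj _ _ _ _ j)).trans
            ((congrArg Subtype.val (g.2 α j)).trans (Eq.symm ((Category.assoc _ _ _).trans
            ((congrArg (fun H => _ ≫ H) (FibrePowers.lift_proj A.proj _ _ _ _ j)).trans
            ((A.comp_sum _ (FibrePowers.lift_base A.proj k.unop.len _ _ _) _ _).trans ?_))))))
          congr 1
          refine Finset.sum_congr rfl fun i _ => Subtype.ext ?_
          exact FibrePowers.lift_proj A.proj k.unop.len (x.app k) (fun i => (g.1 k i).1)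
            (fun i => (g.1 k i).2) i }, by
      apply NatTrans.ext
      funext k
      exact FibrePowers.lift_base A.proj k.unop.len _ _ _⟩
  left_inv f := Subtype.ext (by
    apply NatTrans.ext
    funext k
    refine FibrePowers.hom_ext A.proj k.unop.len ?_ fun j => ?_
    · exact (FibrePowers.lift_base A.proj k.unop.len _ _ _).trans
        (congrArg (fun H => NatTrans.app H k) f.2).symm
    · exact FibrePowers.lift_proj A.proj k.unop.len (x.app k)
        (fun i => (A.components x f k i).1) (fun i => (A.components x f k i).2) j)
  right_inv g := Subtype.ext (by
    funext k i
    exact Subtype.ext (FibrePowers.lift_proj A.proj k.unop.len (x.app k)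
      (fun i => (g.1 k i).1) (fun i => (g.1 k i).2) i))

/-- The delooping of an abelian group object `A` over `X`, as an abelian group object over
the discrete internal groupoid on `X`: the group structure is that of `A`, applied to each
of the components. -/
def deloop {X : 𝒟} (A : AbelianOver X) : AbelianOver ((SimplicialObject.const 𝒟).obj X) where
  obj := A.deloopObj
  proj := A.deloopProj
  grp x := (A.componentsEquiv x).addCommGroup
  precomp_add {T T'} t {x} f g := (A.componentsEquiv (t ≫ x)).injective (Subtype.ext (by
    let _ := (A.componentsEquiv x).addCommGroup
    let _ := (A.componentsEquiv (t ≫ x)).addCommGroup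
    have key : ∀ (h : LiftsAlong A.deloopProj x) (k : SimplexCategoryᵒᵖ) (i : Fin k.unop.len),
        (A.componentsEquiv (t ≫ x) (h.precomp t)).1 k i =
          A.precompHom (t.app k) rfl ((A.componentsEquiv x h).1 k i) := fun h k i =>
      Subtype.ext (Category.assoc _ _ _)
    have h₁ : A.componentsEquiv x (f + g) = A.componentsEquiv x f + A.componentsEquiv x g :=
      Equiv.apply_symm_apply _ _
    have h₂ : A.componentsEquiv (t ≫ x) (f.precomp t + g.precomp t) =
        A.componentsEquiv (t ≫ x) (f.precomp t) + A.componentsEquiv (t ≫ x) (g.precomp t) :=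
      Equiv.apply_symm_apply _ _
    funext k i
    rw [h₂]
    refine (key _ k i).trans ?_
    rw [h₁]
    refine (map_add (A.precompHom (t.app k) rfl) _ _).trans ?_
    exact (congrArg₂ (· + ·) (key f k i) (key g k i)).symm))

end AbelianOver

/-! ### `n`-fold simplicial objects and `n`-fold groupoids -/

/-- `MultiSimplicial 𝒞 m` is the category of `(m + 1)`-fold simplicial objects of `𝒞`, namely
simplicial objects in the category of `m`-fold ones. -/
def MultiSimplicial (𝒞 : Type (u + 1)) [Category.{u} 𝒞] : ℕ → Cat.{u, u + 1}
  | 0 => Cat.of (SimplicialObject 𝒞)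
  | m + 1 => Cat.of (SimplicialObject (MultiSimplicial 𝒞 m))

namespace MultiSimplicial

variable (𝒞 : Type (u + 1)) [Category.{u} 𝒞]

instance fibrePowers [FibrePowers 𝒞] : ∀ m, FibrePowers (MultiSimplicial 𝒞 m)
  | 0 => FibrePowers.simplicialObject 𝒞
  | m + 1 => @FibrePowers.simplicialObject (MultiSimplicial 𝒞 m) _ (fibrePowers m)

instance hasPullbacks [HasPullbacks 𝒞] : ∀ m, HasPullbacks (MultiSimplicial 𝒞 m)
  | 0 => inferInstanceAs (HasPullbacks (SimplicialObject 𝒞))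
  | m + 1 =>
    have := hasPullbacks m
    inferInstanceAs (HasPullbacks (SimplicialObject (MultiSimplicial 𝒞 m)))

variable {𝒞}

/-- The functor on multisimplicial objects obtained by applying a functor `F : 𝒞 ⥤ 𝒞'`
levelwise. -/
def map {𝒞' : Type (u + 1)} [Category.{u} 𝒞'] (F : 𝒞 ⥤ 𝒞') :
    ∀ m, MultiSimplicial 𝒞 m ⥤ MultiSimplicial 𝒞' m
  | 0 => (SimplicialObject.whiskering 𝒞 𝒞').obj F
  | m + 1 => (SimplicialObject.whiskering _ _).obj (map F m)

/-- The object in degree `0` of the first simplicial direction ("the object of objects"). -/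
def objects (𝒞 : Type (u + 1)) [Category.{u} 𝒞] (m : ℕ) :
    MultiSimplicial 𝒞 (m + 1) ⥤ MultiSimplicial 𝒞 m :=
  (evaluation SimplexCategoryᵒᵖ (MultiSimplicial 𝒞 m)).obj (op (SimplexCategory.mk 0))

/-- The simplicial object `Q` as an `(m + 1)`-fold simplicial object, constant in the first
`m` directions. -/
def disc (Q : SimplicialObject 𝒞) : ∀ m, MultiSimplicial 𝒞 m
  | 0 => Q
  | m + 1 => (SimplicialObject.const (MultiSimplicial 𝒞 m)).obj (disc Q m)

/-- The diagonal of a bisimplicial object. -/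
def bidiag (𝒞 : Type (u + 1)) [Category.{u} 𝒞] :
    SimplicialObject (SimplicialObject 𝒞) ⥤ SimplicialObject 𝒞 :=
  Functor.uncurry ⋙ (Functor.whiskeringLeft _ _ _).obj (Functor.diag SimplexCategoryᵒᵖ)

/-- The diagonal `k ↦ X k ⋯ k` of a multisimplicial object. -/
def diag : ∀ m, MultiSimplicial 𝒞 m ⥤ SimplicialObject 𝒞
  | 0 => 𝟭 (SimplicialObject 𝒞)
  | m + 1 => (SimplicialObject.whiskering (MultiSimplicial 𝒞 m) _).obj (diag m) ⋙ bidiag 𝒞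

/-- The diagonal of a simplicial object with values in `𝒟`, followed by a functor to simplicial
objects, in the case of a constant simplicial object. -/
def bidiagConst {𝒟 : Type (u + 1)} [Category.{u} 𝒟] (F : 𝒟 ⥤ SimplicialObject 𝒞) (X : 𝒟) :
    ((SimplicialObject.whiskering 𝒟 _).obj F ⋙ bidiag 𝒞).obj
      ((SimplicialObject.const 𝒟).obj X) ≅ F.obj X :=
  NatIso.ofComponents (fun k => Iso.refl ((F.obj X).obj k)) (by
    intro k l α
    refine (Category.comp_id _).trans (Eq.trans ?_ (Category.id_comp _).symm)
    change (F.map (𝟙 X)).app k ≫ (F.obj X).map α = (F.obj X).map α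
    rw [F.map_id]
    exact Category.id_comp _)

/-- The diagonal of `disc Q m` is `Q`. -/
def diagDisc (Q : SimplicialObject 𝒞) : ∀ m, (diag m).obj (disc Q m) ≅ Q
  | 0 => Iso.refl Q
  | m + 1 => bidiagConst (diag m) (disc Q m) ≪≫ diagDisc Q m

end MultiSimplicial

/-- A simplicial object is (the nerve of) an internal groupoid if it satisfies the Segal
conditions `X (k + 1) = X k ×_{X 0} X 1`, and if the pairs of an arrow and its composite with
a second arrow are the pairs of arrows with the same source, i.e. every arrow is invertible.
(The face `δ 1 : X 1 ⟶ X 0` is the source.) -/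
def IsInternalGroupoid {𝒟 : Type w} [Category.{v} 𝒟] (X : SimplicialObject 𝒟) : Prop :=
  (∀ k : ℕ, IsPullback (X.δ (Fin.last (k + 1)))
    (X.map (SimplexCategory.mkOfSucc (Fin.last k)).op)
    (X.map (SimplexCategory.const (SimplexCategory.mk 0) (SimplexCategory.mk k) (Fin.last k)).op)
    (X.δ (n := 0) 1)) ∧
  IsPullback (X.δ (n := 1) 2) (X.δ (n := 1) 1) (X.δ (n := 0) 1) (X.δ (n := 0) 1)

/-- The `(m + 1)`-fold groupoids in `𝒞`, as `(m + 1)`-fold simplicial objects (identified with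
their multinerves): internal groupoids in `m`-fold groupoids. -/
def IsMultiGroupoid {𝒞 : Type (u + 1)} [Category.{u} 𝒞] : ∀ m, MultiSimplicial 𝒞 m → Prop
  | 0 => fun X => IsInternalGroupoid (𝒟 := 𝒞) X
  | m + 1 => fun (X : SimplicialObject (MultiSimplicial 𝒞 m)) =>
    (∀ k, IsMultiGroupoid m (X.obj k)) ∧ IsInternalGroupoid X

/-- A module over an internal groupoid `Q` in `𝒞`: an abelian group object `M ⟶ Q` in the slice
over `Q` of the category of internal groupoids with object of objects `Q 0`, i.e. `M` is
an internal groupoid and `M ⟶ Q` is an isomorphism on objects of objects. -/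
structure GroupoidModule {𝒞 : Type (u + 1)} [Category.{u} 𝒞] [HasPullbacks 𝒞]
    (Q : SimplicialObject 𝒞) where
  toOver : Over Q
  [grpObj : GrpObj toOver]
  [isComm : IsCommMonObj toOver]
  isInternalGroupoid : IsInternalGroupoid toOver.left
  isIso_objects : IsIso (toOver.hom.app (op (SimplexCategory.mk 0)))

attribute [instance] GroupoidModule.grpObj GroupoidModule.isComm

/-- The inductive construction of the `(m + 1)`-fold groupoid `E^{(m + 1)}(Q, M)`, with
its projection to `d^{(m + 1)} Q` and its fibrewise group structure: `E^{(1)}(Q, M)` is `M`, and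
`E^{(m + 2)}(Q, M)` is the internal groupoid with object of objects `d^{(m + 1)} Q`,
object of arrows `E^{(m + 1)}(Q, M)`, and composition the addition of `E^{(m + 1)}(Q, M)`. -/
def eilenbergMacLane {𝒞 : Type (u + 1)} [Category.{u} 𝒞] [HasPullbacks 𝒞] [FibrePowers 𝒞]
    {Q : SimplicialObject 𝒞} (M : GroupoidModule Q) :
    ∀ m, AbelianOver (MultiSimplicial.disc Q m)
  | 0 => AbelianOver.ofOver (𝒟 := SimplicialObject 𝒞) (X := Q) M.toOver
  | m + 1 => (eilenbergMacLane M m).deloop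

/-! ### Simplicial categories and Eilenberg–Mac Lane objects -/

section

open Simplicial

variable {O : Type u}

/-- The mapping space from `a` to `b` of a simplicial category with object set `O`, i.e. of
a simplicial object in the category of categories with object set `O`. -/
def mapSpace (a b : O) : SimplicialObject (CatO O) ⥤ SSet.{u} :=
  (SimplicialObject.whiskering _ _).obj (CatO.homFunctor a b)

/-- Pointed `n`-simplices of the mapping space from `a` to `b` at `x`; for a Kan complex,
their homotopy classes form the `n`-th homotopy group at `x`. -/
abbrev PointedSimplex (X : SimplicialObject (CatO O)) (n : ℕ) {a b : O} (x : (X _⦋0⦌).Hom a b) :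
    Type u :=
  SSet.PtSimplex ((mapSpace a b).obj X) n x

/-- The `n`-simplex underlying a pointed `n`-simplex. -/
def PointedSimplex.simplex {X : SimplicialObject (CatO O)} {n : ℕ} {a b : O}
    {x : (X _⦋0⦌).Hom a b} (α : PointedSimplex X n x) : (X _⦋n⦌).Hom a b :=
  SSet.yonedaEquiv α.map

/-- Pointed simplices at `x` and at `y` correspond to each other under transport along
the edge `e` from `x` to `y`: there is a homotopy between them which is constantly `e` on the
boundary. -/
def TransportRel {X : SimplicialObject (CatO O)} {n : ℕ} {a b : O} (e : (X _⦋1⦌).Hom a b)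
    {x y : (X _⦋0⦌).Hom a b} (α : PointedSimplex X n x) (β : PointedSimplex X n y) : Prop :=
  ∃ H : Δ[n] ⊗ Δ[1] ⟶ (mapSpace a b).obj X,
    SSet.ι₀ ≫ H = α.map ∧ SSet.ι₁ ≫ H = β.map ∧
      (SSet.boundary n).ι ▷ Δ[1] ≫ H = snd _ _ ≫ SSet.yonedaEquiv.symm e

/-- The relation `m + m' = m''` for arrows of a module `M` over `Q` with the same image in `Q`. -/
def AddRel {Q : SimplicialObject (CatO O)} (M : GroupoidModule Q) {a b : O}
    (m m' m'' : (M.toOver.left _⦋1⦌).Hom a b) : Prop :=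
  ∃ z : ((M.toOver ⊗ M.toOver).left _⦋1⦌).Hom a b,
    CatO.mapHom ((fst M.toOver M.toOver).left.app (op ⦋1⦌)) z = m ∧
    CatO.mapHom ((snd M.toOver M.toOver).left.app (op ⦋1⦌)) z = m' ∧
    CatO.mapHom ((μ[M.toOver]).left.app (op ⦋1⦌)) z = m''

/-- The relation "`h` is the composite of `f` followed by `g`" for arrows of the internal
groupoid `X`. -/
def CompositeRel (X : SimplicialObject (CatO O)) {a b : O} (f g h : (X _⦋1⦌).Hom a b) : Prop :=
  ∃ s : (X _⦋2⦌).Hom a b, CatO.mapHom (X.δ 2) s = f ∧ CatO.mapHom (X.δ 0) s = g ∧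
    CatO.mapHom (X.δ 1) s = h

/-- An isomorphism `π_n X ≅ M` of modules over `Q`, for a simplicial category `X` over `Q`
whose fundamental track category is identified with `Q` by means of `p : X ⟶ Q`.
It consists of isomorphisms from the homotopy groups `π_n (X (a, b), x)` to the groups of arrows
of `M` lying over the identity of `p x`, compatible with the action of the arrows of the
groupoids `Q (a, b)` (by transport along edges in `X`, and by conjugation in `M`), and with
composition. -/
structure HomotopyModuleIso (n : ℕ) {Q : SimplicialObject (CatO O)} (M : GroupoidModule Q)
    (X : SimplicialObject (CatO O)) (p : X ⟶ Q) where
  toFun : ∀ {a b : O} {x : (X _⦋0⦌).Hom a b}, PointedSimplex X n x → (M.toOver.left _⦋1⦌).Hom a b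
  over_id : ∀ {a b : O} {x : (X _⦋0⦌).Hom a b} (α : PointedSimplex X n x),
    CatO.mapHom (M.toOver.hom.app (op ⦋1⦌)) (toFun α) =
      CatO.mapHom (Q.σ 0) (CatO.mapHom (p.app (op ⦋0⦌)) x)
  eq_iff : ∀ {a b : O} {x : (X _⦋0⦌).Hom a b} (α β : PointedSimplex X n x),
    toFun α = toFun β ↔ Nonempty (SSet.RelativeMorphism.Homotopy α β)
  surjective : ∀ {a b : O} (x : (X _⦋0⦌).Hom a b) (m : (M.toOver.left _⦋1⦌).Hom a b),
    CatO.mapHom (M.toOver.hom.app (op ⦋1⦌)) m =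
      CatO.mapHom (Q.σ 0) (CatO.mapHom (p.app (op ⦋0⦌)) x) →
    ∃ α : PointedSimplex X n x, toFun α = m
  map_add : ∀ {a b : O} {x : (X _⦋0⦌).Hom a b} (α β ω : PointedSimplex X n x) (i : Fin n),
    Nonempty (SSet.PtSimplex.MulStruct α β ω i) → AddRel M (toFun α) (toFun β) (toFun ω)
  map_transport : ∀ {a b : O} (e : (X _⦋1⦌).Hom a b) {x y : (X _⦋0⦌).Hom a b}
    (α : PointedSimplex X n x) (β : PointedSimplex X n y),
    CatO.mapHom (X.δ 1) e = x → CatO.mapHom (X.δ 0) e = y → TransportRel e α β →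
    ∃ h, CompositeRel M.toOver.left (toFun α) (CatO.mapHom ((η[M.toOver]).left.app (op ⦋1⦌))
        (CatO.mapHom (p.app (op ⦋1⦌)) e)) h ∧
      CompositeRel M.toOver.left (CatO.mapHom ((η[M.toOver]).left.app (op ⦋1⦌))
        (CatO.mapHom (p.app (op ⦋1⦌)) e)) (toFun β) h
  map_comp : ∀ {a b c : O} {x : (X _⦋0⦌).Hom a b} {y : (X _⦋0⦌).Hom b c}
    (α : PointedSimplex X n x) (β : PointedSimplex X n y)
    (ω : PointedSimplex X n ((X _⦋0⦌).comp x y)),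
    ω.simplex = (X _⦋n⦌).comp α.simplex β.simplex →
    toFun ω = (M.toOver.left _⦋1⦌).comp (toFun α) (toFun β)

/-- The simplicial category `X` over the track category `Q` is a (twisted) Eilenberg–Mac Lane
simplicial category of type `(M, n)` over `Q`: its mapping spaces are Kan complexes, it has
a section over `Q`, its fundamental track category (obtained by taking the fundamental
groupoids of the mapping spaces) is `Q`, the higher homotopy groups of its mapping spaces vanish
except in dimension `n`, and `π_n X` is isomorphic to `M` as a module over `Q`. -/
structure IsEilenbergMacLane (n : ℕ) {Q : SimplicialObject (CatO O)} (M : GroupoidModule Q)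
    (X : SimplicialObject (CatO O)) (p : X ⟶ Q) : Prop where
  kanComplex : ∀ a b, SSet.KanComplex ((mapSpace a b).obj X)
  exists_section : ∃ s : Q ⟶ X, s ≫ p = 𝟙 Q
  fundamentalGroupoid : ∀ a b, IsIso (SSet.hoFunctor.map ((mapSpace a b).map p))
  homotopyGroup_trivial : ∀ i, 2 ≤ i → i ≠ n → ∀ {a b : O} (x : (X _⦋0⦌).Hom a b)
    (α β : PointedSimplex X i x), Nonempty (SSet.RelativeMorphism.Homotopy α β)
  homotopyModule : Nonempty (HomotopyModuleIso n M X p)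

/-- An object `E ⟶ d^{(m + 1)} Q` of the category of `(m + 1)`-fold groupoids in categories with
object set `O`, over `d^{(m + 1)} Q`, is an Eilenberg–Mac Lane object of type `(M, m + 1)` if its
diagonal nerve is an Eilenberg–Mac Lane simplicial category of this type. -/
def IsEilenbergMacLaneObject {m : ℕ} {Q : SimplicialObject (CatO O)} (M : GroupoidModule Q)
    {E : MultiSimplicial (CatO O) m} (r : E ⟶ MultiSimplicial.disc Q m) : Prop :=
  IsMultiGroupoid m E ∧ IsEilenbergMacLane (m + 1) M ((MultiSimplicial.diag m).obj E)
    ((MultiSimplicial.diag m).map r ≫ (MultiSimplicial.diagDisc Q m).hom)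

end

end

/-!
Write `E^{(n)}` for `eilenbergMacLane M (n - 1)`. That it is an Eilenberg–Mac Lane object is
proved over a single mapping space `Q (a, b)` at a time, which is the nerve of a groupoid. There
`M` and the mapping spaces of the diagonals of the `E^{(n)}` are simplicial sets over `Q (a, b)`
with abelian group structures on the fibres over all simplices (`FibrewiseGroup`). An element of
degree `k` of the diagonal of `E^{(n + 1)}` is a `k`-tuple of elements of degree `k` of the
diagonal of `E^{(n)}` over the same simplex, and the simplicial operators add up consecutive
entries; hence the diagonal of `E^{(n + 1)}` is, fibrewise, the diagonal of the bar construction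
of that of `E^{(n)}`. It is convenient to encode tuples by their partial sums
(`FibrewiseGroup.BarStructure`, `MultiSimplicial.deloopBarStructure`): these are families indexed
by the vertices of a simplex, up to an additive constant.

The induction on `n` carries a description of the relative homotopy of `E^{(n)}` over `Q (a, b)`
by cycles, that is, elements all of whose faces vanish (`FibrewiseGroup.EMStructure`). It consists
of fillers for compatible families of faces, the vanishing of cycles of dimension greater than
`n`, the fact that cycles of positive dimension less than `n` are boundaries, and a homomorphism
`ev` from the elements of dimension `n` over a simplex `s` to the elements of `M` over the last
edge of `s`, which is bijective on cycles and satisfies a cocycle identity. The coefficients of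
this identity are twisted: it holds in the fibre of `M` over a triangle. For `n = 1` all of this
expresses that `M` is the nerve of a groupoid with the same objects as `Q`
(`IsGroupoidModule.emStructure`), and the step from `n` to `n + 1` is `BarStructure.emStructure`:
all partial sums of a cycle, except the empty one, have the same face `δ 0`, which is a cycle of
one dimension less, and `ev` is defined by means of it.

The defining properties of an Eilenberg–Mac Lane object follow from this description. Horns are
filled first in `Q (a, b)` and then in the fibre (`HasFillers.kanComplex`); the zero section is
inverse to the projection on fundamental groupoids (`isIso_hoFunctor_map`); pointed simplices are
the same as cycles over constant simplices, so that the other homotopy groups vanish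
(`nonempty_homotopy`) and `ev` identifies `π_n` with `M`. Homotopies, and more generally
transports along an edge, are treated by applying the cocycle identity to the top-dimensional
simplices of the prism `Δ[n] ⊗ Δ[1]` (`exists_triangles_of_prism`): along all but the last two of
them the value of `ev` is constant, and the last two give the two triangles in `M` which express
conjugation. Additivity is the cocycle identity over a constant simplex (`evPt_add`), and
compatibility with composition holds because `ev` comes from a morphism of `CatO O`
(`GroupoidModule.evFunctor`).

That `E^{(n)}` is an `n`-fold groupoid holds since fibre powers commute with the pullbacks in the
definition of internal groupoids, so that all levels of a delooping are multiple groupoids, and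
since the delooping itself is an internal groupoid by the universal property of fibre powers;
moreover the functors `CatO.homFunctor a b` preserve pullbacks. Finally, an abelian group object
given by generalized elements is one in the slice category by the Yoneda lemma
(`AbelianOver.grpObj`).
-/

noncomputable section

/-! ### Simplices of nerves of groupoids -/

section SimplicialSets

open Simplicial SimplexCategory

lemma SSet.map_map {X : SSet.{u}} {k l m : ℕ} (f : ⦋k⦌ ⟶ ⦋l⦌) (g : ⦋l⦌ ⟶ ⦋m⦌) (x : X _⦋m⦌) :
    X.map f.op (X.map g.op x) = X.map (f ≫ g).op x := by simp

lemma SSet.app_map {X Y : SSet.{u}} (p : X ⟶ Y) {k l : ℕ} (f : ⦋k⦌ ⟶ ⦋l⦌) (x : X _⦋l⦌) :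
    p.app _ (X.map f.op x) = Y.map f.op (p.app _ x) :=
  NatTrans.naturality_apply p f.op x

lemma SSet.map_congr {X : SSet.{u}} {k l : ℕ} {f g : ⦋k⦌ ⟶ ⦋l⦌} (h : f = g) (x : X _⦋l⦌) :
    X.map f.op x = X.map g.op x := by rw [h]

/-- The edge from the `i`-th to the `j`-th vertex of a simplex. -/
def SSet.edge (X : SSet.{u}) {k : ℕ} (i j : Fin (k + 1)) (h : i ≤ j) (x : X _⦋k⦌) : X _⦋1⦌ :=
  X.map (mkOfLe i j h).op x

/-- The `i`-th vertex of a simplex. -/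
def SSet.vertex (X : SSet.{u}) {k : ℕ} (i : Fin (k + 1)) (x : X _⦋k⦌) : X _⦋0⦌ :=
  X.map (SimplexCategory.const ⦋0⦌ ⦋k⦌ i).op x

/-- The triangle on three vertices of a simplex. -/
def SSet.triangle (X : SSet.{u}) {k : ℕ} (i j l : Fin (k + 1)) (h : i ≤ j) (h' : j ≤ l)
    (x : X _⦋k⦌) : X _⦋2⦌ :=
  X.map (mkOfLeComp i j l h h').op x

section

variable {X : SSet.{u}} {k l : ℕ}

lemma SSet.edge_map (f : ⦋l⦌ ⟶ ⦋k⦌) (i j : Fin (l + 1)) (h : i ≤ j) (x : X _⦋k⦌) :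
    X.edge i j h (X.map f.op x) = X.edge (f i) (f j) (f.toOrderHom.monotone h) x := by
  unfold SSet.edge
  rw [SSet.map_map]
  exact SSet.map_congr (Hom.ext_one_left _ _ (by rfl) (by rfl)) x

lemma SSet.vertex_map (f : ⦋l⦌ ⟶ ⦋k⦌) (i : Fin (l + 1)) (x : X _⦋k⦌) :
    X.vertex i (X.map f.op x) = X.vertex (f i) x := by
  unfold SSet.vertex
  rw [SSet.map_map]
  congr 2

lemma SSet.edge_δ (m : Fin (k + 2)) (i j : Fin (k + 1)) (h : i ≤ j) (x : X _⦋k + 1⦌) :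
    X.edge i j h (X.δ m x) =
      X.edge (m.succAbove i) (m.succAbove j) ((Fin.strictMono_succAbove m).monotone h) x :=
  SSet.edge_map (SimplexCategory.δ m) i j h x

lemma SSet.vertex_δ (m : Fin (k + 2)) (i : Fin (k + 1)) (x : X _⦋k + 1⦌) :
    X.vertex i (X.δ m x) = X.vertex (m.succAbove i) x :=
  SSet.vertex_map (SimplexCategory.δ m) i x

lemma SSet.δ_one_edge (i j : Fin (k + 1)) (h : i ≤ j) (x : X _⦋k⦌) :
    X.δ (n := 0) 1 (X.edge i j h x) = X.vertex i x := by
  change X.map (SimplexCategory.δ 1).op (X.map _ x) = _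
  rw [SSet.map_map]
  unfold SSet.vertex
  exact SSet.map_congr (Hom.ext_zero_left _ _ (by rfl)) x

lemma SSet.δ_zero_edge (i j : Fin (k + 1)) (h : i ≤ j) (x : X _⦋k⦌) :
    X.δ (n := 0) 0 (X.edge i j h x) = X.vertex j x := by
  change X.map (SimplexCategory.δ 0).op (X.map _ x) = _
  rw [SSet.map_map]
  unfold SSet.vertex
  exact SSet.map_congr (Hom.ext_zero_left _ _ (by rfl)) x

lemma SSet.δ_two_triangle (i j l : Fin (k + 1)) (h : i ≤ j) (h' : j ≤ l) (x : X _⦋k⦌) :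
    X.δ (n := 1) 2 (X.triangle i j l h h' x) = X.edge i j h x := by
  change X.map (SimplexCategory.δ 2).op (X.map _ x) = _
  rw [SSet.map_map]
  unfold SSet.edge
  exact SSet.map_congr (Hom.ext_one_left _ _ (by rfl) (by rfl)) x

lemma SSet.δ_one_triangle (i j l : Fin (k + 1)) (h : i ≤ j) (h' : j ≤ l) (x : X _⦋k⦌) :
    X.δ (n := 1) 1 (X.triangle i j l h h' x) = X.edge i l (h.trans h') x := by
  change X.map (SimplexCategory.δ 1).op (X.map _ x) = _
  rw [SSet.map_map]
  unfold SSet.edge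
  exact SSet.map_congr (Hom.ext_one_left _ _ (by rfl) (by rfl)) x

lemma SSet.δ_zero_triangle (i j l : Fin (k + 1)) (h : i ≤ j) (h' : j ≤ l) (x : X _⦋k⦌) :
    X.δ (n := 1) 0 (X.triangle i j l h h' x) = X.edge j l h' x := by
  change X.map (SimplexCategory.δ 0).op (X.map _ x) = _
  rw [SSet.map_map]
  unfold SSet.edge
  exact SSet.map_congr (Hom.ext_one_left _ _ (by rfl) (by rfl)) x

lemma SSet.δ_σ_eq_self {i : Fin (k + 2)} {j : Fin (k + 1)}
    (h : SimplexCategory.δ i ≫ SimplexCategory.σ j = 𝟙 _) (x : X _⦋k⦌) : X.δ i (X.σ j x) = x := by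
  refine (SSet.map_map (SimplexCategory.δ i) (SimplexCategory.σ j) x).trans ?_
  rw [h]
  simp

lemma SSet.δ_σ_eq_σ_δ {i : Fin (k + 3)} {j : Fin (k + 2)} {i' : Fin (k + 2)} {j' : Fin (k + 1)}
    (h : SimplexCategory.δ i ≫ SimplexCategory.σ j = SimplexCategory.σ j' ≫ SimplexCategory.δ i')
    (x : X _⦋k + 1⦌) : X.δ i (X.σ j x) = X.σ j' (X.δ i' x) :=
  (SSet.map_map (SimplexCategory.δ i) (SimplexCategory.σ j) x).trans
    ((SSet.map_congr h x).trans
      (SSet.map_map (SimplexCategory.σ j') (SimplexCategory.δ i') x).symm)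

lemma SSet.vertex_zero (x : X _⦋0⦌) (i : Fin 1) : X.vertex i x = x := by
  unfold SSet.vertex
  rw [show SimplexCategory.const ⦋0⦌ ⦋0⦌ i = 𝟙 _ from Hom.ext_zero_left _ _
    (Subsingleton.elim (α := Fin 1) _ _)]
  simp

lemma SSet.edge_zero_one (x : X _⦋1⦌) (h : (0 : Fin 2) ≤ 1) : X.edge 0 1 h x = x := by
  unfold SSet.edge
  rw [show mkOfLe (0 : Fin 2) 1 h = 𝟙 _ from Hom.ext_one_left _ _ (by rfl) (by rfl)]
  simp

lemma SSet.δ_zero_δ_zero (s : X _⦋2⦌) : X.δ (n := 0) 0 (X.δ (n := 1) 0 s) = X.vertex 2 s := by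
  rw [← SSet.vertex_zero (X.δ (n := 0) 0 _) 0, SSet.vertex_δ, SSet.vertex_δ]
  rfl

lemma SSet.δ_one_δ_zero (s : X _⦋2⦌) : X.δ (n := 0) 1 (X.δ (n := 1) 0 s) = X.vertex 1 s := by
  rw [← SSet.vertex_zero (X.δ (n := 0) 1 _) 0, SSet.vertex_δ, SSet.vertex_δ]
  rfl

lemma SSet.δ_zero_δ_one (s : X _⦋2⦌) : X.δ (n := 0) 0 (X.δ (n := 1) 1 s) = X.vertex 2 s := by
  rw [← SSet.vertex_zero (X.δ (n := 0) 0 _) 0, SSet.vertex_δ, SSet.vertex_δ]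
  rfl

lemma SSet.δ_one_δ_one (s : X _⦋2⦌) : X.δ (n := 0) 1 (X.δ (n := 1) 1 s) = X.vertex 0 s := by
  rw [← SSet.vertex_zero (X.δ (n := 0) 1 _) 0, SSet.vertex_δ, SSet.vertex_δ]
  rfl

lemma SSet.δ_zero_δ_two (s : X _⦋2⦌) : X.δ (n := 0) 0 (X.δ (n := 1) 2 s) = X.vertex 1 s := by
  rw [← SSet.vertex_zero (X.δ (n := 0) 0 _) 0, SSet.vertex_δ, SSet.vertex_δ]
  rfl

lemma SSet.δ_one_δ_two (s : X _⦋2⦌) : X.δ (n := 0) 1 (X.δ (n := 1) 2 s) = X.vertex 0 s := by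
  rw [← SSet.vertex_zero (X.δ (n := 0) 1 _) 0, SSet.vertex_δ, SSet.vertex_δ]
  rfl

end

namespace IsInternalGroupoid

variable {X : SSet.{u}} (hX : IsInternalGroupoid (𝒟 := Type u) X)
include hX

lemma segal_ext {k : ℕ} {a b : X _⦋k + 1⦌} (h : X.δ (Fin.last (k + 1)) a = X.δ (Fin.last (k + 1)) b)
    (h' : X.edge (Fin.last k).castSucc (Fin.last (k + 1)) (Fin.le_last _) a =
      X.edge (Fin.last k).castSucc (Fin.last (k + 1)) (Fin.le_last _) b) : a = b :=
  Types.ext_of_isPullback (hX.1 k) h h'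

lemma segal_exists {k : ℕ} (a : X _⦋k⦌) (e : X _⦋1⦌)
    (h : X.vertex (Fin.last k) a = X.δ (n := 0) 1 e) :
    ∃ b : X _⦋k + 1⦌, X.δ (Fin.last (k + 1)) b = a ∧
      X.edge (Fin.last k).castSucc (Fin.last (k + 1)) (Fin.le_last _) b = e :=
  Types.exists_of_isPullback (hX.1 k) a e h

lemma triangle_ext₀₂ {a b : X _⦋2⦌} (h₀ : X.δ (n := 1) 0 a = X.δ (n := 1) 0 b)
    (h₂ : X.δ (n := 1) 2 a = X.δ (n := 1) 2 b) : a = b := by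
  refine hX.segal_ext h₂ ?_
  have (c : X _⦋2⦌) : X.edge (Fin.last 1).castSucc (Fin.last 2) (Fin.le_last _) c =
      X.δ (n := 1) 0 c :=
    SSet.map_congr (f := mkOfLe _ _ _) (Hom.ext_one_left _ _ (by rfl) (by rfl)) c
  rw [this, this, h₀]

lemma triangle_ext₁₂ {a b : X _⦋2⦌} (h₁ : X.δ (n := 1) 1 a = X.δ (n := 1) 1 b)
    (h₂ : X.δ (n := 1) 2 a = X.δ (n := 1) 2 b) : a = b :=
  Types.ext_of_isPullback hX.2 h₂ h₁

lemma triangle_exists₁₂ (h f : X _⦋1⦌) (hf : X.δ (n := 0) 1 h = X.δ (n := 0) 1 f) :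
    ∃ s : X _⦋2⦌, X.δ (n := 1) 1 s = h ∧ X.δ (n := 1) 2 s = f := by
  obtain ⟨s, h₂, h₁⟩ := Types.exists_of_isPullback hX.2 f h hf.symm
  exact ⟨s, h₁, h₂⟩

/-- Three edges with the same source span a `3`-simplex. -/
lemma tetrahedron_exists (r₁ r₂ r₃ : X _⦋1⦌) (h₁ : X.δ (n := 0) 1 r₁ = X.δ (n := 0) 1 r₂)
    (h₂ : X.δ (n := 0) 1 r₂ = X.δ (n := 0) 1 r₃) :
    ∃ t : X _⦋3⦌, X.edge 0 1 (by decide) t = r₁ ∧ X.edge 0 2 (by decide) t = r₂ ∧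
      X.edge 0 3 (by decide) t = r₃ := by
  obtain ⟨s, hs₁, hs₂⟩ := hX.triangle_exists₁₂ r₂ r₁ h₁.symm
  obtain ⟨s', hs'₁, hs'₂⟩ := hX.triangle_exists₁₂ r₃ r₂ h₂.symm
  have hv : X.vertex (Fin.last 2) s = X.δ (n := 0) 1 (X.δ (n := 1) 0 s') := by
    rw [SSet.δ_one_δ_zero, ← SSet.δ_zero_δ_two, hs'₂, ← hs₁, SSet.δ_zero_δ_one]
    rfl
  obtain ⟨t, ht, ht'⟩ := hX.segal_exists s _ hv
  have e₁ : X.edge 0 1 (by decide) t = r₁ := by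
    rw [← hs₂, ← ht]
    change _ = X.δ (n := 1) 2 (X.δ (n := 2) 3 t)
    rw [← SSet.edge_zero_one (X.δ (n := 1) 2 (X.δ (n := 2) 3 t)) (by decide), SSet.edge_δ,
      SSet.edge_δ]
    rfl
  have e₂ : X.edge 0 2 (by decide) t = r₂ := by
    rw [← hs₁, ← ht]
    change _ = X.δ (n := 1) 1 (X.δ (n := 2) 3 t)
    rw [← SSet.edge_zero_one (X.δ (n := 1) 1 (X.δ (n := 2) 3 t)) (by decide), SSet.edge_δ,
      SSet.edge_δ]
    rfl
  refine ⟨t, e₁, e₂, ?_⟩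
  have : X.triangle 0 2 3 (by decide) (by decide) t = s' := by
    refine hX.triangle_ext₀₂ ?_ ?_
    · rw [SSet.δ_zero_triangle, ← ht']
      rfl
    · rw [SSet.δ_two_triangle, hs'₂, e₂]
  rw [← hs'₁, ← this, SSet.δ_one_triangle]

/-- The edge `g` has an inverse: it is the edge `1 → 2` of a `3`-simplex whose edges
starting at the vertex `0` are `g`, a degenerate edge and `g`. -/
lemma exists_inverse (g : X _⦋1⦌) : ∃ c : X _⦋2⦌, X.δ (n := 1) 0 c = g ∧
    X.δ (n := 1) 1 c = X.σ (n := 0) 0 (X.δ (n := 0) 0 g) := by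
  obtain ⟨t, h₁, h₂, h₃⟩ := hX.tetrahedron_exists g (X.σ (n := 0) 0 (X.δ (n := 0) 1 g)) g
    (SSet.δ_σ_eq_self (by decide) _).symm (SSet.δ_σ_eq_self (by decide) _)
  have e₁ : X.triangle 0 1 3 (by decide) (by decide) t = X.σ (n := 1) 1 g := by
    refine hX.triangle_ext₁₂ ?_ ?_
    · rw [SSet.δ_one_triangle, h₃, SSet.δ_σ_eq_self (by decide)]
    · rw [SSet.δ_two_triangle, h₁, SSet.δ_σ_eq_self (by decide)]
  have e₂ : X.triangle 0 2 3 (by decide) (by decide) t = X.σ (n := 1) 0 g := by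
    refine hX.triangle_ext₁₂ ?_ ?_
    · rw [SSet.δ_one_triangle, h₃, SSet.δ_σ_eq_self (by decide)]
    · rw [SSet.δ_two_triangle, h₂, SSet.δ_σ_eq_σ_δ (i' := 1) (j' := 0) (by decide)]
  refine ⟨X.triangle 1 2 3 (by decide) (by decide) t, ?_, ?_⟩
  · rw [SSet.δ_zero_triangle, ← SSet.δ_zero_triangle 0 2 3 (by decide) (by decide), e₂,
      SSet.δ_σ_eq_self (by decide)]
  · rw [SSet.δ_one_triangle, ← SSet.δ_zero_triangle 0 1 3 (by decide) (by decide), e₁,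
      SSet.δ_σ_eq_σ_δ (i' := 0) (j' := 0) (by decide)]

lemma triangle_exists₀₁ (g h : X _⦋1⦌) (hgh : X.δ (n := 0) 0 g = X.δ (n := 0) 0 h) :
    ∃ s : X _⦋2⦌, X.δ (n := 1) 0 s = g ∧ X.δ (n := 1) 1 s = h := by
  obtain ⟨c, hc₀, hc₁⟩ := hX.exists_inverse g
  obtain ⟨d, hd₀, hd₁⟩ := hX.exists_inverse h
  have hc : X.δ (n := 0) 1 (X.δ (n := 1) 2 c) = X.δ (n := 0) 0 g := by
    rw [SSet.δ_one_δ_two, ← SSet.δ_one_δ_one, hc₁, SSet.δ_σ_eq_self (by decide)]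
  have hd : X.δ (n := 0) 1 (X.δ (n := 1) 2 d) = X.δ (n := 0) 0 g := by
    rw [SSet.δ_one_δ_two, ← SSet.δ_one_δ_one, hd₁, SSet.δ_σ_eq_self (by decide), hgh]
  obtain ⟨t, h₁, h₂, h₃⟩ := hX.tetrahedron_exists (X.δ (n := 1) 2 d) (X.δ (n := 1) 2 c)
    (X.σ (n := 0) 0 (X.δ (n := 0) 0 g)) (hd.trans hc.symm)
    (hc.trans (SSet.δ_σ_eq_self (by decide) _).symm)
  have e₁ : X.triangle 0 1 3 (by decide) (by decide) t = d := by
    refine hX.triangle_ext₁₂ ?_ ?_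
    · rw [SSet.δ_one_triangle, h₃, hd₁, hgh]
    · rw [SSet.δ_two_triangle, h₁]
  have e₂ : X.triangle 0 2 3 (by decide) (by decide) t = c := by
    refine hX.triangle_ext₁₂ ?_ ?_
    · rw [SSet.δ_one_triangle, h₃, hc₁]
    · rw [SSet.δ_two_triangle, h₂]
  refine ⟨X.triangle 1 2 3 (by decide) (by decide) t, ?_, ?_⟩
  · rw [SSet.δ_zero_triangle, ← SSet.δ_zero_triangle 0 2 3 (by decide) (by decide), e₂, hc₀]
  · rw [SSet.δ_one_triangle, ← SSet.δ_zero_triangle 0 1 3 (by decide) (by decide), e₁, hd₀]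

lemma triangle_ext₀₁ {a b : X _⦋2⦌} (h₀ : X.δ (n := 1) 0 a = X.δ (n := 1) 0 b)
    (h₁ : X.δ (n := 1) 1 a = X.δ (n := 1) 1 b) : a = b := by
  obtain ⟨s, hs₁, hs₂⟩ := hX.triangle_exists₁₂
    (X.σ (n := 0) 0 (X.δ (n := 0) 1 (X.δ (n := 1) 0 a))) (X.δ (n := 1) 0 a)
    (SSet.δ_σ_eq_self (by decide) _)
  -- composing the edge `δ 1` with the inverse of the edge `δ 0` recovers the edge `δ 2`
  have key (c : X _⦋2⦌) (hc : X.δ (n := 1) 0 c = X.δ (n := 1) 0 a) :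
      ∃ d : X _⦋2⦌, X.δ (n := 1) 0 d = X.δ (n := 1) 0 s ∧ X.δ (n := 1) 2 d = X.δ (n := 1) 1 c ∧
        X.δ (n := 1) 1 d = X.δ (n := 1) 2 c := by
    obtain ⟨t, ht, ht'⟩ := hX.segal_exists c (X.δ (n := 1) 0 s) (by
      rw [SSet.δ_one_δ_zero, ← SSet.δ_zero_δ_two, hs₂, ← hc, SSet.δ_zero_δ_zero]
      rfl)
    change X.edge 2 3 (by decide) t = _ at ht'
    have h01 : X.edge 0 1 (by decide) t = X.δ (n := 1) 2 c := by
      rw [← ht, ← SSet.edge_zero_one (X.δ (n := 1) 2 _) (by decide), SSet.edge_δ, SSet.edge_δ]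
      rfl
    have h02 : X.edge 0 2 (by decide) t = X.δ (n := 1) 1 c := by
      rw [← ht, ← SSet.edge_zero_one (X.δ (n := 1) 1 _) (by decide), SSet.edge_δ, SSet.edge_δ]
      rfl
    have h12 : X.edge 1 2 (by decide) t = X.δ (n := 1) 0 c := by
      rw [← ht, ← SSet.edge_zero_one (X.δ (n := 1) 0 _) (by decide), SSet.edge_δ, SSet.edge_δ]
      rfl
    have e₁ : X.triangle 1 2 3 (by decide) (by decide) t = s := by
      refine hX.triangle_ext₀₂ ?_ ?_
      · rw [SSet.δ_zero_triangle, ht']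
      · rw [SSet.δ_two_triangle, h12, hs₂, hc]
    have e₂ : X.triangle 0 1 3 (by decide) (by decide) t = X.σ (n := 1) 1 (X.δ (n := 1) 2 c) := by
      refine hX.triangle_ext₀₂ ?_ ?_
      · rw [SSet.δ_zero_triangle, ← SSet.δ_one_triangle 1 2 3 (by decide) (by decide), e₁, hs₁,
          ← hc, SSet.δ_one_δ_zero, SSet.δ_σ_eq_σ_δ (i' := 0) (j' := 0) (by decide),
          SSet.δ_zero_δ_two]
      · rw [SSet.δ_two_triangle, h01, SSet.δ_σ_eq_self (by decide)]
    refine ⟨X.triangle 0 2 3 (by decide) (by decide) t, ?_, ?_, ?_⟩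
    · rw [SSet.δ_zero_triangle, ht']
    · rw [SSet.δ_two_triangle, h02]
    · rw [SSet.δ_one_triangle, ← SSet.δ_one_triangle 0 1 3 (by decide) (by decide), e₂,
        SSet.δ_σ_eq_self (by decide)]
  obtain ⟨d, hd₀, hd₂, hd₁⟩ := key a rfl
  obtain ⟨d', hd'₀, hd'₂, hd'₁⟩ := key b h₀.symm
  have : d = d' := hX.triangle_ext₀₂ (hd₀.trans hd'₀.symm) (by rw [hd₂, hd'₂, h₁])
  exact hX.triangle_ext₀₂ h₀ (by rw [← hd₁, ← hd'₁, this])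

/-- The induction step for `edges_ext` in the case where `v` is not the last vertex. -/
lemma edges_ext_castSucc {k : ℕ} (v : Fin (k + 1))
    (ih : ∀ {a b : X _⦋k⦌}, X.vertex v a = X.vertex v b →
      (∀ i j (h : i < j), (i = v ∨ j = v) → X.edge i j h.le a = X.edge i j h.le b) → a = b)
    {a b : X _⦋k + 1⦌} (hv : X.vertex v.castSucc a = X.vertex v.castSucc b)
    (h : ∀ i j (h : i < j), (i = v.castSucc ∨ j = v.castSucc) →
      X.edge i j h.le a = X.edge i j h.le b) : a = b := by
  have hδ : X.δ (Fin.last (k + 1)) a = X.δ (Fin.last (k + 1)) b := by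
    refine ih ?_ fun i j hij hor => ?_
    · rw [SSet.vertex_δ, SSet.vertex_δ]
      simpa using hv
    · rw [SSet.edge_δ, SSet.edge_δ]
      refine h _ _ ((Fin.strictMono_succAbove _) hij) ?_
      simpa using hor
  refine hX.segal_ext hδ ?_
  rcases eq_or_ne v (Fin.last k) with rfl | hne
  · exact h _ _ (Fin.castSucc_lt_last _) (Or.inl rfl)
  · have hlt : v.castSucc < (Fin.last k).castSucc := by
      simpa using lt_of_le_of_ne (Fin.le_last v) hne
    have : X.triangle v.castSucc (Fin.last k).castSucc (Fin.last (k + 1)) hlt.le (Fin.le_last _) a =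
        X.triangle v.castSucc (Fin.last k).castSucc (Fin.last (k + 1)) hlt.le
          (Fin.le_last _) b := by
      refine hX.triangle_ext₁₂ ?_ ?_
      · rw [SSet.δ_one_triangle, SSet.δ_one_triangle]
        exact h _ _ (Fin.castSucc_lt_last _) (Or.inl rfl)
      · rw [SSet.δ_two_triangle, SSet.δ_two_triangle]
        exact h _ _ hlt (Or.inl rfl)
    rw [← SSet.δ_zero_triangle _ _ _ hlt.le, this, SSet.δ_zero_triangle]

/-- A simplex of the nerve of a groupoid is determined by its edges containing a given vertex. -/
lemma edges_ext {k : ℕ} (v : Fin (k + 1)) {a b : X _⦋k⦌} (hv : X.vertex v a = X.vertex v b)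
    (h : ∀ i j (h : i < j), (i = v ∨ j = v) → X.edge i j h.le a = X.edge i j h.le b) :
    a = b := by
  induction k with
  | zero => rwa [SSet.vertex_zero, SSet.vertex_zero] at hv
  | succ k ih =>
    induction v using Fin.lastCases with
    | cast v => exact hX.edges_ext_castSucc v (ih v) hv h
    | last =>
      refine hX.edges_ext_castSucc (Fin.last k) (ih _) ?_ fun i j hij hor => ?_
      · rw [← SSet.δ_one_edge _ (Fin.last (k + 1)) (Fin.le_last _),
          ← SSet.δ_one_edge _ (Fin.last (k + 1)) (Fin.le_last _),
          h _ _ (Fin.castSucc_lt_last _) (Or.inr rfl)]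
      · rcases hor with rfl | rfl
        · obtain rfl : j = Fin.last (k + 1) := by
            rw [Fin.castSucc_lt_iff_succ_le, Fin.succ_last, Fin.last_le_iff] at hij
            exact hij
          exact h _ _ hij (Or.inr rfl)
        · have : X.triangle i (Fin.last k).castSucc (Fin.last (k + 1)) hij.le (Fin.le_last _) a =
              X.triangle i (Fin.last k).castSucc (Fin.last (k + 1)) hij.le (Fin.le_last _) b := by
            refine hX.triangle_ext₀₁ ?_ ?_
            · rw [SSet.δ_zero_triangle, SSet.δ_zero_triangle]
              exact h _ _ (Fin.castSucc_lt_last _) (Or.inr rfl)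
            · rw [SSet.δ_one_triangle, SSet.δ_one_triangle]
              exact h _ _ (hij.trans (Fin.castSucc_lt_last _)) (Or.inr rfl)
          rw [← SSet.δ_two_triangle _ _ _ hij.le (Fin.le_last _), this, SSet.δ_two_triangle]

/-- The induction step for `exists_edges` in the case where `v` is not the last vertex. -/
lemma exists_edges_castSucc {k : ℕ} (v : Fin (k + 1))
    (ih : ∀ (x : X _⦋0⦌) (r : Fin (k + 1) → X _⦋1⦌), (∀ j, v < j → X.δ (n := 0) 1 (r j) = x) →
      (∀ j, j < v → X.δ (n := 0) 0 (r j) = x) → ∃ a : X _⦋k⦌, X.vertex v a = x ∧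
        (∀ j (h : v < j), X.edge v j h.le a = r j) ∧ ∀ j (h : j < v), X.edge j v h.le a = r j)
    (x : X _⦋0⦌) (r : Fin (k + 2) → X _⦋1⦌)
    (h₁ : ∀ j, v.castSucc < j → X.δ (n := 0) 1 (r j) = x)
    (h₀ : ∀ j, j < v.castSucc → X.δ (n := 0) 0 (r j) = x) :
    ∃ a : X _⦋k + 1⦌, X.vertex v.castSucc a = x ∧
      (∀ j (h : v.castSucc < j), X.edge v.castSucc j h.le a = r j) ∧
        ∀ j (h : j < v.castSucc), X.edge j v.castSucc h.le a = r j := by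
  obtain ⟨a', ha', ha'₁, ha'₀⟩ := ih x (fun j => r j.castSucc)
    (fun j hj => h₁ _ (by simpa using hj)) (fun j hj => h₀ _ (by simpa using hj))
  have hcast (a : X _⦋k + 1⦌) (ha : X.δ (Fin.last (k + 1)) a = a') (i j : Fin (k + 1))
      (hij : i ≤ j) (hij' : i.castSucc ≤ j.castSucc) :
      X.edge i.castSucc j.castSucc hij' a = X.edge i j hij a' := by
    rw [← ha, SSet.edge_δ]
    congr 1 <;> simp
  have hvert (a : X _⦋k + 1⦌) (ha : X.δ (Fin.last (k + 1)) a = a') :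
      X.vertex v.castSucc a = x := by
    rw [← ha', ← ha, SSet.vertex_δ, Fin.succAbove_last]
  rcases eq_or_ne v (Fin.last k) with rfl | hne
  · obtain ⟨a, ha, hae⟩ := hX.segal_exists a' (r (Fin.last (k + 1)))
      (ha'.trans (h₁ _ (Fin.castSucc_lt_last _)).symm)
    refine ⟨a, hvert a ha, fun j hj => ?_, fun j hj => ?_⟩
    · obtain rfl : j = Fin.last (k + 1) := by
        rw [Fin.castSucc_lt_iff_succ_le, Fin.succ_last, Fin.last_le_iff] at hj
        exact hj
      exact hae
    · obtain ⟨j, rfl⟩ := Fin.eq_castSucc_of_ne_last (hj.trans (Fin.castSucc_lt_last _)).ne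
      rw [hcast a ha j _ (Fin.castSucc_le_castSucc_iff.1 hj.le)]
      exact ha'₀ j (by simpa using hj)
  · have hlt : v.castSucc < (Fin.last k).castSucc := by
      simpa using lt_of_le_of_ne (Fin.le_last v) hne
    have hlt' : v < Fin.last k := by simpa using hlt
    obtain ⟨s, hs₁, hs₂⟩ := hX.triangle_exists₁₂ (r (Fin.last (k + 1)))
      (r (Fin.last k).castSucc)
      ((h₁ _ (Fin.castSucc_lt_last _)).trans (h₁ _ hlt).symm)
    obtain ⟨a, ha, hae⟩ := hX.segal_exists a' (X.δ (n := 1) 0 s) (by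
      rw [SSet.δ_one_δ_zero, ← SSet.δ_zero_δ_two, hs₂, ← ha'₁ _ hlt', SSet.δ_zero_edge])
    have hs : X.triangle v.castSucc (Fin.last k).castSucc (Fin.last (k + 1)) hlt.le
        (Fin.le_last _) a = s := by
      refine hX.triangle_ext₀₂ ?_ ?_
      · rw [SSet.δ_zero_triangle, hae]
      · rw [SSet.δ_two_triangle, hcast a ha _ _ hlt'.le, ha'₁ _ hlt', hs₂]
    refine ⟨a, hvert a ha, fun j hj => ?_, fun j hj => ?_⟩
    · induction j using Fin.lastCases with
      | cast j =>
        rw [hcast a ha _ j (Fin.castSucc_le_castSucc_iff.1 hj.le)]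
        exact ha'₁ j (by simpa using hj)
      | last => rw [← SSet.δ_one_triangle _ _ _ hlt.le (Fin.le_last _), hs, hs₁]
    · obtain ⟨j, rfl⟩ := Fin.eq_castSucc_of_ne_last (hj.trans (Fin.castSucc_lt_last _)).ne
      rw [hcast a ha j _ (Fin.castSucc_le_castSucc_iff.1 hj.le)]
      exact ha'₀ j (by simpa using hj)

/-- In the nerve of a groupoid, the edges of a simplex containing a given vertex can be prescribed
arbitrarily. -/
lemma exists_edges {k : ℕ} (v : Fin (k + 1)) (x : X _⦋0⦌) (r : Fin (k + 1) → X _⦋1⦌)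
    (h₁ : ∀ j, v < j → X.δ (n := 0) 1 (r j) = x) (h₀ : ∀ j, j < v → X.δ (n := 0) 0 (r j) = x) :
    ∃ a : X _⦋k⦌, X.vertex v a = x ∧ (∀ j (h : v < j), X.edge v j h.le a = r j) ∧
      ∀ j (h : j < v), X.edge j v h.le a = r j := by
  induction k generalizing x with
  | zero =>
    exact ⟨x, SSet.vertex_zero _ _, fun j hj => absurd hj (by omega),
      fun j hj => absurd hj (by omega)⟩
  | succ k ih =>
    induction v using Fin.lastCases with
    | cast v => exact hX.exists_edges_castSucc v (ih v) x r h₁ h₀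
    | last =>
      -- the edges to the last vertex determine the edges containing the last but one vertex
      choose s hs₀ hs₁ using fun j : Fin k => hX.triangle_exists₀₁ (r (Fin.last k).castSucc)
        (r j.castSucc.castSucc) ((h₀ _ (Fin.castSucc_lt_last _)).trans
          (h₀ _ (Fin.castSucc_lt_last _)).symm)
      obtain ⟨a, ha, ha₁, ha₀⟩ := hX.exists_edges_castSucc (Fin.last k) (ih _)
        (X.δ (n := 0) 1 (r (Fin.last k).castSucc))
        (Fin.lastCases (r (Fin.last k).castSucc) (Fin.lastCases (r (Fin.last k).castSucc)
          (fun j => X.δ (n := 1) 2 (s j)))) (fun j hj => by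
            obtain rfl : j = Fin.last (k + 1) := by
              rw [Fin.castSucc_lt_iff_succ_le, Fin.succ_last, Fin.last_le_iff] at hj
              exact hj
            simp) (fun j hj => by
            obtain ⟨j, rfl⟩ := Fin.eq_castSucc_of_ne_last (hj.trans (Fin.castSucc_lt_last _)).ne
            obtain ⟨j, rfl⟩ := Fin.eq_castSucc_of_ne_last (Fin.castSucc_lt_castSucc_iff.1 hj).ne
            rw [Fin.lastCases_castSucc, Fin.lastCases_castSucc, SSet.δ_zero_δ_two,
              ← SSet.δ_one_δ_zero, hs₀])
      have hl := ha₁ _ (Fin.castSucc_lt_last _)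
      rw [Fin.lastCases_last] at hl
      refine ⟨a, ?_, fun j hj => absurd hj (not_lt.2 (Fin.le_last _)), fun j hj => ?_⟩
      · rw [← SSet.δ_zero_edge _ _ (Fin.castSucc_lt_last (Fin.last k)).le, hl]
        exact h₀ _ (Fin.castSucc_lt_last _)
      · obtain ⟨j, rfl⟩ := Fin.eq_castSucc_of_ne_last hj.ne
        induction j using Fin.lastCases with
        | last => exact hl
        | cast j =>
          have hlt : j.castSucc.castSucc < (Fin.last k).castSucc := by simp
          have h := ha₀ _ hlt
          rw [Fin.lastCases_castSucc, Fin.lastCases_castSucc] at h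
          have : X.triangle _ _ _ hlt.le (Fin.le_last _) a = s j := by
            refine hX.triangle_ext₀₂ ?_ ?_
            · rw [SSet.δ_zero_triangle, hl, hs₀]
            · rw [SSet.δ_two_triangle, h]
          rw [← SSet.δ_one_triangle _ _ _ hlt.le (Fin.le_last _), this, hs₁]

end IsInternalGroupoid

/-- A family of `k`-simplices indexed by the faces in `J` of a `(k + 1)`-simplex is compatible if
its members agree on common faces. -/
def SSet.CompatibleOn (X : SSet.{u}) {k : ℕ} (J : Set (Fin (k + 2))) (a : Fin (k + 2) → X _⦋k⦌) :
    Prop :=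
  ∀ i ∈ J, ∀ j ∈ J, ∀ (l : ℕ) (f g : ⦋l⦌ ⟶ ⦋k⦌),
    f ≫ SimplexCategory.δ i = g ≫ SimplexCategory.δ j → X.map f.op (a i) = X.map g.op (a j)

lemma SSet.CompatibleOn.edge_eq {X : SSet.{u}} {k : ℕ} {J : Set (Fin (k + 2))}
    {a : Fin (k + 2) → X _⦋k⦌} (ha : X.CompatibleOn J a) {m n : Fin (k + 2)} (hm : m ∈ J)
    (hn : n ∈ J) {i j i' j' : Fin (k + 1)} (hij : i ≤ j) (hij' : i' ≤ j')
    (hi : m.succAbove i = n.succAbove i') (hj : m.succAbove j = n.succAbove j') :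
    X.edge i j hij (a m) = X.edge i' j' hij' (a n) :=
  ha m hm n hn 1 _ _ (Hom.ext_one_left _ _ hi hj)

/-- Fillers in the nerve of a groupoid for any family of faces not containing the face opposite
to `v`; the edges at `v` which belong to none of the given faces can be prescribed. -/
lemma IsInternalGroupoid.exists_filler {X : SSet.{u}} (hX : IsInternalGroupoid (𝒟 := Type u) X)
    {k : ℕ} (J : Set (Fin (k + 2))) (v : Fin (k + 2)) (hv : v ∉ J) (a : Fin (k + 2) → X _⦋k⦌)
    (ha : X.CompatibleOn J a) (c : X _⦋k + 1⦌)
    (hc : ∀ j ∈ J, ∀ v', j.succAbove v' = v → X.vertex v' (a j) = X.vertex v c) :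
    ∃ b : X _⦋k + 1⦌, (∀ j ∈ J, X.δ j b = a j) ∧ X.vertex v b = X.vertex v c ∧
      ∀ i j (h : i < j), (i = v ∨ j = v) → (∀ m ∈ J, m = i ∨ m = j) →
        X.edge i j h.le b = X.edge i j h.le c := by
  classical
  -- the prescribed edge between `v` and `i`
  have hr (i : Fin (k + 2)) : ∃ r : X _⦋1⦌,
      (∀ m ∈ J, ∀ p q (h : p ≤ q), m.succAbove p = v → m.succAbove q = i →
        r = X.edge p q h (a m)) ∧
      (∀ m ∈ J, ∀ p q (h : p ≤ q), m.succAbove p = i → m.succAbove q = v →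
        r = X.edge p q h (a m)) ∧
      ((∀ m ∈ J, m = i ∨ m = v) → (∀ h : v < i, r = X.edge v i h.le c) ∧
        ∀ h : i < v, r = X.edge i v h.le c) := by
    by_cases hi : ∃ m ∈ J, m ≠ i
    · obtain ⟨m, hm, hmi⟩ := hi
      have hmv : m ≠ v := fun h => hv (h ▸ hm)
      obtain ⟨p, hp⟩ := Fin.exists_succAbove_eq hmv.symm
      obtain ⟨q, hq⟩ := Fin.exists_succAbove_eq hmi.symm
      rcases le_total p q with hpq | hpq
      · refine ⟨X.edge p q hpq (a m), fun n hn p' q' h h₁ h₂ =>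
          ha.edge_eq hm hn _ _ (hp.trans h₁.symm) (hq.trans h₂.symm), fun n hn p' q' h h₁ h₂ => ?_,
          fun h => absurd (h m hm) (by tauto)⟩
        obtain rfl : v = i := le_antisymm
          (hp ▸ hq ▸ (Fin.strictMono_succAbove m).monotone hpq)
          (h₁ ▸ h₂ ▸ (Fin.strictMono_succAbove n).monotone h)
        exact ha.edge_eq hm hn _ _ (hp.trans h₁.symm) (hq.trans h₂.symm)
      · refine ⟨X.edge q p hpq (a m), fun n hn p' q' h h₁ h₂ => ?_, fun n hn p' q' h h₁ h₂ =>
          ha.edge_eq hm hn _ _ (hq.trans h₁.symm) (hp.trans h₂.symm),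
          fun h => absurd (h m hm) (by tauto)⟩
        obtain rfl : i = v := le_antisymm
          (hp ▸ hq ▸ (Fin.strictMono_succAbove m).monotone hpq)
          (h₁ ▸ h₂ ▸ (Fin.strictMono_succAbove n).monotone h)
        exact ha.edge_eq hm hn _ _ (hq.trans h₁.symm) (hp.trans h₂.symm)
    · push Not at hi
      have hne (m : Fin (k + 2)) (hm : m ∈ J) (p : Fin (k + 1)) : m.succAbove p ≠ i :=
        hi m hm ▸ Fin.succAbove_ne _ _
      rcases le_total v i with h | h
      · exact ⟨X.edge v i h c, fun m hm p q _ _ h₂ => absurd h₂ (hne m hm q),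
          fun m hm p q _ h₂ _ => absurd h₂ (hne m hm p), fun _ => ⟨fun _ => rfl,
            fun h' => absurd h' (not_lt.2 h)⟩⟩
      · exact ⟨X.edge i v h c, fun m hm p q _ _ h₂ => absurd h₂ (hne m hm q),
          fun m hm p q _ h₂ _ => absurd h₂ (hne m hm p), fun _ => ⟨
            fun h' => absurd h' (not_lt.2 h), fun _ => rfl⟩⟩
  choose r hr₁ hr₀ hrc using hr
  obtain ⟨b, hbv, hb₁, hb₀⟩ := hX.exists_edges v (X.vertex v c) r (fun i hi => by
    by_cases h : ∀ m ∈ J, m = i ∨ m = v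
    · rw [(hrc i h).1 hi, SSet.δ_one_edge]
    · push Not at h
      obtain ⟨m, hm, hmi, hmv⟩ := h
      obtain ⟨p, hp⟩ := Fin.exists_succAbove_eq hmv.symm
      obtain ⟨q, hq⟩ := Fin.exists_succAbove_eq hmi.symm
      have hpq : p < q := (Fin.strictMono_succAbove m).lt_iff_lt.1 (by rwa [hp, hq])
      rw [hr₁ i m hm p q hpq.le hp hq, SSet.δ_one_edge, hc m hm p hp]) (fun i hi => by
    by_cases h : ∀ m ∈ J, m = i ∨ m = v
    · rw [(hrc i h).2 hi, SSet.δ_zero_edge]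
    · push Not at h
      obtain ⟨m, hm, hmi, hmv⟩ := h
      obtain ⟨p, hp⟩ := Fin.exists_succAbove_eq hmv.symm
      obtain ⟨q, hq⟩ := Fin.exists_succAbove_eq hmi.symm
      have hpq : q < p := (Fin.strictMono_succAbove m).lt_iff_lt.1 (by rwa [hp, hq])
      rw [hr₀ i m hm q p hpq.le hq hp, SSet.δ_zero_edge, hc m hm p hp])
  refine ⟨b, fun m hm => ?_, hbv, fun i j hij hor hJ => ?_⟩
  · obtain ⟨p, hp⟩ := Fin.exists_succAbove_eq (show v ≠ m from fun h => hv (h ▸ hm))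
    refine hX.edges_ext p ?_ fun i j hij hor => ?_
    · rw [SSet.vertex_δ, hc m hm p hp, hp, hbv]
    · rw [SSet.edge_δ]
      rcases hor with rfl | rfl
      · rw [← hr₁ _ m hm i j hij.le hp rfl]
        subst hp
        exact hb₁ _ (Fin.strictMono_succAbove m hij)
      · rw [← hr₀ _ m hm i j hij.le rfl hp]
        subst hp
        exact hb₀ _ (Fin.strictMono_succAbove m hij)
  · rcases hor with rfl | rfl
    · rw [hb₁ j hij]
      exact (hrc j fun m hm => (hJ m hm).symm).1 hij
    · rw [hb₀ i hij]
      exact (hrc i hJ).2 hij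

end SimplicialSets

/-! ### Fibrewise abelian groups over a simplicial set -/

section FibrewiseGroups

open Simplicial SimplexCategory

lemma SimplexCategory.exists_common_face_of_lt {k l : ℕ} {i j : Fin (k + 2)} (hij : i < j)
    (f g : ⦋l⦌ ⟶ ⦋k⦌) (h : f ≫ δ i = g ≫ δ j) :
    ∃ (l' : ℕ) (r : ⦋l⦌ ⟶ ⦋l'⦌) (f' g' : ⦋l'⦌ ⟶ ⦋k⦌), f = r ≫ f' ∧ g = r ≫ g' ∧
      f' ≫ δ i = g' ≫ δ j ∧ ∀ m, m ≠ i → m ≠ j → ∃ m', i.succAbove (f'.toOrderHom m') = m := by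
  have hfg (x : Fin (l + 1)) : i.succAbove (f.toOrderHom x) = j.succAbove (g.toOrderHom x) :=
    congrArg (fun t : ⦋l⦌ ⟶ ⦋k + 1⦌ => t.toOrderHom x) h
  obtain _ | k := k
  · have h₁ := Fin.succAbove_ne i (f.toOrderHom 0)
    have h₂ := Fin.succAbove_ne j (g.toOrderHom 0)
    rw [← hfg] at h₂
    exfalso
    generalize i.succAbove (f.toOrderHom 0) = x at h₁ h₂
    rw [Ne, Fin.ext_iff] at h₁ h₂
    rw [Fin.lt_def] at hij
    have := x.2; have := i.2; have := j.2
    omega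
  · obtain ⟨i, rfl⟩ := Fin.eq_castSucc_of_ne_last (hij.trans_le (Fin.le_last _)).ne
    obtain ⟨j, rfl⟩ := Fin.eq_succ_of_ne_zero (Fin.ne_zero_of_lt hij)
    have hle : i ≤ j := by simpa [Fin.castSucc_lt_succ_iff] using hij
    have hs : i.castSucc.succAbove j = j.succ :=
      Fin.succAbove_of_le_castSucc _ _ (by simpa using hle)
    obtain ⟨r, hr⟩ := eq_comp_δ_of_not_surjective' f j fun x hx =>
      Fin.succAbove_ne j.succ (g.toOrderHom x) (by rw [← hfg, hx, hs])
    have hδ : δ j ≫ δ i.castSucc = δ i ≫ δ j.succ := (δ_comp_δ hle).symm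
    refine ⟨k, r, δ j, δ i, hr, ?_, hδ, fun m hmi hmj => ?_⟩
    · rw [← cancel_mono (δ j.succ), ← h, hr, Category.assoc, Category.assoc, hδ]
    · obtain ⟨m, rfl⟩ := Fin.exists_succAbove_eq hmi
      obtain ⟨m, rfl⟩ := Fin.exists_succAbove_eq (show m ≠ j from fun h => hmj (h ▸ hs))
      exact ⟨m, rfl⟩

/-- The maps into two distinct faces of a simplex which agree in the simplex factor through the
common face, which contains all the other vertices. -/
lemma SimplexCategory.exists_common_face {k l : ℕ} {i j : Fin (k + 2)} (hij : i ≠ j)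
    (f g : ⦋l⦌ ⟶ ⦋k⦌) (h : f ≫ δ i = g ≫ δ j) :
    ∃ (l' : ℕ) (r : ⦋l⦌ ⟶ ⦋l'⦌) (f' g' : ⦋l'⦌ ⟶ ⦋k⦌), f = r ≫ f' ∧ g = r ≫ g' ∧
      f' ≫ δ i = g' ≫ δ j ∧ ∀ m, m ≠ i → m ≠ j → ∃ m', i.succAbove (f'.toOrderHom m') = m := by
  rcases lt_or_gt_of_ne hij with hlt | hlt
  · exact exists_common_face_of_lt hlt f g h
  · obtain ⟨l', r, f', g', hf, hg, h', hm⟩ := exists_common_face_of_lt hlt g f h.symm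
    refine ⟨l', r, g', f', hg, hf, h'.symm, fun m hmi hmj => ?_⟩
    obtain ⟨m', hm'⟩ := hm m hmj hmi
    refine ⟨m', Eq.trans ?_ hm'⟩
    exact congrArg (fun t : ⦋l'⦌ ⟶ ⦋k + 1⦌ => t.toOrderHom m') h'.symm

lemma SimplexCategory.exists_notMem_range {k l : ℕ} (f : ⦋l⦌ ⟶ ⦋k⦌) (h : l < k) :
    ∃ j, ∀ x, f.toOrderHom x ≠ j := by
  by_contra! hc
  have := Fintype.card_le_of_surjective f.toOrderHom hc
  simp only [len_mk, Fintype.card_fin] at this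
  omega

/-- An abelian group object over the simplicial set `Q`: a simplicial set over `Q` with abelian
group structures on the fibres over the simplices of `Q`, compatible with the simplicial
operators. -/
structure FibrewiseGroup (Q : SSet.{u}) where
  tot : SSet.{u}
  p : tot ⟶ Q
  grp : ∀ {k : ℕ} (s : Q _⦋k⦌), AddCommGroup {a : tot _⦋k⦌ // p.app _ a = s}
  map_add : ∀ {k l : ℕ} (f : ⦋l⦌ ⟶ ⦋k⦌) {s : Q _⦋k⦌} (a b : {a : tot _⦋k⦌ // p.app _ a = s}),
    tot.map f.op (a + b).1 =
      ((⟨tot.map f.op a.1, (SSet.app_map p f a.1).trans (congrArg _ a.2)⟩ +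
        ⟨tot.map f.op b.1, (SSet.app_map p f b.1).trans (congrArg _ b.2)⟩ :
          {a : tot _⦋l⦌ // p.app _ a = Q.map f.op s})).1

namespace FibrewiseGroup

variable {Q : SSet.{u}}

/-- The fibre over a simplex of `Q`. -/
abbrev Fib (A : FibrewiseGroup Q) {k : ℕ} (s : Q _⦋k⦌) : Type u :=
  {a : A.tot _⦋k⦌ // A.p.app _ a = s}

instance (A : FibrewiseGroup Q) {k : ℕ} (s : Q _⦋k⦌) : AddCommGroup (A.Fib s) := A.grp s

section

variable (A : FibrewiseGroup Q) {k l m : ℕ}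

/-- The homomorphism between fibres given by a simplicial operator. -/
def res (f : ⦋l⦌ ⟶ ⦋k⦌) {s : Q _⦋k⦌} {t : Q _⦋l⦌} (h : Q.map f.op s = t) : A.Fib s →+ A.Fib t :=
  AddMonoidHom.mk' (fun a => ⟨A.tot.map f.op a.1,
    (SSet.app_map A.p f a.1).trans ((congrArg _ a.2).trans h)⟩) (fun a b => by
    subst h
    exact Subtype.ext (A.map_add f a b))

@[simp] lemma res_val (f : ⦋l⦌ ⟶ ⦋k⦌) {s : Q _⦋k⦌} {t : Q _⦋l⦌} (h : Q.map f.op s = t)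
    (a : A.Fib s) : (A.res f h a).1 = A.tot.map f.op a.1 := rfl

lemma res_res (f : ⦋l⦌ ⟶ ⦋k⦌) (g : ⦋m⦌ ⟶ ⦋l⦌) {s : Q _⦋k⦌} {t : Q _⦋l⦌} {r : Q _⦋m⦌}
    (h : Q.map f.op s = t) (h' : Q.map g.op t = r) (a : A.Fib s) :
    A.res g h' (A.res f h a) = A.res (g ≫ f) (by rw [← h', ← h, SSet.map_map]) a :=
  Subtype.ext (SSet.map_map _ _ _)

lemma res_congr {f f' : ⦋l⦌ ⟶ ⦋k⦌} (e : f = f') {s : Q _⦋k⦌} {t : Q _⦋l⦌}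
    (h : Q.map f.op s = t) (a : A.Fib s) : A.res f h a = A.res f' (e ▸ h) a := by
  subst e
  rfl

lemma res_comm {l' : ℕ} {f : ⦋l⦌ ⟶ ⦋k⦌} {g : ⦋m⦌ ⟶ ⦋l⦌} {f' : ⦋l'⦌ ⟶ ⦋k⦌} {g' : ⦋m⦌ ⟶ ⦋l'⦌}
    (e : g ≫ f = g' ≫ f') {s : Q _⦋k⦌} {t : Q _⦋l⦌} {t' : Q _⦋l'⦌} {r : Q _⦋m⦌}
    (h₁ : Q.map f.op s = t) (h₂ : Q.map g.op t = r) (h₁' : Q.map f'.op s = t')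
    (h₂' : Q.map g'.op t' = r) (a : A.Fib s) :
    A.res g h₂ (A.res f h₁ a) = A.res g' h₂' (A.res f' h₁' a) := by
  rw [res_res, res_res, res_congr A e]

lemma res_eq_zero_iff (f : ⦋l⦌ ⟶ ⦋k⦌) {s : Q _⦋k⦌} {t t' : Q _⦋l⦌}
    (h : Q.map f.op s = t) (h' : Q.map f.op s = t') (a : A.Fib s) :
    A.res f h a = 0 ↔ A.res f h' a = 0 := by
  subst h h'
  rfl

/-- If the face opposite to a vertex vanishes then so does the restriction along any operator
which misses this vertex. -/
lemma res_eq_zero_of_face (j : Fin (k + 2)) {s : Q _⦋k + 1⦌} {a : A.Fib s}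
    (ha : A.res (δ j) rfl a = 0) (f : ⦋l⦌ ⟶ ⦋k + 1⦌) (hf : ∀ x, f.toOrderHom x ≠ j) {t : Q _⦋l⦌}
    (h : Q.map f.op s = t) : A.res f h a = 0 := by
  obtain ⟨g, rfl⟩ := eq_comp_δ_of_not_surjective' f j hf
  subst h
  rw [← A.res_res (δ j) g rfl (SSet.map_map _ _ _), ha, map_zero]

/-- The elements of a fibre all of whose faces vanish. -/
def IsCycle {s : Q _⦋k⦌} (a : A.Fib s) : Prop :=
  ∀ (l : ℕ) (f : ⦋l⦌ ⟶ ⦋k⦌), l < k → A.res f rfl a = 0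

lemma isCycle_iff {s : Q _⦋k + 1⦌} {a : A.Fib s} :
    A.IsCycle a ↔ ∀ j, A.res (δ j) rfl a = 0 := by
  refine ⟨fun h j => h k _ (Nat.lt_succ_self k), fun h l f hl => ?_⟩
  obtain ⟨j, hj⟩ := SimplexCategory.exists_notMem_range f hl
  exact A.res_eq_zero_of_face j (h j) f hj _

lemma IsCycle.sub {A : FibrewiseGroup Q} {s : Q _⦋k⦌} {a b : A.Fib s} (ha : A.IsCycle a)
    (hb : A.IsCycle b) : A.IsCycle (a - b) :=
  fun l f hl => by rw [map_sub, ha l f hl, hb l f hl, sub_zero]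

/-- If only one face of an element can be nonzero, then this face is a cycle. -/
lemma isCycle_face (i : Fin (k + 2)) {s : Q _⦋k + 1⦌} {a : A.Fib s}
    (ha : ∀ j, j ≠ i → A.res (δ j) rfl a = 0) : A.IsCycle (A.res (δ i) rfl a) := by
  intro l f hl
  obtain ⟨j, hj⟩ := SimplexCategory.exists_notMem_range f hl
  rw [res_res]
  refine A.res_eq_zero_of_face (i.succAbove j) (ha _ (Fin.succAbove_ne i j)) _ (fun x hx => ?_) _
  exact hj x (Fin.succAbove_right_injective hx)

/-- Every compatible family of faces over the faces of a simplex `s` of `Q`, in which at least one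
face is not prescribed, extends to an element over `s`. -/
def HasFillers : Prop :=
  ∀ {k : ℕ} (s : Q _⦋k + 1⦌) (J : Set (Fin (k + 2))) (v : Fin (k + 2)), v ∉ J →
    ∀ a : ∀ j, A.Fib (Q.δ j s), A.tot.CompatibleOn J (fun j => (a j).1) →
      ∃ b : A.Fib s, ∀ j ∈ J, A.res (δ j) rfl b = a j

lemma zero_val_eq {s t : Q _⦋k⦌} (h : s = t) : (0 : A.Fib s).1 = (0 : A.Fib t).1 := by
  subst h
  rfl

variable {A} in
/-- An element `z` over `δ 0 s` is the face `δ 0` of an element over `s` whose other faces vanish,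
except possibly the face `i + 1`, provided that all faces of `z` other than `δ i` vanish. -/
lemma HasFillers.exists_of_face_zero (hA : A.HasFillers) {s : Q _⦋k + 1⦌} (z : A.Fib (Q.δ 0 s))
    (i : Fin (k + 1)) (hz : ∀ j, j ≠ i → ∀ (l : ℕ) (f : ⦋l⦌ ⟶ ⦋k⦌), (∀ x, f.toOrderHom x ≠ j) →
      A.res f rfl z = 0) :
    ∃ y : A.Fib s, A.res (δ 0) rfl y = z ∧ ∀ j, j ≠ 0 → j ≠ i.succ → A.res (δ j) rfl y = 0 := by
  classical
  let a (j : Fin (k + 2)) : A.Fib (Q.δ j s) := if h : j = 0 then h ▸ z else 0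
  have ha₀ : a 0 = z := by simp [a]
  have ha (j : Fin (k + 2)) (hj : j ≠ 0) : a j = 0 := by simp [a, hj]
  have hbase {p q : Fin (k + 2)} {l : ℕ} {f g : ⦋l⦌ ⟶ ⦋k⦌} (h : f ≫ δ p = g ≫ δ q) :
      Q.map f.op (Q.δ p s) = Q.map g.op (Q.δ q s) :=
    (SSet.map_map f (δ p) s).trans ((SSet.map_congr h s).trans (SSet.map_map g (δ q) s).symm)
  have hmixed {q : Fin (k + 2)} (hq : q ≠ 0) (hqi : q ≠ i.succ) {l : ℕ} {f g : ⦋l⦌ ⟶ ⦋k⦌}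
      (h : f ≫ δ 0 = g ≫ δ q) : A.tot.map f.op (a 0).1 = A.tot.map g.op (a q).1 := by
    obtain ⟨q, rfl⟩ := Fin.eq_succ_of_ne_zero hq
    have h₁ : A.res f rfl z = 0 := hz q (fun e => hqi (e ▸ rfl)) l f fun x hx => by
      have e : q.succ.succAbove (g.toOrderHom x) = Fin.succAbove 0 (f.toOrderHom x) :=
        (congrArg (fun t : ⦋l⦌ ⟶ ⦋k + 1⦌ => t.toOrderHom x) h).symm
      rw [hx, Fin.succAbove_zero] at e
      exact Fin.succAbove_ne _ _ e
    have h₂ : A.res g rfl (a q.succ) = 0 := by rw [ha _ hq, map_zero]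
    rw [ha₀]
    exact (congrArg Subtype.val h₁).trans ((A.zero_val_eq (hbase h)).trans
      (congrArg Subtype.val h₂).symm)
  obtain ⟨y, hy⟩ := hA s {i.succ}ᶜ i.succ (by simp) a (by
    intro p hp q hq l f g h
    by_cases hp₀ : p = 0
    · subst hp₀
      by_cases hq₀ : q = 0
      · subst hq₀
        rw [(cancel_mono (δ 0)).1 h]
      · exact hmixed hq₀ hq h
    · by_cases hq₀ : q = 0
      · subst hq₀
        exact (hmixed hp₀ hp h.symm).symm
      · have h₁ : A.res f rfl (a p) = 0 := by rw [ha _ hp₀, map_zero]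
        have h₂ : A.res g rfl (a q) = 0 := by rw [ha _ hq₀, map_zero]
        exact (congrArg Subtype.val h₁).trans ((A.zero_val_eq (hbase h)).trans
          (congrArg Subtype.val h₂).symm))
  exact ⟨y, (hy 0 (Fin.succ_ne_zero i).symm).trans ha₀, fun j hj hji => (hy j hji).trans (ha j hj)⟩

end

/-- The structure on `B` of a diagonal of the bar construction of `A`: in degree `k`,
an element of a fibre of `B` is a `k`-tuple of elements of the fibre of `A`. It is encoded by the
sums `S i` of its first `i` entries, in terms of which the simplicial operators have a simple
description: elements of a fibre of `B` are the maps `S` from the vertices to the fibre of `A`,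
up to an additive constant, which is normalized by `S 0 = 0`. -/
structure BarStructure (A B : FibrewiseGroup Q) where
  S : ∀ {k : ℕ} {s : Q _⦋k⦌} (_ : Fin (k + 1)), B.Fib s →+ A.Fib s
  S_zero : ∀ {k : ℕ} {s : Q _⦋k⦌} (x : B.Fib s), S 0 x = 0
  S_res : ∀ {k l : ℕ} (f : ⦋l⦌ ⟶ ⦋k⦌) {s : Q _⦋k⦌} {t : Q _⦋l⦌} (h : Q.map f.op s = t)
    (i : Fin (l + 1)) (x : B.Fib s),
    S i (B.res f h x) = A.res f h (S (f.toOrderHom i) x - S (f.toOrderHom 0) x)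
  ext : ∀ {k : ℕ} {s : Q _⦋k⦌} {x y : B.Fib s}, (∀ i, S i x = S i y) → x = y
  exists_S : ∀ {k : ℕ} {s : Q _⦋k⦌} (P : Fin (k + 1) → A.Fib s), ∃ x, ∀ i, S i x = P i - P 0

namespace BarStructure

variable {A B : FibrewiseGroup Q} {k l : ℕ} (b : BarStructure A B)

lemma res_S_sub (f : ⦋l⦌ ⟶ ⦋k⦌) {s : Q _⦋k⦌} {t : Q _⦋l⦌} (h : Q.map f.op s = t)
    (i j : Fin (l + 1)) (x : B.Fib s) :
    A.res f h (b.S (f.toOrderHom i) x - b.S (f.toOrderHom j) x) =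
      b.S i (B.res f h x) - b.S j (B.res f h x) := by
  rw [b.S_res, b.S_res, ← map_sub]
  congr 1
  abel

/-- If the face opposite to `v` is not prescribed, then the differences of the partial sums at
a vertex `i` and at `v` are prescribed on all the given faces except the one opposite to `i`, and
these families of faces can be filled in `A`. -/
lemma hasFillers (b : BarStructure A B) (hA : A.HasFillers) : B.HasFillers := by
  intro k s J v hv y hy
  -- the faces of the differences of the partial sums at the `i`-th vertex and at `v`
  have ha (i j : Fin (k + 2)) : ∃ a : A.Fib (Q.δ j s), ∀ i' v', j.succAbove i' = i →
      j.succAbove v' = v → a = b.S i' (y j) - b.S v' (y j) := by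
    by_cases h : ∃ i' v', j.succAbove i' = i ∧ j.succAbove v' = v
    · obtain ⟨i', v', hi, hv⟩ := h
      refine ⟨b.S i' (y j) - b.S v' (y j), fun i'' v'' hi' hv' => ?_⟩
      rw [Fin.succAbove_right_injective (hi.trans hi'.symm),
        Fin.succAbove_right_injective (hv.trans hv'.symm)]
    · exact ⟨0, fun i' v' hi hv => absurd ⟨i', v', hi, hv⟩ h⟩
  choose a ha using ha
  have hP (i : Fin (k + 2)) : ∃ P : A.Fib s, ∀ j ∈ J, j ≠ i → A.res (δ j) rfl P = a i j := by
    obtain ⟨P, hP⟩ := hA s (J \ {i}) v (fun h => hv h.1) (a i) (by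
      intro m hm n hn l f g h
      rcases eq_or_ne m n with rfl | hmn
      · rw [(cancel_mono (δ m)).1 h]
      obtain ⟨l', r, f', g', rfl, rfl, h', hr⟩ := SimplexCategory.exists_common_face hmn f g h
      have hr' (x) : m.succAbove (f'.toOrderHom x) = n.succAbove (g'.toOrderHom x) :=
        congrArg (fun t : ⦋l'⦌ ⟶ ⦋k + 1⦌ => t.toOrderHom x) h'
      obtain ⟨i', hi'⟩ := hr i (fun e => hm.2 e.symm) (fun e => hn.2 e.symm)
      obtain ⟨v', hv'⟩ := hr v (fun e => hv (e ▸ hm.1)) (fun e => hv (e ▸ hn.1))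
      have hbase : Q.map f'.op (Q.δ m s) = Q.map g'.op (Q.δ n s) :=
        (SSet.map_map f' (δ m) s).trans
          ((SSet.map_congr h' s).trans (SSet.map_map g' (δ n) s).symm)
      have hyy : B.res f' hbase (y m) = B.res g' rfl (y n) :=
        Subtype.ext (hy m hm.1 n hn.1 l' f' g' h')
      have key : A.res f' hbase (a i m) = A.res g' rfl (a i n) := by
        rw [ha i m _ _ hi' hv', ha i n _ _ ((hr' i').symm.trans hi') ((hr' v').symm.trans hv'),
          b.res_S_sub, b.res_S_sub, hyy]
      have := congrArg (fun z => A.tot.map r.op z.1) key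
      simp only [res_val, SSet.map_map] at this
      exact this)
    exact ⟨P, fun j hj hji => hP j ⟨hj, hji⟩⟩
  choose P hP using hP
  obtain ⟨x, hx⟩ := b.exists_S P
  refine ⟨x, fun j hj => b.ext fun i => ?_⟩
  obtain ⟨v', hv'⟩ := Fin.exists_succAbove_eq (show v ≠ j from fun e => hv (e ▸ hj))
  have hres (i : Fin (k + 1)) : A.res (δ j) rfl (P (j.succAbove i)) =
      b.S i (y j) - b.S v' (y j) := by
    rw [hP _ j hj (Fin.succAbove_ne j i).symm]
    exact ha _ _ _ _ rfl hv'
  rw [b.S_res, hx, hx, sub_sub_sub_cancel_right, map_sub]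
  change A.res (δ j) rfl (P (j.succAbove i)) - A.res (δ j) rfl (P (j.succAbove 0)) = _
  rw [hres, hres, b.S_zero]
  abel

section

variable {s : Q _⦋k + 1⦌} {x : B.Fib s}

/-- The faces of the partial sums, other than those with indices `0` and `i`, vanish
for a cycle. -/
lemma res_δ_S_of_isCycle (hx : B.IsCycle x) (i j : Fin (k + 2)) (hj : j ≠ 0) (hij : j ≠ i) :
    A.res (δ j) rfl (b.S i x) = 0 := by
  obtain ⟨i', hi'⟩ := Fin.exists_succAbove_eq hij.symm
  have h := b.S_res (δ j) rfl i' x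
  rw [B.isCycle_iff.1 hx j, map_zero] at h
  have e : b.S ((δ j).toOrderHom i') x - b.S ((δ j).toOrderHom 0) x = b.S i x := by
    change b.S (j.succAbove i') x - b.S (j.succAbove 0) x = _
    rw [hi', Fin.succAbove_ne_zero_zero hj, b.S_zero, sub_zero]
  rw [e] at h
  exact h.symm

/-- The faces with index `0` of the partial sums of a cycle all coincide. -/
lemma res_δ_zero_S_of_isCycle (hx : B.IsCycle x) (i : Fin (k + 2)) (hi : i ≠ 0) :
    A.res (δ 0) rfl (b.S i x) = A.res (δ 0) rfl (b.S 1 x) := by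
  obtain ⟨i, rfl⟩ := Fin.eq_succ_of_ne_zero hi
  have h := b.S_res (δ 0) rfl i x
  rw [B.isCycle_iff.1 hx 0, map_zero, map_sub] at h
  exact sub_eq_zero.1 h.symm

/-- Converse to `res_δ_S_of_isCycle` and `res_δ_zero_S_of_isCycle`. -/
lemma isCycle_of_res_δ_S (h : ∀ i j : Fin (k + 2), j ≠ 0 → j ≠ i → A.res (δ j) rfl (b.S i x) = 0)
    (h₀ : ∀ i, i ≠ 0 → A.res (δ 0) rfl (b.S i x) = A.res (δ 0) rfl (b.S 1 x)) : B.IsCycle x := by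
  refine B.isCycle_iff.2 fun j => b.ext fun i => ?_
  rw [map_zero, b.S_res, map_sub]
  change A.res (δ j) rfl (b.S (j.succAbove i) x) - A.res (δ j) rfl (b.S (j.succAbove 0) x) = 0
  rcases eq_or_ne j 0 with rfl | hj
  · rw [h₀ _ (Fin.succAbove_ne _ _), h₀ _ (Fin.succAbove_ne _ _), sub_self]
  · rw [h _ j hj (Fin.succAbove_ne _ _).symm, h _ j hj (Fin.succAbove_ne _ _).symm, sub_self]

/-- The map sending a cycle `x` of the bar construction to the face `δ 0` of its first entry takes
values in the cycles of one dimension less; it induces the isomorphism between the homotopy groups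
of the bar construction and those of `A`. -/
lemma isCycle_res_δ_zero_S (hx : B.IsCycle x) : A.IsCycle (A.res (δ 0) rfl (b.S 1 x)) := by
  intro l f hl
  obtain ⟨j, hj⟩ := SimplexCategory.exists_notMem_range f hl
  obtain ⟨i, hi₀, hi⟩ : ∃ i : Fin (k + 2), i ≠ 0 ∧ j.succ ≠ i := by
    by_cases h : j.succ = Fin.last (k + 1)
    · refine ⟨1, by simp, fun e => ?_⟩
      rw [h, Fin.ext_iff] at e
      have := Fin.val_one (k + 1)
      simp at e
      omega
    · exact ⟨_, (Fin.last_pos).ne', h⟩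
  rw [← b.res_δ_zero_S_of_isCycle hx i hi₀, A.res_res]
  refine A.res_eq_zero_of_face j.succ (b.res_δ_S_of_isCycle hx i _ (Fin.succ_ne_zero _) hi) _
    (fun y hy => hj y ?_) _
  exact Fin.succ_injective _ ((Fin.succAbove_zero_apply _).symm.trans hy)

end

end BarStructure

end FibrewiseGroup

end FibrewiseGroups

/-! ### Fibrewise Eilenberg–Mac Lane objects -/

section EilenbergMacLane

open Simplicial SimplexCategory

/-- The last edge of a simplex. -/
def lastArrow (m : ℕ) : ⦋1⦌ ⟶ ⦋m + 1⦌ :=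
  mkOfLe (Fin.last m).castSucc (Fin.last (m + 1)) (Fin.le_last _)

/-- The triangle on the last three vertices of a simplex. -/
def lastTriangle (m : ℕ) : ⦋2⦌ ⟶ ⦋m + 2⦌ :=
  mkOfLeComp (Fin.last m).castSucc.castSucc (Fin.last (m + 1)).castSucc (Fin.last (m + 2))
    (Fin.castSucc_lt_last (Fin.last m)).le (Fin.le_last _)

lemma lastArrow_zero : lastArrow 0 = 𝟙 _ := Hom.ext_one_left _ _ (by rfl) (by rfl)

lemma SSet.map_lastArrow_zero {X : SSet.{u}} (x : X _⦋1⦌) : X.map (lastArrow 0).op x = x := by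
  rw [lastArrow_zero]
  simp

lemma lastArrow_comp_δ_zero (m : ℕ) : lastArrow m ≫ δ 0 = lastArrow (m + 1) :=
  Hom.ext_one_left _ _ (by rfl) (by rfl)

lemma lastTriangle_comp_δ_zero (m : ℕ) : lastTriangle m ≫ δ 0 = lastTriangle (m + 1) := by
  apply SimplexCategory.Hom.ext
  ext i
  fin_cases i <;> rfl

lemma lastArrow_comp_δ_last (m : ℕ) :
    lastArrow m ≫ δ (Fin.last (m + 2)) = δ 2 ≫ lastTriangle m := by
  refine Hom.ext_one_left _ _ ?_ ?_
  · change (Fin.last (m + 2)).succAbove (Fin.last m).castSucc = (Fin.last m).castSucc.castSucc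
    rw [Fin.succAbove_last]
  · change (Fin.last (m + 2)).succAbove (Fin.last (m + 1)) = (Fin.last (m + 1)).castSucc
    rw [Fin.succAbove_last]

lemma lastArrow_comp_δ_castSucc_last (m : ℕ) :
    lastArrow m ≫ δ (Fin.last (m + 1)).castSucc = δ 1 ≫ lastTriangle m := by
  refine Hom.ext_one_left _ _ ?_ ?_
  · change (Fin.last (m + 1)).castSucc.succAbove (Fin.last m).castSucc =
      (Fin.last m).castSucc.castSucc
    exact Fin.succAbove_of_castSucc_lt _ _ (by simp [Fin.lt_def])
  · change (Fin.last (m + 1)).castSucc.succAbove (Fin.last (m + 1)) = Fin.last (m + 2)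
    exact Fin.succAbove_of_le_castSucc _ _ le_rfl

lemma lastArrow_comp_δ_castSucc_castSucc (m : ℕ) (j : Fin (m + 1)) :
    lastArrow m ≫ δ j.castSucc.castSucc = δ 0 ≫ lastTriangle m := by
  refine Hom.ext_one_left _ _ ?_ ?_
  · change j.castSucc.castSucc.succAbove (Fin.last m).castSucc = (Fin.last (m + 1)).castSucc
    rw [Fin.succAbove_of_le_castSucc _ _ (by simpa using Fin.le_last j)]
    rfl
  · change j.castSucc.castSucc.succAbove (Fin.last (m + 1)) = Fin.last (m + 2)
    exact Fin.succAbove_of_le_castSucc _ _ (by simpa using Fin.le_last _)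

variable {Q : SSet.{u}}

lemma lastArrow_base {k l n : ℕ} {f : ⦋k⦌ ⟶ ⦋l⦌} {f' : ⦋n⦌ ⟶ ⦋l⦌} {g : ⦋1⦌ ⟶ ⦋k⦌}
    {g' : ⦋1⦌ ⟶ ⦋n⦌} (h : g ≫ f = g' ≫ f') (s : Q _⦋l⦌) :
    Q.map g.op (Q.map f.op s) = Q.map g'.op (Q.map f'.op s) := by
  rw [SSet.map_map, SSet.map_map, h]

namespace FibrewiseGroup

/-- A fibrewise abelian group `A` over `Q` whose only homotopy groups relative to `Q` are those
of `M`, in dimension `m + 1`: an operation `ev` with values in the fibre of `M` over the last edge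
of a simplex which identifies cycles of dimension `m + 1` with elements of `M`, and which
satisfies the identity of a normalized cocycle; cycles of higher dimension vanish, and those
of lower positive dimension are boundaries. -/
structure EMStructure (M A : FibrewiseGroup Q) (m : ℕ) where
  hasFillers : A.HasFillers
  subsingleton : ∀ s : Q _⦋0⦌, Subsingleton (A.Fib s)
  ev : ∀ {s : Q _⦋m + 1⦌} {t : Q _⦋1⦌}, Q.map (lastArrow m).op s = t → A.Fib s →+ M.Fib t
  cocycle : ∀ {s : Q _⦋m + 2⦌} (b : A.Fib s), ∃ z : M.Fib (Q.map (lastTriangle m).op s),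
    M.res (δ 2) rfl z =
      ev (lastArrow_base (lastArrow_comp_δ_last m) s) (A.res (δ (Fin.last (m + 2))) rfl b) ∧
    M.res (δ 1) rfl z = ev (lastArrow_base (lastArrow_comp_δ_castSucc_last m) s)
      (A.res (δ (Fin.last (m + 1)).castSucc) rfl b) ∧
    M.res (δ 0) rfl z = ∑ j : Fin (m + 1), (-1 : ℤ) ^ (m + j.1) •
      ev (lastArrow_base (lastArrow_comp_δ_castSucc_castSucc m j) s)
        (A.res (δ j.castSucc.castSucc) rfl b)
  eq_zero_of_ev : ∀ {s : Q _⦋m + 1⦌} (a : A.Fib s), A.IsCycle a → ev rfl a = 0 → a = 0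
  eq_zero : ∀ {k : ℕ} (_ : m + 1 ≤ k) {s : Q _⦋k + 1⦌} (a : A.Fib s), A.IsCycle a → a = 0
  exists_ev : ∀ {s : Q _⦋m + 1⦌} (c : M.Fib (Q.map (lastArrow m).op s)),
    ∃ a : A.Fib s, A.IsCycle a ∧ ev rfl a = c
  exists_boundary : ∀ {k : ℕ} (_ : k < m) {s : Q _⦋k + 2⦌} (c : A.Fib (Q.δ 0 s)), A.IsCycle c →
    ∃ y : A.Fib s, A.res (δ 0) rfl y = c ∧ ∀ j : Fin (k + 2), A.res (δ j.succ) rfl y = 0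

/-- The hypotheses on `M`: it is the nerve of a groupoid with the same objects as `Q`. -/
structure IsGroupoidModule (M : FibrewiseGroup Q) : Prop where
  base : IsInternalGroupoid (𝒟 := Type u) Q
  tot : IsInternalGroupoid (𝒟 := Type u) M.tot
  subsingleton : ∀ s : Q _⦋0⦌, Subsingleton (M.Fib s)

namespace IsGroupoidModule

variable {M : FibrewiseGroup Q} (hM : M.IsGroupoidModule)
include hM

/-- The vertices of `M` are determined by their images in `Q`. -/
lemma vertex_eq {k : ℕ} {s t : Q _⦋k⦌} (a : M.Fib s) (b : M.Fib t) (i : Fin (k + 1))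
    {j : Fin (k + 1)} (h : Q.vertex i s = Q.vertex j t) :
    M.tot.vertex i a.1 = M.tot.vertex j b.1 := by
  have := hM.subsingleton (Q.vertex i s)
  exact congrArg Subtype.val (Subsingleton.elim (α := M.Fib (Q.vertex i s))
    (M.res (SimplexCategory.const ⦋0⦌ ⦋k⦌ i) rfl a)
    (M.res (SimplexCategory.const ⦋0⦌ ⦋k⦌ j) h.symm b))

lemma hasFillers : M.HasFillers := by
  intro k s J v hv a ha
  obtain ⟨b, hb, hbv, hbe⟩ := hM.tot.exists_filler J v hv (fun j => (a j).1) ha (0 : M.Fib s).1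
    (fun j hj v' hv' => by
      have := hM.subsingleton (Q.vertex v s)
      have h : Q.vertex v' (Q.δ j s) = Q.vertex v s := by rw [SSet.vertex_δ, hv']
      exact congrArg Subtype.val (Subsingleton.elim
        (M.res (SimplexCategory.const ⦋0⦌ ⦋k⦌ v') h (a j))
        (M.res (SimplexCategory.const ⦋0⦌ ⦋k + 1⦌ v) rfl 0)))
  have hvertex (i : Fin (k + 2)) (c : M.tot _⦋k + 1⦌) :
      M.p.app _ (M.tot.vertex i c) = Q.vertex i (M.p.app _ c) := SSet.app_map _ _ _
  have hedge (i j : Fin (k + 2)) (h : i ≤ j) (c : M.tot _⦋k + 1⦌) :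
      M.p.app _ (M.tot.edge i j h c) = Q.edge i j h (M.p.app _ c) := SSet.app_map _ _ _
  -- an edge of `b` at `v` lies in one of the given faces, or it is an edge of the zero section
  have hbs : M.p.app _ b = s := by
    refine hM.base.edges_ext v ?_ fun i j hij hor => ?_
    · rw [← hvertex, hbv, hvertex, (0 : M.Fib s).2]
    · by_cases h : ∀ m ∈ J, m = i ∨ m = j
      · rw [← hedge, hbe i j hij hor h, hedge, (0 : M.Fib s).2]
      · push Not at h
        obtain ⟨m, hm, hmi, hmj⟩ := h
        obtain ⟨i, rfl⟩ := Fin.exists_succAbove_eq hmi.symm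
        obtain ⟨j, rfl⟩ := Fin.exists_succAbove_eq hmj.symm
        have hij' : i ≤ j := ((Fin.strictMono_succAbove m).lt_iff_lt.1 hij).le
        have h : Q.δ m (M.p.app _ b) = Q.δ m s := by
          rw [← (a m).2, ← hb m hm]
          exact (SSet.app_map _ _ _).symm
        rw [← SSet.edge_δ m i j hij', ← SSet.edge_δ m i j hij', h]
  exact ⟨⟨b, hbs⟩, fun j hj => Subtype.ext (hb j hj)⟩

/-- Since the simplices of `M` are determined by their edges, a cycle of dimension at least `2`
vanishes. -/
lemma eq_zero {k : ℕ} {s : Q _⦋k + 2⦌} (a : M.Fib s) (ha : M.IsCycle a) : a = 0 := by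
  refine Subtype.ext (hM.tot.edges_ext 0 (hM.vertex_eq _ _ _ rfl) fun i j hij _ => ?_)
  have h₀ : M.IsCycle (0 : M.Fib s) := fun l f _ => map_zero _
  exact congrArg Subtype.val ((ha 1 (mkOfLe i j hij.le) (by omega)).trans
    (h₀ 1 (mkOfLe i j hij.le) (by omega)).symm)

/-- `M` itself is a fibrewise Eilenberg–Mac Lane object of dimension `1`. -/
def emStructure : EMStructure M M 0 where
  hasFillers := hM.hasFillers
  subsingleton := hM.subsingleton
  ev h := M.res (lastArrow 0) h
  cocycle {s} b := by
    refine ⟨M.res (lastTriangle 0) rfl b, ?_, ?_, ?_⟩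
    · exact M.res_comm (lastArrow_comp_δ_last 0).symm _ _ _ _ _
    · exact M.res_comm (lastArrow_comp_δ_castSucc_last 0).symm _ _ _ _ _
    · rw [Fin.sum_univ_one]
      refine (M.res_comm (lastArrow_comp_δ_castSucc_castSucc 0 0).symm _ _ rfl
        (lastArrow_base (lastArrow_comp_δ_castSucc_castSucc 0 0) s) _).trans ?_
      exact (one_smul ℤ _).symm
  eq_zero_of_ev {s} a _ h := by
    refine Subtype.ext ?_
    have := congrArg Subtype.val h
    rw [res_val, SSet.map_lastArrow_zero] at this
    exact this.trans (M.zero_val_eq (SSet.map_lastArrow_zero s))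
  eq_zero {k} hk s a ha := by
    obtain ⟨k, rfl⟩ := Nat.exists_eq_add_of_le' hk
    exact hM.eq_zero a ha
  exists_ev {s} c := by
    refine ⟨⟨c.1, c.2.trans (SSet.map_lastArrow_zero s)⟩, M.isCycle_iff.2 fun j => ?_,
      Subtype.ext (SSet.map_lastArrow_zero c.1)⟩
    have := hM.subsingleton (Q.map (δ j).op s)
    exact Subsingleton.elim _ _
  exists_boundary hk := absurd hk (by omega)

end IsGroupoidModule

end FibrewiseGroup

end EilenbergMacLane

/-! ### The bar construction of a fibrewise Eilenberg–Mac Lane object -/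

section EilenbergMacLaneBar

open Simplicial SimplexCategory

namespace FibrewiseGroup

variable {Q : SSet.{u}}

namespace IsGroupoidModule

variable {M : FibrewiseGroup Q} (hM : M.IsGroupoidModule)
include hM

/-- Two of the faces of a triangle in `M` determine it, since `M` is a groupoid. -/
lemma eq_zero_of_faces {s : Q _⦋2⦌} (z : M.Fib s) (i j : Fin 3) (hij : i < j)
    (hi : M.res (δ i) rfl z = 0) (hj : M.res (δ j) rfl z = 0) : z = 0 := by
  have h (i : Fin 3) (hi : M.res (δ i) rfl z = 0) : M.tot.δ i z.1 = M.tot.δ i (0 : M.Fib s).1 :=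
    congrArg Subtype.val (hi.trans (map_zero (M.res (δ i) rfl)).symm)
  refine Subtype.ext ?_
  have hi' := h i hi
  have hj' := h j hj
  fin_cases i <;> fin_cases j <;> try exact absurd hij (by decide)
  · exact hM.tot.triangle_ext₀₁ hi' hj'
  · exact hM.tot.triangle_ext₀₂ hi' hj'
  · exact hM.tot.triangle_ext₁₂ hi' hj'

end IsGroupoidModule

namespace EMStructure

variable {M A : FibrewiseGroup Q} {m : ℕ} (hA : EMStructure M A m)

lemma ev_congr {k : ℕ} {f f' : ⦋m + 1⦌ ⟶ ⦋k⦌} (e : f = f') {s : Q _⦋k⦌} {t t' : Q _⦋m + 1⦌}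
    {r : Q _⦋1⦌} (hf : Q.map f.op s = t) (hf' : Q.map f'.op s = t')
    (h : Q.map (lastArrow m).op t = r) (h' : Q.map (lastArrow m).op t' = r) (x : A.Fib s) :
    hA.ev h (A.res f hf x) = hA.ev h' (A.res f' hf' x) := by
  subst e hf hf'
  rfl

lemma ev_eq_zero_iff {s : Q _⦋m + 1⦌} {r r' : Q _⦋1⦌} (h : Q.map (lastArrow m).op s = r)
    (h' : Q.map (lastArrow m).op s = r') (a : A.Fib s) : hA.ev h a = 0 ↔ hA.ev h' a = 0 := by
  subst h h'
  rfl

lemma exists_cocycle {s : Q _⦋m + 2⦌} {t : Q _⦋2⦌} (ht : Q.map (lastTriangle m).op s = t)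
    (h₂ : Q.map (lastArrow m).op (Q.map (δ (Fin.last (m + 2))).op s) = Q.map (δ 2).op t)
    (h₁ : Q.map (lastArrow m).op (Q.map (δ (Fin.last (m + 1)).castSucc).op s) = Q.map (δ 1).op t)
    (h₀ : ∀ j : Fin (m + 1),
      Q.map (lastArrow m).op (Q.map (δ j.castSucc.castSucc).op s) = Q.map (δ 0).op t)
    (b : A.Fib s) :
    ∃ z : M.Fib t, M.res (δ 2) rfl z = hA.ev h₂ (A.res (δ (Fin.last (m + 2))) rfl b) ∧
      M.res (δ 1) rfl z = hA.ev h₁ (A.res (δ (Fin.last (m + 1)).castSucc) rfl b) ∧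
      M.res (δ 0) rfl z = ∑ j : Fin (m + 1), (-1 : ℤ) ^ (m + j.1) •
        hA.ev (h₀ j) (A.res (δ j.castSucc.castSucc) rfl b) := by
  subst ht
  exact hA.cocycle b

lemma exists_cycle {s : Q _⦋m + 1⦌} {t : Q _⦋1⦌} (h : Q.map (lastArrow m).op s = t) (c : M.Fib t) :
    ∃ a : A.Fib s, A.IsCycle a ∧ hA.ev h a = c := by
  subst h
  exact hA.exists_ev c

/-- If all faces but one of an element of dimension `m + 2` vanish, then so does the last one. -/
lemma eq_zero_of_face_zero (hA : EMStructure M A m) (hM : M.IsGroupoidModule) {s : Q _⦋m + 2⦌}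
    (a : A.Fib s) (i : Fin (m + 3)) (ha : ∀ j, j ≠ i → A.res (δ j) rfl a = 0) : a = 0 := by
  refine hA.eq_zero le_rfl a (A.isCycle_iff.2 fun j => ?_)
  rcases eq_or_ne j i with rfl | hj
  swap
  · exact ha j hj
  refine hA.eq_zero_of_ev _ (A.isCycle_face j ha) ?_
  obtain ⟨z, h₂, h₁, h₀⟩ := hA.cocycle a
  have hz (i : Fin (m + 1)) (hj : j.castSucc ≠ i.castSucc.castSucc.castSucc) :
      (-1 : ℤ) ^ (m + i.1) • hA.ev (lastArrow_base (lastArrow_comp_δ_castSucc_castSucc m i) s)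
        (A.res (δ i.castSucc.castSucc) rfl a) = 0 := by
    rw [ha _ (fun e => hj (by rw [← e])), map_zero, smul_zero]
  induction j using Fin.lastCases with
  | last =>
    rw [ha _ (Fin.castSucc_lt_last _).ne, map_zero] at h₁
    rw [Finset.sum_eq_zero fun i _ => hz i (by simp [Fin.ext_iff]; omega)] at h₀
    have := hM.eq_zero_of_faces z 0 1 (by decide) h₀ h₁
    rw [this, map_zero] at h₂
    exact (hA.ev_eq_zero_iff _ _ _).1 h₂.symm
  | cast j =>
    rw [ha _ (Fin.castSucc_lt_last _).ne', map_zero] at h₂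
    induction j using Fin.lastCases with
    | last =>
      rw [Finset.sum_eq_zero fun i _ => hz i (by simp [Fin.ext_iff]; omega)] at h₀
      have := hM.eq_zero_of_faces z 0 2 (by decide) h₀ h₂
      rw [this, map_zero] at h₁
      exact (hA.ev_eq_zero_iff _ _ _).1 h₁.symm
    | cast j =>
      rw [ha _ (by simp [Fin.ext_iff]; omega), map_zero] at h₁
      have := hM.eq_zero_of_faces z 1 2 (by decide) h₁ h₂
      rw [this, map_zero, Finset.sum_eq_single j (fun i _ hi => hz i (by simpa using hi.symm))
        (by simp)] at h₀
      refine (hA.ev_eq_zero_iff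
        (lastArrow_base (lastArrow_comp_δ_castSucc_castSucc m j) s) _ _).1 ?_
      rcases neg_one_pow_eq_or ℤ (m + j.1) with h | h <;> simpa [h] using h₀.symm

end EMStructure

namespace BarStructure

variable {M A B : FibrewiseGroup Q} {k m : ℕ} (b : BarStructure A B)

lemma res_δ_S_eq_zero {s : Q _⦋k + 1⦌} {x : B.Fib s} (hx : B.IsCycle x)
    (h : A.res (δ 0) rfl (b.S 1 x) = 0) (i j : Fin (k + 2)) (hj : j ≠ i) :
    A.res (δ j) rfl (b.S i x) = 0 := by
  rcases eq_or_ne j 0 with rfl | hj₀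
  · rw [b.res_δ_zero_S_of_isCycle hx i hj.symm, h]
  · exact b.res_δ_S_of_isCycle hx i j hj₀ hj

/-- An element of the bar construction with prescribed faces `δ 0` of its partial sums. -/
lemma exists_of_faces (hA : A.HasFillers) {s : Q _⦋k + 1⦌} (z : Fin (k + 1) → A.Fib (Q.δ 0 s))
    (hz : ∀ i j, j ≠ i → ∀ (l : ℕ) (f : ⦋l⦌ ⟶ ⦋k⦌), (∀ x, f.toOrderHom x ≠ j) →
      A.res f rfl (z i) = 0) :
    ∃ y : B.Fib s, (∀ i : Fin (k + 1), A.res (δ 0) rfl (b.S i.succ y) = z i) ∧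
      ∀ i j : Fin (k + 2), j ≠ 0 → j ≠ i → A.res (δ j) rfl (b.S i y) = 0 := by
  choose P hP₀ hP using fun i => hA.exists_of_face_zero (z i) i (hz i)
  obtain ⟨y, hy⟩ := b.exists_S (Fin.cons 0 P : Fin (k + 2) → A.Fib s)
  refine ⟨y, fun i => ?_, fun i j hj hji => ?_⟩
  · rw [hy, Fin.cons_succ, Fin.cons_zero, sub_zero, hP₀]
  · rw [hy, Fin.cons_zero, sub_zero]
    induction i using Fin.cases with
    | zero => rw [Fin.cons_zero, map_zero]
    | succ i => rw [Fin.cons_succ, hP i j hj hji]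

/-- The face `δ 0` of the first entry of an element of the bar construction, evaluated in `M`. -/
def ev (hA : EMStructure M A m) {s : Q _⦋m + 2⦌} {t : Q _⦋1⦌}
    (h : Q.map (lastArrow (m + 1)).op s = t) : B.Fib s →+ M.Fib t :=
  ((hA.ev ((SSet.map_map _ _ _).trans
    ((SSet.map_congr (lastArrow_comp_δ_zero m) s).trans h))).comp (A.res (δ 0) rfl)).comp (b.S 1)

lemma ev_res_succ (hA : EMStructure M A m) {s : Q _⦋m + 3⦌} (x : B.Fib s) (j : Fin (m + 3))
    (hj : j ≠ 0) {r : Q _⦋1⦌} (h : Q.map (lastArrow (m + 1)).op (Q.map (δ j.succ).op s) = r)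
    (h' : Q.map (lastArrow m).op (Q.map (δ j).op (Q.map (δ 0).op s)) = r) :
    b.ev hA h (B.res (δ j.succ) rfl x) =
      hA.ev h' (A.res (δ j) rfl (A.res (δ 0) rfl (b.S 1 x))) := by
  have hS : b.S 1 (B.res (δ j.succ) rfl x) = A.res (δ j.succ) rfl (b.S 1 x) := by
    rw [b.S_res]
    change A.res _ _ (b.S (j.succ.succAbove 1) x - b.S (j.succ.succAbove 0) x) = _
    rw [Fin.succAbove_ne_zero_zero (Fin.succ_ne_zero j), b.S_zero, sub_zero,
      Fin.succAbove_of_castSucc_lt _ _ (Fin.succ_lt_succ_iff.2 (Fin.pos_of_ne_zero hj))]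
    rfl
  change hA.ev _ (A.res (δ 0) rfl (b.S 1 (B.res (δ j.succ) rfl x))) = _
  rw [hS, A.res_res, A.res_res]
  exact hA.ev_congr (δ_comp_δ (Fin.zero_le j)) _ _ _ _ _

lemma ev_res_zero (hA : EMStructure M A m) {s : Q _⦋m + 3⦌} (x : B.Fib s) {r : Q _⦋1⦌}
    (h : Q.map (lastArrow (m + 1)).op (Q.map (δ 0).op s) = r)
    (h₁ : Q.map (lastArrow (m + 1)).op (Q.map (δ 1).op s) = r)
    (h' : Q.map (lastArrow m).op (Q.map (δ 0).op (Q.map (δ 0).op s)) = r) :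
    b.ev hA h (B.res (δ 0) rfl x) = b.ev hA h₁ (B.res (δ 1) rfl x) -
      hA.ev h' (A.res (δ 0) rfl (A.res (δ 0) rfl (b.S 1 x))) := by
  change hA.ev _ (A.res (δ 0) rfl (b.S 1 (B.res (δ 0) rfl x))) =
    hA.ev _ (A.res (δ 0) rfl (b.S 1 (B.res (δ 1) rfl x))) - _
  rw [b.S_res, b.S_res]
  change hA.ev _ (A.res (δ 0) rfl (A.res (δ 0) rfl (b.S 2 x - b.S 1 x))) =
    hA.ev _ (A.res (δ 0) rfl (A.res (δ 1) rfl (b.S 2 x - b.S 0 x))) - _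
  rw [b.S_zero, sub_zero, map_sub, map_sub, map_sub]
  congr 1
  rw [A.res_res, A.res_res]
  exact hA.ev_congr (δ_comp_δ (Fin.zero_le 0)).symm _ _ _ _ _

/-- The cocycle identity for the bar construction is that for `A`, applied to the face `δ 0` of the
first entry: the face `δ (j + 1)` on the bar side corresponds to `δ j` for `j ≠ 0`, whereas the face
`δ 0` of `A` accounts for the faces `δ 0` and `δ 1`, which occur with opposite signs. -/
lemma exists_cocycle (hA : EMStructure M A m) {s : Q _⦋m + 3⦌} (x : B.Fib s) :
    ∃ z : M.Fib (Q.map (lastTriangle (m + 1)).op s),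
      M.res (δ 2) rfl z = b.ev hA (lastArrow_base (lastArrow_comp_δ_last (m + 1)) s)
        (B.res (δ (Fin.last (m + 3))) rfl x) ∧
      M.res (δ 1) rfl z = b.ev hA (lastArrow_base (lastArrow_comp_δ_castSucc_last (m + 1)) s)
        (B.res (δ (Fin.last (m + 2)).castSucc) rfl x) ∧
      M.res (δ 0) rfl z = ∑ j : Fin (m + 2), (-1 : ℤ) ^ (m + 1 + j.1) •
        b.ev hA (lastArrow_base (lastArrow_comp_δ_castSucc_castSucc (m + 1) j) s)
          (B.res (δ j.castSucc.castSucc) rfl x) := by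
  have hbase (j : Fin (m + 3)) {r : Q _⦋1⦌}
      (h : Q.map (lastArrow (m + 1)).op (Q.map (δ j.succ).op s) = r) :
      Q.map (lastArrow m).op (Q.map (δ j).op (Q.map (δ 0).op s)) = r := by
    rw [← h, SSet.map_map, SSet.map_map, SSet.map_map]
    refine SSet.map_congr ?_ s
    rw [← lastArrow_comp_δ_zero, Category.assoc, Category.assoc]
    exact congrArg _ (δ_comp_δ (Fin.zero_le j)).symm
  obtain ⟨z, h₂, h₁, h₀⟩ := hA.exists_cocycle
    ((SSet.map_map _ _ _).trans (SSet.map_congr (lastTriangle_comp_δ_zero m) s))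
    (hbase _ (lastArrow_base (lastArrow_comp_δ_last (m + 1)) s))
    (hbase _ (lastArrow_base (lastArrow_comp_δ_castSucc_last (m + 1)) s))
    (fun j => hbase j.castSucc.castSucc
      (lastArrow_base (lastArrow_comp_δ_castSucc_castSucc (m + 1) j.succ) s))
    (A.res (δ 0) rfl (b.S 1 x))
  refine ⟨z, h₂.trans (b.ev_res_succ hA x (Fin.last (m + 2)) (Fin.last_pos).ne' _ _).symm,
    h₁.trans (b.ev_res_succ hA x (Fin.last (m + 1)).castSucc ?_ _ _).symm, ?_⟩
  · simp [Fin.ext_iff]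
  rw [h₀, Fin.sum_univ_succ, Fin.sum_univ_succ, Fin.sum_univ_succ]
  have e₀ := b.ev_res_zero hA x
    (lastArrow_base (lastArrow_comp_δ_castSucc_castSucc (m + 1) 0) s)
    (lastArrow_base (lastArrow_comp_δ_castSucc_castSucc (m + 1) 1) s)
    (hbase 0 (lastArrow_base (lastArrow_comp_δ_castSucc_castSucc (m + 1) 1) s))
  have e (j : Fin m) := b.ev_res_succ hA x j.succ.castSucc.castSucc (by simp [Fin.ext_iff])
    (lastArrow_base (lastArrow_comp_δ_castSucc_castSucc (m + 1) j.succ.succ) s)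
    (hbase _ (lastArrow_base (lastArrow_comp_δ_castSucc_castSucc (m + 1) j.succ.succ) s))
  have hsum {G : Type u} [AddCommGroup G] (c₀ c₀' c₁' : G) (c c' : Fin m → G)
      (h₀ : c₀' = c₁' - c₀) (h : ∀ j, c' j = c j) :
      (-1 : ℤ) ^ (m + (0 : Fin (m + 1)).1) • c₀ +
          ∑ j : Fin m, (-1 : ℤ) ^ (m + j.succ.1) • c j =
        (-1 : ℤ) ^ (m + 1 + (0 : Fin (m + 2)).1) • c₀' +
          ((-1 : ℤ) ^ (m + 1 + (Fin.succ (0 : Fin (m + 1))).1) • c₁' +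
            ∑ j : Fin m, (-1 : ℤ) ^ (m + 1 + j.succ.succ.1) • c' j) := by
    have : ∀ j : Fin m, (-1 : ℤ) ^ (m + 1 + j.succ.succ.1) • c' j =
        (-1 : ℤ) ^ (m + j.succ.1) • c j := fun j => by
      rw [h, Fin.val_succ j.succ, show m + 1 + (j.succ.1 + 1) = m + j.succ.1 + 2 by ring,
        pow_add _ _ 2]
      simp
    simp only [this, h₀, ← add_assoc]
    congr 1
    simp only [Fin.val_zero, Fin.val_succ, add_zero, zero_add, pow_succ]
    module
  exact hsum _ _ _ _ _ e₀ e

/-- The bar construction raises the dimension of a fibrewise Eilenberg–Mac Lane object by one: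
a cycle `x` of the bar construction is determined up to boundaries by the common face `δ 0` of
its partial sums. -/
def emStructure (hM : M.IsGroupoidModule) (hA : EMStructure M A m) : EMStructure M B (m + 1) where
  hasFillers := b.hasFillers hA.hasFillers
  subsingleton s := ⟨fun x y => b.ext fun i => by
    rw [Subsingleton.elim (α := Fin 1) i 0, b.S_zero, b.S_zero]⟩
  ev h := b.ev hA h
  cocycle := b.exists_cocycle hA
  eq_zero_of_ev {s} x hx h := by
    have hc := hA.eq_zero_of_ev (A.res (δ 0) rfl (b.S 1 x)) (b.isCycle_res_δ_zero_S hx)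
      ((hA.ev_eq_zero_iff _ _ _).1 h)
    refine b.ext fun i => ?_
    rw [map_zero]
    exact hA.eq_zero_of_face_zero hM _ i (b.res_δ_S_eq_zero hx hc i)
  eq_zero {k} hk s x hx := by
    obtain ⟨k, rfl⟩ : ∃ l, k = l + 1 := ⟨k - 1, by omega⟩
    have hc := hA.eq_zero (by omega) _ (b.isCycle_res_δ_zero_S hx)
    refine b.ext fun i => ?_
    rw [map_zero]
    have h := b.res_δ_S_eq_zero hx hc i
    refine hA.eq_zero (by omega) _ (A.isCycle_iff.2 fun j => ?_)
    rcases eq_or_ne j i with rfl | hj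
    · exact hA.eq_zero (by omega) _ (A.isCycle_face j h)
    · exact h j hj
  exists_ev {s} c := by
    -- all partial sums except the one with index `0` have the same face `δ 0`, a cycle with
    -- value `c`
    obtain ⟨z, hz, hzc⟩ := hA.exists_cycle ((SSet.map_map _ _ _).trans
      (SSet.map_congr (lastArrow_comp_δ_zero m) s)) c
    obtain ⟨x, hx₀, hx⟩ := b.exists_of_faces hA.hasFillers (s := s) (fun _ => z)
      fun i j _ l f hf => A.res_eq_zero_of_face j (A.isCycle_iff.1 hz j) f hf rfl
    refine ⟨x, b.isCycle_of_res_δ_S hx fun i hi => ?_, ?_⟩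
    · obtain ⟨i, rfl⟩ := Fin.eq_succ_of_ne_zero hi
      exact (hx₀ i).trans (hx₀ 0).symm
    · refine Eq.trans ?_ hzc
      exact congrArg (hA.ev _) (hx₀ 0)
  exists_boundary {k} hk s c hc := by
    -- `T` bounds the common face of the partial sums of `c`, and the differences `S i c - T` have
    -- few enough nonzero faces to be the faces `δ 0` of the partial sums of an element `y`
    obtain ⟨T, hT₀, hT⟩ : ∃ T : A.Fib (Q.δ 0 s),
        A.res (δ 0) rfl T = A.res (δ 0) rfl (b.S 1 c) ∧
          ∀ j : Fin (k + 1), A.res (δ j.succ) rfl T = 0 := by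
      obtain _ | k := k
      · have hs := hA.subsingleton
        exact ⟨0, @Subsingleton.elim _ (hs _) _ _, fun j => @Subsingleton.elim _ (hs _) _ _⟩
      · exact hA.exists_boundary (by omega) _ (b.isCycle_res_δ_zero_S hc)
    obtain ⟨y, hy₀, hy⟩ := b.exists_of_faces hA.hasFillers (s := s) (fun i => b.S i c - T)
      fun i j hji l f hf => A.res_eq_zero_of_face j (by
        rw [map_sub]
        induction j using Fin.cases with
        | zero => rw [b.res_δ_zero_S_of_isCycle hc i hji.symm, hT₀, sub_self]
        | succ j =>
          rw [hT, sub_zero, b.res_δ_S_of_isCycle hc i _ (Fin.succ_ne_zero j) hji]) f hf rfl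
    refine ⟨y, b.ext fun i => ?_, fun j => b.ext fun i => ?_⟩
    · rw [b.S_res, map_sub]
      change A.res (δ 0) rfl (b.S (Fin.succAbove 0 i) y) -
        A.res (δ 0) rfl (b.S (Fin.succAbove 0 0) y) = _
      rw [Fin.succAbove_zero, hy₀, hy₀, b.S_zero]
      abel
    · rw [map_zero, b.S_res, map_sub]
      change A.res (δ j.succ) rfl (b.S (j.succ.succAbove i) y) -
        A.res (δ j.succ) rfl (b.S (j.succ.succAbove 0) y) = _
      rw [hy _ _ (Fin.succ_ne_zero j) (Fin.succAbove_ne _ _).symm,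
        hy _ _ (Fin.succ_ne_zero j) (Fin.succAbove_ne _ _).symm, sub_self]

end BarStructure

end FibrewiseGroup

end EilenbergMacLaneBar

/-! ### Horn fillers, pointed simplices and homotopies -/

section Homotopies

open Simplicial SimplexCategory

namespace SSet

/-- The constant simplex on a vertex. -/
def constSimplex {X : SSet.{u}} (k : ℕ) (x : X _⦋0⦌) : X _⦋k⦌ :=
  X.map (SimplexCategory.const ⦋k⦌ ⦋0⦌ 0).op x

section

variable {X Y : SSet.{u}} {k l n : ℕ}

@[simp] lemma map_constSimplex (f : ⦋l⦌ ⟶ ⦋k⦌) (x : X _⦋0⦌) :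
    X.map f.op (constSimplex k x) = constSimplex l x :=
  SSet.map_map _ _ _

lemma app_constSimplex (p : X ⟶ Y) (x : X _⦋0⦌) :
    p.app _ (constSimplex k x) = constSimplex k (p.app _ x) :=
  SSet.app_map _ _ _

lemma constSimplex_zero (x : X _⦋0⦌) : constSimplex 0 x = x := by
  unfold constSimplex
  rw [show SimplexCategory.const ⦋0⦌ ⦋0⦌ 0 = 𝟙 _ from Hom.ext_zero_left _ _ (by rfl)]
  simp

lemma map_simplex_of_notMem {x : X _⦋0⦌} (α : X.PtSimplex n x) (f : ⦋k⦌ ⟶ ⦋n⦌) (j : Fin (n + 1))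
    (hf : ∀ i, f.toOrderHom i ≠ j) : X.map f.op (yonedaEquiv α.map) = constSimplex k x := by
  rw [yonedaEquiv_naturality, yonedaEquiv_comp, yonedaEquiv_map]
  exact α.map_eq_of_mem (stdSimplex.objEquiv.symm f) fun h => by
    obtain ⟨i, hi⟩ := h j
    exact hf i hi

/-- A pointed simplex is determined by its underlying simplex, all of whose faces are constant. -/
def ptSimplexMk (x : X _⦋0⦌) (a : X _⦋n⦌)
    (ha : ∀ (k : ℕ) (f : ⦋k⦌ ⟶ ⦋n⦌) (j : Fin (n + 1)), (∀ i, f.toOrderHom i ≠ j) →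
      X.map f.op a = constSimplex k x) : X.PtSimplex n x where
  map := yonedaEquiv.symm a
  comm := by
    ext ⟨k⟩ ⟨f, hf⟩
    induction k using SimplexCategory.rec with
    | mk k =>
      have hf' : ¬ Function.Surjective (stdSimplex.asOrderHom f) := hf
      rw [Function.Surjective] at hf'
      push Not at hf'
      obtain ⟨j, hj⟩ := hf'
      exact ha k (stdSimplex.objEquiv f) j hj

lemma yonedaEquiv_ptSimplexMk (x : X _⦋0⦌) (a : X _⦋n⦌)
    (ha : ∀ (k : ℕ) (f : ⦋k⦌ ⟶ ⦋n⦌) (j : Fin (n + 1)), (∀ i, f.toOrderHom i ≠ j) →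
      X.map f.op a = constSimplex k x) : yonedaEquiv (ptSimplexMk x a ha).map = a :=
  Equiv.apply_symm_apply _ _

lemma map_comp_hornι {i p : Fin (n + 2)} (hp : p ≠ i) (g : ⦋l⦌ ⟶ ⦋n⦌) :
    (SSet.stdSimplex.{u}.map g ≫ horn.ι i p hp) ≫ Λ[n + 1, i].ι =
      SSet.stdSimplex.map (g ≫ δ p) :=
  (Category.assoc _ _ _).trans ((congrArg (SSet.stdSimplex.map g ≫ ·) (horn.ι_ι i p hp)).trans
    (SSet.stdSimplex.map_comp g (δ p)).symm)

lemma map_comp_hornι_eq {i p q : Fin (n + 2)} (hp : p ≠ i) (hq : q ≠ i) {g g' : ⦋l⦌ ⟶ ⦋n⦌}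
    (h : g ≫ δ p = g' ≫ δ q) : SSet.stdSimplex.{u}.map g ≫ horn.ι i p hp =
      SSet.stdSimplex.map g' ≫ horn.ι i q hq := by
  apply (cancel_mono (Λ[n + 1, i].ι : _ ⟶ Δ[n + 1])).1
  exact (map_comp_hornι hp g).trans ((congrArg _ h).trans (map_comp_hornι hq g').symm)

/-- The faces of a horn form a compatible family of simplices. -/
lemma compatibleOn_of_isCompatible {i : Fin (n + 2)}
    {f : ∀ (j : Fin (n + 2)) (_ : j ≠ i), Δ[n] ⟶ X} (hf : horn.IsCompatible f)
    (a : Fin (n + 2) → X _⦋n⦌) (ha : ∀ j hj, a j = yonedaEquiv (f j hj)) :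
    X.CompatibleOn {i}ᶜ a := by
  intro p hp q hq l g g' h
  have key : SSet.stdSimplex.map g ≫ f p hp = SSet.stdSimplex.map g' ≫ f q hq := by
    rw [← hf.ι_desc p hp, ← hf.ι_desc q hq, ← Category.assoc, map_comp_hornι_eq hp hq h,
      Category.assoc]
  rw [ha p hp, ha q hq]
  exact (yonedaEquiv_naturality g (f p hp)).trans
    ((congrArg yonedaEquiv key).trans (yonedaEquiv_naturality g' (f q hq)).symm)

end

end SSet

namespace FibrewiseGroup

variable {Q : SSet.{u}}

/-- If `Q` is the nerve of a groupoid, horns in `A` can be filled in `Q`, and then in `A`. -/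
lemma HasFillers.kanComplex {A : FibrewiseGroup Q} (hA : A.HasFillers)
    (hQ : IsInternalGroupoid (𝒟 := Type u) Q) : SSet.KanComplex A.tot := by
  classical
  refine SSet.KanComplex.iff.2 fun n i f hf => ?_
  let a (j : Fin (n + 2)) : A.tot _⦋n⦌ := if hj : j ≠ i then SSet.yonedaEquiv (f j hj) else
    SSet.yonedaEquiv (f (i.succAbove 0) (Fin.succAbove_ne _ _))
  have ha (j) (hj : j ≠ i) : a j = SSet.yonedaEquiv (f j hj) := dif_pos hj
  have hcomp := SSet.compatibleOn_of_isCompatible hf a ha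
  have hcompQ : Q.CompatibleOn {i}ᶜ (fun j => A.p.app _ (a j)) := fun p hp q hq l g g' h => by
    rw [← SSet.app_map, ← SSet.app_map, hcomp p hp q hq l g g' h]
  obtain ⟨i', hi'⟩ := Fin.exists_succAbove_eq (Fin.succAbove_ne i 0).symm
  obtain ⟨s, hs, -⟩ := hQ.exists_filler {i}ᶜ i (by simp) _ hcompQ
    (SSet.constSimplex _ (Q.vertex i' (A.p.app _ (a (i.succAbove 0))))) (fun j hj v hv => by
      refine Eq.trans ?_ (SSet.map_constSimplex _ _).symm
      rw [SSet.constSimplex_zero]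
      exact hcompQ j hj _ (Fin.succAbove_ne _ _) 0 _ _
        (Hom.ext_zero_left _ _ (hv.trans hi'.symm)))
  obtain ⟨b, hb⟩ := hA s {i}ᶜ i (by simp)
    (fun j => if hj : j ≠ i then ⟨a j, (hs j hj).symm⟩ else 0) (by
      intro p hp q hq l g g' h
      have hp' : p ≠ i := hp
      have hq' : q ≠ i := hq
      simp only [dif_pos hp', dif_pos hq']
      exact hcomp p hp q hq l g g' h)
  refine ⟨SSet.yonedaEquiv.symm b.1, fun j hj => ?_⟩
  rw [SSet.stdSimplex.δ_comp_yonedaEquiv_symm, Equiv.symm_apply_eq, ← ha j hj]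
  have := congrArg Subtype.val (hb j hj)
  simp only [dif_pos hj] at this
  exact this

/-- The zero section. -/
def zero (A : FibrewiseGroup Q) : Q ⟶ A.tot where
  app k := ↾fun s => (0 : A.Fib (k := k.unop.len) s).1
  naturality k l f := by
    ext s
    exact (congrArg Subtype.val (map_zero (A.res (k := k.unop.len) (l := l.unop.len) f.unop
      (s := s) rfl))).symm

lemma zero_app (A : FibrewiseGroup Q) {k : ℕ} (s : Q _⦋k⦌) : A.zero.app _ s = (0 : A.Fib s).1 := rfl

lemma zero_comp_p (A : FibrewiseGroup Q) : A.zero ≫ A.p = 𝟙 Q := by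
  ext k s
  exact (0 : A.Fib (k := k.unop.len) s).2

end FibrewiseGroup

namespace FibrewiseGroup.EMStructure

variable {Q : SSet.{u}} {M A : FibrewiseGroup Q} {m : ℕ}

include M in
lemma isCycle_one (hA : EMStructure M A m) {s : Q _⦋1⦌} (a : A.Fib s) : A.IsCycle a :=
  A.isCycle_iff.2 fun j => by
    have := hA.subsingleton (Q.map (δ j).op s)
    exact Subsingleton.elim _ _

/-- All vertices of `A` lie on the zero section. -/
lemma val_eq_zero (hA : EMStructure M A m) (x : A.tot _⦋0⦌) :
    x = A.zero.app _ (A.p.app _ x) := by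
  have := hA.subsingleton (A.p.app _ x)
  exact congrArg Subtype.val (Subsingleton.elim (α := A.Fib (A.p.app _ x)) ⟨x, rfl⟩ 0)

/-- Two edges with the same image in `Q` are two faces of a triangle whose third face is
degenerate. -/
lemma exists_triangle (hA : EMStructure M A m) (hm : 0 < m) {s : Q _⦋1⦌} (a a' : A.Fib s) :
    ∃ t : A.tot _⦋2⦌, A.tot.δ (n := 1) 0 t = a.1 ∧ A.tot.δ (n := 1) 1 t = a'.1 ∧
      A.tot.δ (n := 1) 2 t = A.tot.σ (n := 0) 0 (A.tot.δ (n := 0) 1 a.1) := by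
  -- the difference of the edges bounds, and adding a degenerate triangle gives the required one
  obtain ⟨y, hy₀, hy⟩ := hA.exists_boundary hm (s := Q.map (σ 0).op s)
    (A.res (δ 0) rfl (A.res (σ 0) rfl (a - a'))) (hA.isCycle_one _)
  have hy₁ : A.res (δ 1) rfl y = 0 := hy 0
  have hy₂ : A.res (δ 2) rfl y = 0 := hy 1
  refine ⟨(y + A.res (σ 0) rfl a').1, ?_, ?_, ?_⟩
  · have : A.res (δ 0) rfl (y + A.res (σ 0) rfl a') = A.res (δ 0) rfl (A.res (σ 0) rfl a) := by
      rw [_root_.map_add, hy₀, ← _root_.map_add, ← _root_.map_add, sub_add_cancel]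
    exact (congrArg Subtype.val this).trans (SSet.δ_σ_eq_self (by decide) _)
  · have : A.res (δ 1) rfl (y + A.res (σ 0) rfl a') = A.res (δ 1) rfl (A.res (σ 0) rfl a') := by
      rw [_root_.map_add, hy₁, zero_add]
    exact (congrArg Subtype.val this).trans (SSet.δ_σ_eq_self (by decide) _)
  · have : A.res (δ 2) rfl (y + A.res (σ 0) rfl a') = A.res (δ 2) rfl (A.res (σ 0) rfl a') := by
      rw [_root_.map_add, hy₂, zero_add]
    refine (congrArg Subtype.val this).trans
      ((SSet.δ_σ_eq_σ_δ (i' := 1) (j' := 0) (by decide) _).trans ?_)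
    rw [hA.val_eq_zero (A.tot.δ 1 a'.1), hA.val_eq_zero (A.tot.δ 1 a.1)]
    congr 2
    exact (SSet.app_map A.p _ _).trans ((congrArg _ (a'.2.trans a.2.symm)).trans
      (SSet.app_map A.p _ _).symm)

open SSet.Truncated in
/-- Edges with the same endpoints and the same image in `Q` agree in the homotopy category; the
endpoints are only required to be propositionally equal. -/
lemma homMk_eq (hA : EMStructure M A m) (hm : 0 < m)
    {x y x' y' : ((SSet.truncation 2).obj A.tot).obj (op ⟨⦋0⦌, by decide⟩)} (e : Edge x y)
    (e' : Edge x' y') (hx : x' = x) (hy : y' = y)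
    (h : A.p.app (op ⦋1⦌) e.edge = A.p.app (op ⦋1⦌) e'.edge) :
    HomotopyCategory.homMk e' = eqToHom (congrArg _ hx) ≫ HomotopyCategory.homMk e ≫
      eqToHom (congrArg _ hy.symm) := by
  subst hx hy
  obtain ⟨t, h₀, h₁, h₂⟩ := hA.exists_triangle hm (s := A.p.app (op ⦋1⦌) e.edge) ⟨e.edge, rfl⟩
    ⟨e'.edge, h.symm⟩
  have := HomotopyCategory.homMk_comp_homMk (e₀₁ := .id _) (e₁₂ := e) (e₀₂ := e')
    ⟨t, h₂.trans (congrArg (A.tot.σ (n := 0) 0) e.src_eq), h₀, h₁⟩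
  simpa using this.symm

/-- The fundamental groupoid of `A` is that of `Q`, the zero section giving the inverse. -/
lemma isIso_hoFunctor_map (hA : EMStructure M A m) (hm : 0 < m) :
    IsIso (SSet.hoFunctor.map A.p) := by
  refine ⟨SSet.hoFunctor.map A.zero, ?_, ?_⟩
  · rw [← Functor.map_comp]
    ext1
    refine SSet.Truncated.HomotopyCategory.functor_ext
      (fun x => congrArg (SSet.Truncated.HomotopyCategory.mk (V := (SSet.truncation 2).obj A.tot))
        (a₁ := ((SSet.truncation 2).map (A.p ≫ A.zero)).app _ x) (hA.val_eq_zero x).symm)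
      fun x y e => hA.homMk_eq hm e (e.map ((SSet.truncation 2).map (A.p ≫ A.zero)))
        (hA.val_eq_zero x).symm (hA.val_eq_zero y).symm ?_
    exact (0 : A.Fib (A.p.app (op ⦋1⦌) e.edge)).2.symm
  · rw [← Functor.map_comp, A.zero_comp_p]
    exact SSet.hoFunctor.map_id Q

end FibrewiseGroup.EMStructure

end Homotopies

/-! ### The homotopy groups in terms of cycles -/

section HomotopyGroups

open Simplicial SimplexCategory

namespace FibrewiseGroup

variable {Q : SSet.{u}}

lemma IsCycle.res_eq_zero {A : FibrewiseGroup Q} {k l : ℕ} {s : Q _⦋k + 1⦌} {a : A.Fib s}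
    (ha : A.IsCycle a) (f : ⦋l⦌ ⟶ ⦋k + 1⦌) (j : Fin (k + 2)) (hf : ∀ i, f.toOrderHom i ≠ j)
    {t : Q _⦋l⦌} (h : Q.map f.op s = t) : A.res f h a = 0 :=
  A.res_eq_zero_of_face j (A.isCycle_iff.1 ha j) f hf h

namespace EMStructure

variable {M A : FibrewiseGroup Q} {m n : ℕ}

lemma ev_val_congr (hA : EMStructure M A m) {s s' : Q _⦋m + 1⦌} {t t' : Q _⦋1⦌}
    (h : Q.map (lastArrow m).op s = t) (h' : Q.map (lastArrow m).op s' = t') {a : A.Fib s}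
    {a' : A.Fib s'} (ha : a.1 = a'.1) : (hA.ev h a).1 = (hA.ev h' a').1 := by
  obtain ⟨a, rfl⟩ := a
  obtain ⟨a', rfl⟩ := a'
  obtain rfl : a = a' := ha
  subst h h'
  rfl

lemma zero_constSimplex (hA : EMStructure M A m) (k : ℕ) (x : A.tot _⦋0⦌) :
    (0 : A.Fib (SSet.constSimplex k (A.p.app _ x))).1 = SSet.constSimplex k x := by
  rw [← A.zero_app, SSet.app_constSimplex, ← hA.val_eq_zero]

/-- Pointed simplices of dimension at least `2` lie over constant simplices of `Q`, since the
simplices of `Q` are determined by their edges. -/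
lemma app_simplex (hM : M.IsGroupoidModule) (hn : 2 ≤ n) {x : A.tot _⦋0⦌}
    (α : A.tot.PtSimplex n x) :
    A.p.app _ (SSet.yonedaEquiv α.map) = SSet.constSimplex n (A.p.app _ x) := by
  have key (k : ℕ) (hk : k < n) (f : ⦋k⦌ ⟶ ⦋n⦌) : Q.map f.op (A.p.app _ (SSet.yonedaEquiv α.map)) =
      Q.map f.op (SSet.constSimplex n (A.p.app _ x)) := by
    obtain ⟨j, hj⟩ := SimplexCategory.exists_notMem_range f hk
    rw [← SSet.app_map, SSet.map_simplex_of_notMem α f j hj, SSet.app_constSimplex,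
      SSet.map_constSimplex]
  exact hM.base.edges_ext 0 (key 0 (by omega) _) fun i j hij _ => key 1 (by omega) _

/-- The element of a fibre given by a pointed simplex. -/
def ptFib (A : FibrewiseGroup Q) (hM : M.IsGroupoidModule) (hn : 2 ≤ n) {x : A.tot _⦋0⦌}
    (α : A.tot.PtSimplex n x) : A.Fib (SSet.constSimplex n (A.p.app _ x)) :=
  ⟨SSet.yonedaEquiv α.map, app_simplex hM hn α⟩

lemma ptFib_injective (hM : M.IsGroupoidModule) (hn : 2 ≤ n) {x : A.tot _⦋0⦌}
    {α β : A.tot.PtSimplex n x} (h : ptFib A hM hn α = ptFib A hM hn β) : α = β :=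
  SSet.RelativeMorphism.ext (SSet.yonedaEquiv.injective (congrArg Subtype.val h))

/-- The base point lies on the zero section, so that pointed simplices are cycles. -/
lemma isCycle_ptFib (hA : EMStructure M A m) (hM : M.IsGroupoidModule) (hn : 2 ≤ n)
    {x : A.tot _⦋0⦌} (α : A.tot.PtSimplex n x) : A.IsCycle (ptFib A hM hn α) := by
  intro l f hl
  obtain ⟨j, hj⟩ := SimplexCategory.exists_notMem_range f hl
  refine Subtype.ext ((SSet.map_simplex_of_notMem α f j hj).trans ?_)
  rw [← hA.zero_constSimplex]
  exact A.zero_val_eq (SSet.map_constSimplex _ _).symm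

lemma exists_ptFib (hA : EMStructure M A m) (hM : M.IsGroupoidModule) (hn : 2 ≤ n + 1)
    (x : A.tot _⦋0⦌) (a : A.Fib (SSet.constSimplex (n + 1) (A.p.app _ x))) (ha : A.IsCycle a) :
    ∃ α : A.tot.PtSimplex (n + 1) x, ptFib A hM hn α = a := by
  refine ⟨SSet.ptSimplexMk x a.1 fun k f j hj => ?_,
    Subtype.ext (SSet.yonedaEquiv_ptSimplexMk _ _ _)⟩
  rw [← hA.zero_constSimplex]
  exact congrArg Subtype.val (ha.res_eq_zero f j hj (SSet.map_constSimplex _ _))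

/-- The element of `M` which corresponds to a pointed simplex of dimension `m + 1`. -/
def evPt (hA : EMStructure M A m) (hM : M.IsGroupoidModule) (hm : 0 < m) {x : A.tot _⦋0⦌}
    (α : A.tot.PtSimplex (m + 1) x) : M.Fib (SSet.constSimplex 1 (A.p.app _ x)) :=
  hA.ev (SSet.map_constSimplex _ _) (ptFib A hM (by omega) α)

lemma evPt_injective (hA : EMStructure M A m) (hM : M.IsGroupoidModule) (hm : 0 < m)
    {x : A.tot _⦋0⦌} {α β : A.tot.PtSimplex (m + 1) x} (h : hA.evPt hM hm α = hA.evPt hM hm β) :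
    α = β := by
  refine ptFib_injective hM (by omega) (sub_eq_zero.1 (hA.eq_zero_of_ev _
    ((hA.isCycle_ptFib hM _ α).sub (hA.isCycle_ptFib hM _ β)) ?_))
  refine (hA.ev_eq_zero_iff (SSet.map_constSimplex _ _) _ _).1 ?_
  rw [_root_.map_sub]
  exact sub_eq_zero.2 h

lemma evPt_surjective (hA : EMStructure M A m) (hM : M.IsGroupoidModule) (hm : 0 < m)
    (x : A.tot _⦋0⦌) (c : M.Fib (SSet.constSimplex 1 (A.p.app _ x))) :
    ∃ α : A.tot.PtSimplex (m + 1) x, hA.evPt hM hm α = c := by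
  obtain ⟨a, ha, hac⟩ := hA.exists_cycle (SSet.map_constSimplex (lastArrow m) _) c
  obtain ⟨α, rfl⟩ := hA.exists_ptFib hM (by omega) x a ha
  exact ⟨α, hac⟩

/-- In a triangle of `M` over a constant triangle of `Q`, composition is addition. -/
lemma res_one_eq_add (hM : M.IsGroupoidModule) {q : Q _⦋0⦌} (z : M.Fib (SSet.constSimplex 2 q)) :
    M.res (δ 1) (SSet.map_constSimplex _ _) z = M.res (δ 2) (SSet.map_constSimplex _ _) z +
      M.res (δ 0) (SSet.map_constSimplex _ _) z := by
  have hs (i : Fin 2) (j : Fin 3) (a : M.Fib (SSet.constSimplex 1 q)) (h : δ j ≫ σ i = 𝟙 ⦋1⦌) :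
      M.res (δ j) (SSet.map_constSimplex _ _)
        (M.res (t := SSet.constSimplex 2 q) (σ i) (SSet.map_constSimplex _ _) a) = a :=
    Subtype.ext (SSet.δ_σ_eq_self h a.1)
  have hd (i : Fin 2) (j : Fin 3) (a : M.Fib (SSet.constSimplex 1 q)) (i' : Fin 1) (j' : Fin 2)
      (h : δ j ≫ σ i = σ i' ≫ δ j') :
      M.res (t := SSet.constSimplex 1 q) (δ j) (SSet.map_constSimplex _ _)
        (M.res (t := SSet.constSimplex 2 q) (σ i) (SSet.map_constSimplex _ _) a) = 0 := by
    rw [M.res_comm (t' := SSet.constSimplex 0 q) h _ _ (SSet.map_constSimplex _ _)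
      (SSet.map_constSimplex _ _)]
    have := hM.subsingleton (SSet.constSimplex 0 q)
    rw [Subsingleton.elim (M.res (δ j') _ a) 0, _root_.map_zero]
  -- `z` is the sum of two degenerate triangles, since it has the same faces `δ 0` and `δ 2`
  set f := M.res (δ 2) (SSet.map_constSimplex _ _) z with hf
  set g := M.res (δ 0) (SSet.map_constSimplex _ _) z with hg
  have : z - (M.res (σ 1) (SSet.map_constSimplex _ _) f +
      M.res (σ 0) (SSet.map_constSimplex _ _) g) = 0 := by
    refine hM.eq_zero_of_faces _ 0 2 (by decide) ?_ ?_
    · refine (M.res_eq_zero_iff _ (SSet.map_constSimplex _ _) _ _).1 ?_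
      rw [_root_.map_sub, _root_.map_add, hs 0 0 g (by decide), hd 1 0 f 0 0 (by decide), zero_add,
        hg, sub_self]
    · refine (M.res_eq_zero_iff _ (SSet.map_constSimplex _ _) _ _).1 ?_
      rw [_root_.map_sub, _root_.map_add, hs 1 2 f (by decide), hd 0 2 g 0 1 (by decide), add_zero,
        hf, sub_self]
  rw [sub_eq_zero.1 this, _root_.map_add, hs 1 1 f (by decide), hs 0 1 g (by decide)]

/-- The cocycle identity, with the simplices of `Q` involved given up to propositional equality. -/
lemma exists_cocycle_of_eq (hA : EMStructure M A m) {s : Q _⦋m + 2⦌} {t : Q _⦋2⦌}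
    (ht : Q.map (lastTriangle m).op s = t) {s' : Fin (m + 3) → Q _⦋m + 1⦌}
    (hs : ∀ j, Q.map (δ j).op s = s' j) {t₀ t₁ t₂ : Q _⦋1⦌} (e₀ : Q.map (δ 0).op t = t₀)
    (e₁ : Q.map (δ 1).op t = t₁) (e₂ : Q.map (δ 2).op t = t₂)
    (h₂ : Q.map (lastArrow m).op (s' (Fin.last (m + 2))) = t₂)
    (h₁ : Q.map (lastArrow m).op (s' (Fin.last (m + 1)).castSucc) = t₁)
    (h₀ : ∀ j : Fin (m + 1), Q.map (lastArrow m).op (s' j.castSucc.castSucc) = t₀) (b : A.Fib s) :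
    ∃ z : M.Fib t, M.res (δ 2) e₂ z = hA.ev h₂ (A.res _ (hs _) b) ∧
      M.res (δ 1) e₁ z = hA.ev h₁ (A.res _ (hs _) b) ∧
      M.res (δ 0) e₀ z = ∑ j : Fin (m + 1), (-1 : ℤ) ^ (m + j.1) •
        hA.ev (h₀ j) (A.res _ (hs _) b) := by
  obtain rfl : (fun j => Q.map (δ j).op s) = s' := funext hs
  subst e₀ e₁ e₂
  exact hA.exists_cocycle ht h₂ h₁ h₀ b

/-- Over a constant simplex, `ev` is a cocycle. -/
lemma sum_ev_eq_zero (hA : EMStructure M A m) (hM : M.IsGroupoidModule) {q : Q _⦋0⦌}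
    (b : A.Fib (SSet.constSimplex (m + 2) q)) :
    ∑ j : Fin (m + 3), (-1 : ℤ) ^ (m + j.1) • hA.ev (t := SSet.constSimplex 1 q)
      (SSet.map_constSimplex _ _) (A.res (δ j) (SSet.map_constSimplex _ _) b) = 0 := by
  obtain ⟨z, h₂, h₁, h₀⟩ := hA.exists_cocycle_of_eq (t := SSet.constSimplex 2 q)
    (SSet.map_constSimplex _ _) (fun j => SSet.map_constSimplex (δ j) _)
    (SSet.map_constSimplex _ _) (SSet.map_constSimplex _ _) (SSet.map_constSimplex _ _)
    (SSet.map_constSimplex _ _) (SSet.map_constSimplex _ _)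
    (fun j => SSet.map_constSimplex _ _) b
  have h := res_one_eq_add hM z
  rw [h₀, h₁, h₂] at h
  rw [Fin.sum_univ_castSucc, Fin.sum_univ_castSucc, h]
  have e₁ : (-1 : ℤ) ^ (m + (Fin.last (m + 1)).castSucc.1) = -1 := by
    rw [show m + (Fin.last (m + 1)).castSucc.1 = 2 * m + 1 by simp; ring, pow_succ, pow_mul]
    simp
  have e₂ : (-1 : ℤ) ^ (m + (Fin.last (m + 2)).1) = 1 := by
    rw [show m + (Fin.last (m + 2)).1 = 2 * (m + 1) by simp; ring, pow_mul]
    simp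
  rw [e₁, e₂]
  simp only [Fin.val_castSucc]
  module

lemma app_simplex_of_faces (hM : M.IsGroupoidModule) (hn : 2 ≤ n) {x : A.tot _⦋0⦌}
    (b : A.tot _⦋n + 1⦌) (hb : ∀ j, A.p.app _ (A.tot.δ j b) = SSet.constSimplex n (A.p.app _ x)) :
    A.p.app _ b = SSet.constSimplex (n + 1) (A.p.app _ x) := by
  have key (k : ℕ) (hk : k < n + 1) (f : ⦋k⦌ ⟶ ⦋n + 1⦌) : Q.map f.op (A.p.app _ b) =
      Q.map f.op (SSet.constSimplex (n + 1) (A.p.app _ x)) := by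
    obtain ⟨j, hj⟩ := SimplexCategory.exists_notMem_range f hk
    obtain ⟨g, rfl⟩ := eq_comp_δ_of_not_surjective' f j hj
    have h := congrArg (Q.map g.op) (hb j)
    rw [SSet.map_constSimplex] at h
    rw [SSet.map_constSimplex, ← h, ← SSet.map_map]
    exact congrArg (Q.map g.op) (SSet.app_map A.p _ _).symm
  exact hM.base.edges_ext 0 (key 0 (by omega) _) fun i j hij _ => key 1 (by omega) _

/-- The bijection between homotopy classes and elements of `M` is additive. -/
lemma evPt_add (hA : EMStructure M A m) (hM : M.IsGroupoidModule) (hm : 0 < m) {x : A.tot _⦋0⦌}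
    (α β ω : A.tot.PtSimplex (m + 1) x) (i : Fin (m + 1))
    (h : SSet.PtSimplex.MulStruct α β ω i) :
    hA.evPt hM hm ω = hA.evPt hM hm α + hA.evPt hM hm β := by
  set b := SSet.yonedaEquiv h.map with hb
  have hi : i.castSucc.castSucc < i.castSucc.succ := Fin.castSucc_lt_succ
  have hi' : i.castSucc.succ < i.succ.succ := by simp
  have hβ : A.tot.δ i.castSucc.castSucc b = SSet.yonedaEquiv β.map := by
    rw [hb, ← SSet.stdSimplex.yonedaEquiv_δ_comp, h.δ_castSucc_castSucc_map]
  have hω : A.tot.δ i.castSucc.succ b = SSet.yonedaEquiv ω.map := by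
    rw [hb, ← SSet.stdSimplex.yonedaEquiv_δ_comp, h.δ_succ_castSucc_map]
  have hα : A.tot.δ i.succ.succ b = SSet.yonedaEquiv α.map := by
    rw [hb, ← SSet.stdSimplex.yonedaEquiv_δ_comp, h.δ_succ_succ_map]
  have hc (j : Fin (m + 3)) (h₀ : j ≠ i.castSucc.castSucc) (h₁ : j ≠ i.castSucc.succ)
      (h₂ : j ≠ i.succ.succ) : A.tot.δ j b = SSet.constSimplex (m + 1) x := by
    have : SSet.stdSimplex.δ j ≫ h.map = SSet.const x := by
      rcases lt_or_ge j i.castSucc.castSucc with hj | hj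
      · exact h.δ_map_of_lt j hj
      · refine h.δ_map_of_gt j ?_
        simp only [Fin.lt_def, Fin.le_def, Ne, Fin.ext_iff, Fin.val_succ, Fin.val_castSucc] at *
        omega
    rw [hb, ← SSet.stdSimplex.yonedaEquiv_δ_comp, this]
    rfl
  have hpb : A.p.app _ b = SSet.constSimplex (m + 2) (A.p.app _ x) := by
    refine app_simplex_of_faces hM (by omega) b fun j => ?_
    by_cases h₀ : j = i.castSucc.castSucc
    · rw [h₀, hβ, app_simplex hM (by omega)]
    by_cases h₁ : j = i.castSucc.succ
    · rw [h₁, hω, app_simplex hM (by omega)]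
    by_cases h₂ : j = i.succ.succ
    · rw [h₂, hα, app_simplex hM (by omega)]
    rw [hc j h₀ h₁ h₂, SSet.app_constSimplex]
  -- only the three faces `β`, `ω`, `α` contribute to the cocycle identity, with alternating signs
  have hsum := hA.sum_ev_eq_zero hM (q := A.p.app _ x) ⟨b, hpb⟩
  rw [← Finset.sum_subset (Finset.subset_univ
    {i.castSucc.castSucc, i.castSucc.succ, i.succ.succ}) (fun j _ hj => by
      simp only [Finset.mem_insert, Finset.mem_singleton, not_or] at hj
      have : A.res (t := SSet.constSimplex (m + 1) (A.p.app _ x)) (δ j)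
          (SSet.map_constSimplex _ _) ⟨b, hpb⟩ = 0 :=
        Subtype.ext ((hc j hj.1 hj.2.1 hj.2.2).trans (hA.zero_constSimplex _ _).symm)
      rw [this, _root_.map_zero, smul_zero]), Finset.sum_insert (by
        simp [hi.ne, (hi.trans hi').ne]), Finset.sum_insert (by simpa using hi'.ne),
    Finset.sum_singleton] at hsum
  have eβ : A.res (t := SSet.constSimplex (m + 1) (A.p.app _ x)) (δ i.castSucc.castSucc)
      (SSet.map_constSimplex _ _) ⟨b, hpb⟩ = ptFib A hM (by omega) β := Subtype.ext hβ
  have eω : A.res (t := SSet.constSimplex (m + 1) (A.p.app _ x)) (δ i.castSucc.succ)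
      (SSet.map_constSimplex _ _) ⟨b, hpb⟩ = ptFib A hM (by omega) ω := Subtype.ext hω
  have eα : A.res (t := SSet.constSimplex (m + 1) (A.p.app _ x)) (δ i.succ.succ)
      (SSet.map_constSimplex _ _) ⟨b, hpb⟩ = ptFib A hM (by omega) α := Subtype.ext hα
  rw [eβ, eω, eα] at hsum
  change _ • hA.evPt hM hm β + (_ • hA.evPt hM hm ω + _ • hA.evPt hM hm α) = 0 at hsum
  simp only [Fin.val_succ, Fin.val_castSucc, ← add_assoc, pow_succ] at hsum
  rcases neg_one_pow_eq_or ℤ (m + i.1) with hp | hp <;> rw [hp] at hsum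
  · refine sub_eq_zero.1 (Eq.trans ?_ (congrArg Neg.neg hsum |>.trans neg_zero))
    module
  · refine sub_eq_zero.1 (Eq.trans ?_ hsum)
    module

end EMStructure

end FibrewiseGroup

end HomotopyGroups

/-! ### Simplices of prisms -/

section Prisms

open Simplicial SimplexCategory

namespace SSet

variable {X Y : SSet.{u}} {k l n : ℕ}

/-- The simplex of the prism `Δ[n] ⊗ Δ[1]` given by two operators. -/
def prismSimplex (f : ⦋k⦌ ⟶ ⦋n⦌) (g : ⦋k⦌ ⟶ ⦋1⦌) : (Δ[n] ⊗ Δ[1] : SSet.{u}) _⦋k⦌ :=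
  (SSet.stdSimplex.objEquiv.symm f, SSet.stdSimplex.objEquiv.symm g)

/-- The monotone map `(v, 0) ↦ δ 1 v`, `(v, 1) ↦ δ 0 v`. -/
def prismVertex (v : Fin (n + 1)) (ε : Fin 2) : Fin (n + 2) :=
  if ε = 0 then Fin.succAbove 1 v else v.succ

lemma prismVertex_val (v : Fin (n + 1)) (ε : Fin 2) :
    (prismVertex v ε).1 = if v.1 = 0 ∧ ε = 0 then 0 else v.1 + 1 := by
  unfold prismVertex Fin.succAbove
  by_cases h : ε = 0 <;> by_cases h' : v.1 = 0 <;> simp [h, h', Fin.lt_def]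

lemma prismVertex_mono {v v' : Fin (n + 1)} {ε ε' : Fin 2} (hv : v ≤ v') (hε : ε ≤ ε') :
    prismVertex v ε ≤ prismVertex v' ε' := by
  rw [Fin.le_def, prismVertex_val, prismVertex_val]
  rw [Fin.le_def] at hv
  split_ifs <;> omega

/-- The map of a prism to a simplex which restricts to the faces `δ 1` and `δ 0` on the two ends. -/
def prismMap (n : ℕ) : (Δ[n] ⊗ Δ[1] : SSet.{u}) ⟶ Δ[n + 1] where
  app _ := ↾fun x => SSet.stdSimplex.objMk
    { toFun := fun i => prismVertex ((SSet.stdSimplex.objEquiv x.1).toOrderHom i)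
        ((SSet.stdSimplex.objEquiv x.2).toOrderHom i)
      monotone' := fun _ _ h => prismVertex_mono
        ((SSet.stdSimplex.objEquiv x.1).toOrderHom.monotone h)
        ((SSet.stdSimplex.objEquiv x.2).toOrderHom.monotone h) }
  naturality _ _ _ := rfl

lemma ι₀_prismMap : ι₀ ≫ prismMap.{u} n = SSet.stdSimplex.δ 1 := by
  ext k x
  rfl

lemma ι₁_prismMap : ι₁ ≫ prismMap.{u} n = SSet.stdSimplex.δ 0 := by
  ext k x
  rfl

/-- If all but the first two faces of a simplex are constant, and these are pointed simplices,
then they are homotopic. -/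
lemma homotopy_of_faces {x : X _⦋0⦌} (α β : X.PtSimplex n x) (t : X _⦋n + 1⦌)
    (h₀ : X.δ 0 t = SSet.yonedaEquiv α.map) (h₁ : X.δ 1 t = SSet.yonedaEquiv β.map)
    (ht : ∀ j, j ≠ 0 → j ≠ 1 → X.δ j t = constSimplex n x) :
    Nonempty (SSet.RelativeMorphism.Homotopy β α) := by
  refine ⟨⟨prismMap n ≫ SSet.yonedaEquiv.symm t, ?_, ?_, ?_⟩⟩
  · rw [← Category.assoc, ι₀_prismMap, SSet.stdSimplex.δ_comp_yonedaEquiv_symm, h₁,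
      Equiv.symm_apply_apply]
  · rw [← Category.assoc, ι₁_prismMap, SSet.stdSimplex.δ_comp_yonedaEquiv_symm, h₀,
      Equiv.symm_apply_apply]
  · ext ⟨k⟩ ⟨⟨f, hf⟩, g⟩
    induction k using SimplexCategory.rec with
    | mk k =>
      have hf' : ¬ Function.Surjective (SSet.stdSimplex.asOrderHom f) := hf
      rw [Function.Surjective] at hf'
      push Not at hf'
      obtain ⟨v, hv⟩ := hf'
      let r : ⦋k⦌ ⟶ ⦋n + 1⦌ := SSet.stdSimplex.objEquiv ((prismMap n).app (op ⦋k⦌) (f, g))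
      change X.map r.op t = constSimplex k x
      have hr (i : Fin (k + 1)) : r.toOrderHom i = prismVertex (SSet.stdSimplex.asOrderHom f i)
        (SSet.stdSimplex.asOrderHom g i) := rfl
      -- if `v = 0` is omitted, the simplex lies in the face `δ 0`; otherwise it omits `v + 1`
      by_cases h : v = 0
      · subst h
        have : r = SSet.stdSimplex.objEquiv f ≫ δ 0 := by
          apply SimplexCategory.Hom.ext
          ext i : 2
          refine (hr i).trans ?_
          change _ = Fin.succAbove 0 (SSet.stdSimplex.asOrderHom f i)
          have := hv i
          rw [Ne, Fin.ext_iff] at this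
          rw [Fin.ext_iff, prismVertex_val, Fin.succAbove_zero_apply, Fin.val_succ,
            if_neg fun h => this h.1]
        rw [this, ← SSet.map_map]
        exact (congrArg _ h₀).trans (map_simplex_of_notMem α _ 0 hv)
      · obtain ⟨r', hr'⟩ := eq_comp_δ_of_not_surjective' r v.succ fun i hi => by
          have h₁ := hv i
          rw [Fin.ext_iff] at h
          rw [Ne, Fin.ext_iff] at h₁
          rw [hr, Fin.ext_iff, prismVertex_val, Fin.val_succ] at hi
          split_ifs at hi
          omega
        rw [hr', ← SSet.map_map]
        refine (congrArg _ (ht v.succ ?_ ?_)).trans (map_constSimplex _ _)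
        · exact Fin.succ_ne_zero v
        · exact fun e => h (Fin.succ_injective _ (e.trans Fin.succ_zero_eq_one.symm))

/-- The simplices of a homotopy `H`: the value of `H` at the simplex of the prism given by two
operators. -/
def prismCell (H : Δ[n] ⊗ Δ[1] ⟶ X) (f : ⦋k⦌ ⟶ ⦋n⦌) (g : ⦋k⦌ ⟶ ⦋1⦌) : X _⦋k⦌ :=
  H.app _ (prismSimplex f g)

section

variable (H : Δ[n] ⊗ Δ[1] ⟶ X)

lemma map_prismCell (r : ⦋l⦌ ⟶ ⦋k⦌) (f : ⦋k⦌ ⟶ ⦋n⦌) (g : ⦋k⦌ ⟶ ⦋1⦌) :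
    X.map r.op (prismCell H f g) = prismCell H (r ≫ f) (r ≫ g) :=
  (SSet.app_map H r _).symm

variable {H}

/-- A homotopy which is constantly `e` on the boundary is given by `e` on the simplices lying over
a proper face. -/
lemma prismCell_of_notMem {e : X _⦋1⦌}
    (hH : (boundary n).ι ▷ Δ[1] ≫ H = snd _ _ ≫ SSet.yonedaEquiv.symm e) (f : ⦋k⦌ ⟶ ⦋n⦌)
    (g : ⦋k⦌ ⟶ ⦋1⦌) (j : Fin (n + 1)) (hf : ∀ i, f.toOrderHom i ≠ j) :
    prismCell H f g = X.map g.op e := by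
  have hf' : SSet.stdSimplex.objEquiv.symm f ∈ (boundary n).obj (op ⦋k⦌) := fun h => by
    obtain ⟨i, hi⟩ := h j
    exact hf i hi
  exact ConcreteCategory.congr_hom (NatTrans.congr_app hH (op ⦋k⦌))
    ((⟨SSet.stdSimplex.objEquiv.symm f, hf'⟩, SSet.stdSimplex.objEquiv.symm g) :
      (((boundary n : SSet) ⊗ Δ[1] : SSet.{u}) _⦋k⦌))

lemma prismCell_const_zero {φ : Δ[n] ⟶ X} (h : ι₀ ≫ H = φ) :
    prismCell H (𝟙 _) (SimplexCategory.const ⦋n⦌ ⦋1⦌ 0) = SSet.yonedaEquiv φ := by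
  subst h
  rfl

lemma prismCell_const_one {φ : Δ[n] ⟶ X} (h : ι₁ ≫ H = φ) :
    prismCell H (𝟙 _) (SimplexCategory.const ⦋n⦌ ⦋1⦌ 1) = SSet.yonedaEquiv φ := by
  subst h
  rfl

end

end SSet

end Prisms

/-! ### Vanishing of homotopy groups, and the action of edges -/

section Transport

open Simplicial SimplexCategory

lemma Fin.val_predAbove {n : ℕ} (j : Fin (n + 1)) (y : Fin (n + 2)) :
    (j.predAbove y).1 = if j.1 < y.1 then y.1 - 1 else y.1 := by
  unfold Fin.predAbove
  simp only [Fin.lt_def, Fin.val_castSucc]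
  split_ifs <;> rfl

lemma Fin.predAbove_succAbove_ne {n : ℕ} (i : Fin (n + 2)) (j : Fin (n + 1)) (h : i ≠ j.castSucc)
    (h' : i ≠ j.succ) (x : Fin (n + 1)) : j.predAbove (i.succAbove x) ≠ j.predAbove i := by
  intro e
  have := Fin.succAbove_ne i x
  generalize i.succAbove x = y at *
  simp only [Fin.ext_iff, Fin.val_predAbove, Ne, Fin.val_castSucc, Fin.val_succ] at *
  split_ifs at e <;> omega

lemma lastTriangle_comp_toMk₁ (m : ℕ) :
    lastTriangle m ≫ toMk₁ (Fin.last m).castSucc.succ.castSucc = σ 1 := by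
  apply SimplexCategory.Hom.ext
  ext i : 2
  change (if (lastTriangle m i).castSucc < _ then (0 : Fin 2) else 1) = Fin.predAbove 1 i
  fin_cases i
  · exact if_pos (show m < m + 1 by omega)
  · exact if_neg (show ¬ m + 1 < m + 1 by omega)
  · exact if_neg (show ¬ m + 2 < m + 1 by omega)

lemma lastTriangle_comp_toMk₁_last (m : ℕ) :
    lastTriangle m ≫ toMk₁ (Fin.last (m + 1)).succ.castSucc = σ 0 := by
  apply SimplexCategory.Hom.ext
  ext i : 2
  change (if (lastTriangle m i).castSucc < _ then (0 : Fin 2) else 1) = Fin.predAbove 0 i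
  fin_cases i
  · exact if_pos (show m < m + 2 by omega)
  · exact if_pos (show m + 1 < m + 2 by omega)
  · exact if_neg (show ¬ m + 2 < m + 2 by omega)

namespace FibrewiseGroup.EMStructure

variable {Q : SSet.{u}} {M A : FibrewiseGroup Q} {m n : ℕ}

/-- Cycles of small dimension are boundaries; the faces of the simplex of `Q` are given up to
propositional equality. -/
lemma exists_boundary_of_eq (hA : EMStructure M A m) {k : ℕ} (hk : k < m) {s : Q _⦋k + 2⦌}
    {s' : Fin (k + 3) → Q _⦋k + 1⦌} (hs : ∀ j, Q.map (δ j).op s = s' j) (c : A.Fib (s' 0))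
    (hc : A.IsCycle c) : ∃ y : A.Fib s, A.res (δ 0) (hs 0) y = c ∧
      ∀ j, j ≠ 0 → A.res (δ j) (hs j) y = 0 := by
  obtain rfl : (fun j => Q.map (δ j).op s) = s' := funext hs
  obtain ⟨y, hy₀, hy⟩ := hA.exists_boundary hk c hc
  refine ⟨y, hy₀, fun j hj => ?_⟩
  obtain ⟨j, rfl⟩ := Fin.eq_succ_of_ne_zero hj
  exact hy j

/-- The homotopy groups of `A` of dimension at least `2` and different from `m + 1` vanish. -/
lemma nonempty_homotopy (hA : EMStructure M A m) (hM : M.IsGroupoidModule) (hn : 2 ≤ n)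
    (hnm : n ≠ m + 1) {x : A.tot _⦋0⦌} (α β : A.tot.PtSimplex n x) :
    Nonempty (SSet.RelativeMorphism.Homotopy α β) := by
  obtain ⟨k, rfl⟩ := Nat.exists_eq_add_of_le' (show 1 ≤ n by omega)
  rcases lt_or_ge k m with hk | hk
  · -- the cycle `β - α` bounds some `y`; adding a degeneracy of `α` gives a simplex with faces
    -- `β`, `α` and otherwise constant ones
    set q := A.p.app _ x
    have hs (j : Fin (k + 3)) : Q.map (δ j).op (SSet.constSimplex (k + 2) q) =
      SSet.constSimplex (k + 1) q := SSet.map_constSimplex _ _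
    obtain ⟨y, hy₀, hy⟩ := hA.exists_boundary_of_eq hk hs (ptFib A hM hn β - ptFib A hM hn α)
      ((hA.isCycle_ptFib hM hn β).sub (hA.isCycle_ptFib hM hn α))
    let a : A.Fib (SSet.constSimplex (k + 2) q) :=
      A.res (σ 0) (SSet.map_constSimplex _ _) (ptFib A hM hn α)
    have ha (j : Fin (k + 3)) (h : δ j ≫ σ 0 = 𝟙 ⦋k + 1⦌) :
        A.res (δ j) (hs j) a = ptFib A hM hn α :=
      Subtype.ext (SSet.δ_σ_eq_self h _)
    refine SSet.homotopy_of_faces β α (y + a).1 ?_ ?_ fun j hj₀ hj₁ => ?_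
    · refine congrArg Subtype.val (a₁ := A.res (δ 0) (hs 0) (y + a)) (a₂ := ptFib A hM hn β) ?_
      rw [_root_.map_add, hy₀, ha 0 (δ_comp_σ_self (i := 0)), sub_add_cancel]
    · refine congrArg Subtype.val (a₁ := A.res (δ 1) (hs 1) (y + a)) (a₂ := ptFib A hM hn α) ?_
      rw [_root_.map_add, hy 1 (by simp), ha 1 (δ_comp_σ_succ (i := 0)), zero_add]
    · rw [← hA.zero_constSimplex]
      refine congrArg Subtype.val (a₁ := A.res (δ j) (hs j) (y + a)) (a₂ := 0) ?_
      rw [_root_.map_add, hy j hj₀, zero_add, A.res_res]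
      exact (hA.isCycle_ptFib hM hn α).res_eq_zero _ (Fin.predAbove 0 j)
        (Fin.predAbove_succAbove_ne j 0 hj₀ hj₁) _
  · -- all cycles of this dimension vanish
    obtain ⟨k, rfl⟩ := Nat.exists_eq_add_of_le' (show 1 ≤ k by omega)
    have h (ω : A.tot.PtSimplex (k + 1 + 1) x) : ptFib A hM hn ω = 0 :=
      hA.eq_zero (by omega) _ (hA.isCycle_ptFib hM hn ω)
    rw [ptFib_injective hM hn ((h α).trans (h β).symm)]
    exact ⟨.refl _⟩

/-- If only two consecutive faces of a simplex are nonzero, and neither of them is among the last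
two faces, then these faces have the same image in `M`. -/
lemma ev_face_eq (hA : EMStructure M A m) (hM : M.IsGroupoidModule) {s : Q _⦋m + 2⦌} (b : A.Fib s)
    (j : Fin m) (hb : ∀ i, i ≠ j.castSucc.castSucc.castSucc → i ≠ j.succ.castSucc.castSucc →
      A.res (δ i) rfl b = 0) :
    (hA.ev rfl (A.res (δ j.castSucc.castSucc.castSucc) rfl b)).1 =
      (hA.ev rfl (A.res (δ j.succ.castSucc.castSucc) rfl b)).1 := by
  obtain ⟨z, h₂, h₁, h₀⟩ := hA.cocycle b
  rw [hb _ (Fin.castSucc_lt_last _).ne' (Fin.castSucc_lt_last _).ne', _root_.map_zero] at h₂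
  rw [hb _ (by simpa [Fin.ext_iff] using by omega) (by simpa [Fin.ext_iff] using by omega),
    _root_.map_zero] at h₁
  rw [hM.eq_zero_of_faces z 1 2 (by decide) h₁ h₂, _root_.map_zero, ← Finset.sum_subset
    (Finset.subset_univ {j.castSucc, j.succ}) (fun i _ hi => by
      simp only [Finset.mem_insert, Finset.mem_singleton, not_or] at hi
      rw [hb _ (fun e => hi.1 (by simpa [Fin.ext_iff] using e))
        (fun e => hi.2 (by simpa [Fin.ext_iff] using e)), _root_.map_zero, smul_zero]),
    Finset.sum_pair (Fin.castSucc_lt_succ).ne] at h₀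
  have h : hA.ev (lastArrow_base (lastArrow_comp_δ_castSucc_castSucc m j.castSucc) s)
      (A.res (δ j.castSucc.castSucc.castSucc) rfl b) =
      hA.ev (lastArrow_base (lastArrow_comp_δ_castSucc_castSucc m j.succ) s)
        (A.res (δ j.succ.castSucc.castSucc) rfl b) := by
    simp only [Fin.val_succ, Fin.val_castSucc, ← add_assoc, pow_succ] at h₀
    rcases neg_one_pow_eq_or ℤ (m + j.1) with hp | hp <;> rw [hp] at h₀
    · exact sub_eq_zero.1 (Eq.trans (by module) h₀.symm)
    · exact (sub_eq_zero.1 (Eq.trans (by module) h₀.symm)).symm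
  exact (hA.ev_val_congr _ _ rfl).trans ((congrArg Subtype.val h).trans (hA.ev_val_congr _ _ rfl))

/-- The cocycle identity for a simplex of which only the two faces opposite to the vertices `m`
and `m + 1` are nonzero. -/
lemma exists_triangle_zero_last (hA : EMStructure M A m) {s : Q _⦋m + 2⦌} (b : A.Fib s)
    (hb : ∀ i, i ≠ (Fin.last m).castSucc.castSucc → i ≠ (Fin.last (m + 1)).castSucc →
      A.res (δ i) rfl b = 0) :
    ∃ z : M.tot _⦋2⦌, M.tot.map (δ 2).op z =
        M.zero.app _ (Q.map (δ 2 ≫ lastTriangle m).op s) ∧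
      M.tot.map (δ 1).op z = (hA.ev rfl (A.res (δ (Fin.last (m + 1)).castSucc) rfl b)).1 ∧
      M.tot.map (δ 0).op z = (hA.ev rfl (A.res (δ (Fin.last m).castSucc.castSucc) rfl b)).1 := by
  obtain ⟨z, h₂, h₁, h₀⟩ := hA.cocycle b
  rw [hb _ (by simp [Fin.ext_iff]) (by simp [Fin.ext_iff]), _root_.map_zero] at h₂
  rw [← Finset.sum_subset (Finset.subset_univ {Fin.last m}) (fun i _ hi => by
      simp only [Finset.mem_singleton] at hi
      rw [hb _ (fun e => hi (by simpa [Fin.ext_iff] using e))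
        (fun e => by have := i.2; simp [Fin.ext_iff] at e; omega), _root_.map_zero, smul_zero]),
    Finset.sum_singleton, Fin.val_last, Even.neg_one_pow ⟨m, rfl⟩, one_smul] at h₀
  refine ⟨z.1, (congrArg Subtype.val h₂).trans (M.zero_val_eq (SSet.map_map _ _ _)),
    (congrArg Subtype.val h₁).trans (hA.ev_val_congr _ _ rfl),
    (congrArg Subtype.val h₀).trans (hA.ev_val_congr _ _ rfl)⟩

/-- The cocycle identity for a simplex of which only the last two faces are nonzero. -/
lemma exists_triangle_last_zero (hA : EMStructure M A m) {s : Q _⦋m + 2⦌} (b : A.Fib s)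
    (hb : ∀ i, i ≠ (Fin.last (m + 1)).castSucc → i ≠ Fin.last (m + 2) → A.res (δ i) rfl b = 0) :
    ∃ z : M.tot _⦋2⦌, M.tot.map (δ 2).op z = (hA.ev rfl (A.res (δ (Fin.last (m + 2))) rfl b)).1 ∧
      M.tot.map (δ 1).op z = (hA.ev rfl (A.res (δ (Fin.last (m + 1)).castSucc) rfl b)).1 ∧
      M.tot.map (δ 0).op z = M.zero.app _ (Q.map (δ 0 ≫ lastTriangle m).op s) := by
  obtain ⟨z, h₂, h₁, h₀⟩ := hA.cocycle b
  rw [Finset.sum_eq_zero fun i _ => by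
    rw [hb _ (fun e => by have := i.2; simp [Fin.ext_iff] at e; omega)
      (fun e => by have := i.2; simp [Fin.ext_iff] at e; omega), _root_.map_zero, smul_zero]] at h₀
  exact ⟨z.1, (congrArg Subtype.val h₂).trans (hA.ev_val_congr _ _ rfl),
    (congrArg Subtype.val h₁).trans (hA.ev_val_congr _ _ rfl),
    (congrArg Subtype.val h₀).trans (M.zero_val_eq (SSet.map_map _ _ _))⟩

/-- Let `C` assign to the simplices `(f, g)` of the prism `Δ[m + 1] ⊗ Δ[1]` elements of `A` over
the degenerate simplices of an edge `w`, compatibly with the simplicial operators, which vanish on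
the prism over the boundary. Then the values on the two ends of the prism correspond to each other
under conjugation by `w`. -/
lemma exists_triangles_of_prism (hA : EMStructure M A m) (hM : M.IsGroupoidModule) (w : Q _⦋1⦌)
    (C : ∀ {k : ℕ} (_ : ⦋k⦌ ⟶ ⦋m + 1⦌) (g : ⦋k⦌ ⟶ ⦋1⦌), A.Fib (Q.map g.op w))
    (hC : ∀ {k l : ℕ} (r : ⦋l⦌ ⟶ ⦋k⦌) (f : ⦋k⦌ ⟶ ⦋m + 1⦌) (g : ⦋k⦌ ⟶ ⦋1⦌),
      A.tot.map r.op (C f g).1 = (C (r ≫ f) (r ≫ g)).1)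
    (hC₀ : ∀ {k : ℕ} (f : ⦋k⦌ ⟶ ⦋m + 1⦌) (g : ⦋k⦌ ⟶ ⦋1⦌) (v : Fin (m + 2)),
      (∀ i, f.toOrderHom i ≠ v) → C f g = 0) :
    ∃ h : M.tot _⦋1⦌, (∃ z : M.tot _⦋2⦌,
        M.tot.map (δ 2).op z = (hA.ev rfl (C (𝟙 _) (toMk₁ (Fin.last (m + 2))))).1 ∧
        M.tot.map (δ 0).op z = M.zero.app _ w ∧ M.tot.map (δ 1).op z = h) ∧
      ∃ z : M.tot _⦋2⦌, M.tot.map (δ 2).op z = M.zero.app _ w ∧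
        M.tot.map (δ 0).op z = (hA.ev rfl (C (𝟙 _) (toMk₁ 0))).1 ∧ M.tot.map (δ 1).op z = h := by
  -- the values on the top-dimensional simplices of the prism and on the simplices between them
  let b (j : Fin (m + 2)) := C (σ j) (toMk₁ j.succ.castSucc)
  let V (j : Fin (m + 3)) : M.tot _⦋1⦌ := (hA.ev rfl (C (𝟙 _) (toMk₁ j))).1
  have hb (j : Fin (m + 2)) (i : Fin (m + 3)) (hi : i ≠ j.castSucc) (hi' : i ≠ j.succ) :
      A.res (δ i) rfl (b j) = 0 := by
    refine Subtype.ext ((hC _ _ _).trans ?_)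
    rw [hC₀ _ _ (j.predAbove i) (Fin.predAbove_succAbove_ne i j hi hi')]
    exact A.zero_val_eq (SSet.map_map _ _ _).symm
  have hV (j : Fin (m + 2)) (i j' : Fin (m + 3)) (h : δ i ≫ σ j = 𝟙 _)
      (h' : δ i ≫ toMk₁ j.succ.castSucc = toMk₁ j') :
      (hA.ev rfl (A.res (δ i) rfl (b j))).1 = V j' := by
    refine hA.ev_val_congr _ _ ((hC _ _ _).trans ?_)
    rw [h, h']
  have hV₁ (j : Fin (m + 2)) : (hA.ev rfl (A.res (δ j.castSucc) rfl (b j))).1 = V j.castSucc :=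
    hV _ _ _ δ_comp_σ_self ((δ_comp_toMk₁_of_lt _ _ (by simp [Fin.lt_def])).trans (by congr 1))
  have hV₂ (j : Fin (m + 2)) : (hA.ev rfl (A.res (δ j.succ) rfl (b j))).1 = V j.succ :=
    hV _ _ _ δ_comp_σ_succ ((δ_comp_toMk₁_of_le _ _ le_rfl).trans (by congr 1))
  -- all but the last two of the top-dimensional simplices are subject to `ev_face_eq`
  have hconst (j : Fin (m + 1)) : V j.castSucc.castSucc = V 0 := by
    induction j using Fin.induction with
    | zero => rfl
    | succ j ih =>
      rw [← ih]
      have := hA.ev_face_eq hM (b j.castSucc.castSucc) j (hb _)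
      rw [hV₁ j.castSucc.castSucc] at this
      exact (this.trans (hV₂ j.castSucc.castSucc)).symm
  have hw (j : Fin (m + 2)) (i : Fin 3) (i' : Fin 2)
      (h : lastTriangle m ≫ toMk₁ j.succ.castSucc = σ i')
      (h' : δ i ≫ σ i' = 𝟙 ⦋1⦌) :
      Q.map (δ i ≫ lastTriangle m).op (Q.map (toMk₁ j.succ.castSucc).op w) = w := by
    rw [SSet.map_map, Category.assoc, h, h']
    exact ConcreteCategory.congr_hom (Q.map_id _) w
  refine ⟨V (Fin.last (m + 1)).castSucc, ?_, ?_⟩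
  · obtain ⟨z, h₂, h₁, h₀⟩ := hA.exists_triangle_last_zero (b (Fin.last (m + 1)))
      (hb (Fin.last (m + 1)))
    have h₀' := hw (Fin.last (m + 1)) 0 0 (lastTriangle_comp_toMk₁_last m) (by decide)
    exact ⟨z, h₂.trans (hV₂ (Fin.last (m + 1))), h₀.trans (by rw [h₀']),
      h₁.trans (hV₁ (Fin.last (m + 1)))⟩
  · obtain ⟨z, h₂, h₁, h₀⟩ := hA.exists_triangle_zero_last (b (Fin.last m).castSucc)
      (hb (Fin.last m).castSucc)
    have h₂' := hw (Fin.last m).castSucc 2 1 (lastTriangle_comp_toMk₁ m) (by decide)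
    exact ⟨z, h₂.trans (by rw [h₂']),
      h₀.trans ((hV₁ (Fin.last m).castSucc).trans (hconst (Fin.last m))),
      h₁.trans (hV₂ (Fin.last m).castSucc)⟩

end FibrewiseGroup.EMStructure

end Transport

/-! ### Transport of pointed simplices -/

section TransportOfPointedSimplices

open Simplicial SimplexCategory

lemma SimplexCategory.toMk₁_zero (n : ℕ) :
    toMk₁ (0 : Fin (n + 2)) = SimplexCategory.const ⦋n⦌ ⦋0⦌ 0 ≫ δ 0 := by
  apply SimplexCategory.Hom.ext
  ext i : 2
  exact if_neg (t := (0 : Fin 2)) (show ¬ i.castSucc.1 < 0 from Nat.not_lt_zero _)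

lemma SimplexCategory.toMk₁_last (n : ℕ) :
    toMk₁ (Fin.last (n + 1)) = SimplexCategory.const ⦋n⦌ ⦋0⦌ 0 ≫ δ 1 := by
  apply SimplexCategory.Hom.ext
  ext i : 2
  exact if_pos (Fin.castSucc_lt_last _)

namespace FibrewiseGroup.EMStructure

variable {Q : SSet.{u}} {M A : FibrewiseGroup Q} {m n k : ℕ}

include M in
/-- Degeneracies of vertices vanish, since there is only one vertex in each fibre. -/
lemma res_eq_zero_of_factors (hA : EMStructure M A m) {l : ℕ} {s : Q _⦋k⦌} (a : A.Fib s)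
    (v : ⦋0⦌ ⟶ ⦋k⦌) (g : ⦋l⦌ ⟶ ⦋0⦌) : A.res (g ≫ v) rfl a = 0 := by
  have := hA.subsingleton (Q.map v.op s)
  rw [← A.res_res v g rfl (SSet.map_map _ _ _), Subsingleton.elim (A.res v rfl a) 0,
    _root_.map_zero]

/-- The simplices of a homotopy which is constantly `e` on the boundary lie over degeneracies of
the image of `e`, since the simplices of `Q` are determined by their edges. -/
lemma app_prismCell (hM : M.IsGroupoidModule) (hn : 2 ≤ n) {e : A.tot _⦋1⦌}
    {H : (Δ[n] ⊗ Δ[1] : SSet.{u}) ⟶ A.tot}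
    (hH : (SSet.boundary n).ι ▷ Δ[1] ≫ H = snd _ _ ≫ SSet.yonedaEquiv.symm e) (f : ⦋k⦌ ⟶ ⦋n⦌)
    (g : ⦋k⦌ ⟶ ⦋1⦌) : A.p.app _ (SSet.prismCell H f g) = Q.map g.op (A.p.app _ e) := by
  have key (l : ℕ) (hl : l < n) (r : ⦋l⦌ ⟶ ⦋k⦌) :
      Q.map r.op (A.p.app _ (SSet.prismCell H f g)) = Q.map r.op (Q.map g.op (A.p.app _ e)) := by
    obtain ⟨j, hj⟩ := SimplexCategory.exists_notMem_range (r ≫ f) hl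
    rw [← SSet.app_map, SSet.map_prismCell, SSet.prismCell_of_notMem hH _ _ j hj, SSet.app_map,
      SSet.map_map]
  exact hM.base.edges_ext 0 (key 0 (by omega) _) fun i j hij _ => key 1 (by omega) _

/-- Pointed simplices which correspond to each other under transport along an edge of `A` have
values in `M` which correspond to each other under conjugation by its image in `Q`. -/
lemma evPt_transport (hA : EMStructure M A m) (hM : M.IsGroupoidModule) (hm : 0 < m)
    (e : A.tot _⦋1⦌) {x y : A.tot _⦋0⦌} (hx : A.tot.map (δ 1).op e = x)
    (hy : A.tot.map (δ 0).op e = y) (α : A.tot.PtSimplex (m + 1) x) (β : A.tot.PtSimplex (m + 1) y)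
    (H : (Δ[m + 1] ⊗ Δ[1] : SSet.{u}) ⟶ A.tot) (h₀ : SSet.ι₀ ≫ H = α.map)
    (h₁ : SSet.ι₁ ≫ H = β.map)
    (hH : (SSet.boundary (m + 1)).ι ▷ Δ[1] ≫ H = snd _ _ ≫ SSet.yonedaEquiv.symm e) :
    ∃ h : M.tot _⦋1⦌, (∃ z : M.tot _⦋2⦌, M.tot.map (δ 2).op z = (hA.evPt hM hm α).1 ∧
        M.tot.map (δ 0).op z = M.zero.app _ (A.p.app _ e) ∧ M.tot.map (δ 1).op z = h) ∧
      ∃ z : M.tot _⦋2⦌, M.tot.map (δ 2).op z = M.zero.app _ (A.p.app _ e) ∧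
        M.tot.map (δ 0).op z = (hA.evPt hM hm β).1 ∧ M.tot.map (δ 1).op z = h := by
  -- subtracting the degeneracies of `e` makes the simplices of `H` vanish over the boundary
  subst hx hy
  let c {k : ℕ} (f : ⦋k⦌ ⟶ ⦋m + 1⦌) (g : ⦋k⦌ ⟶ ⦋1⦌) : A.Fib (Q.map g.op (A.p.app _ e)) :=
    ⟨SSet.prismCell H f g, app_prismCell hM (by omega) hH f g⟩
  let C {k : ℕ} (f : ⦋k⦌ ⟶ ⦋m + 1⦌) (g : ⦋k⦌ ⟶ ⦋1⦌) : A.Fib (Q.map g.op (A.p.app _ e)) :=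
    c f g - A.res g rfl ⟨e, rfl⟩
  obtain ⟨h, ⟨z, hz₂, hz₀, hz₁⟩, z', hz₂', hz₀', hz₁'⟩ := hA.exists_triangles_of_prism hM
    (A.p.app _ e) C (fun r f g => by
      refine (congrArg Subtype.val (_root_.map_sub (A.res r (SSet.map_map _ _ _)) (c f g)
        (A.res g rfl ⟨e, rfl⟩))).trans (congrArg Subtype.val (congrArg₂ (· - ·) ?_ ?_))
      · exact Subtype.ext (SSet.map_prismCell H r f g)
      · exact Subtype.ext (SSet.map_map _ _ _)) (fun f g v hv => sub_eq_zero.2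
      (Subtype.ext (SSet.prismCell_of_notMem hH f g v hv)))
  have hα : (C (𝟙 _) (toMk₁ (Fin.last (m + 2)))).1 = SSet.yonedaEquiv α.map := by
    change (c _ _ - _ : A.Fib _).1 = _
    rw [A.res_congr (toMk₁_last (m + 1)),
      (A.res_eq_zero_iff _ _ rfl _).2 (hA.res_eq_zero_of_factors _ (δ 1) _), sub_zero]
    exact (congrArg (SSet.prismCell H (𝟙 _)) (toMk₁_last (m + 1))).trans
      (SSet.prismCell_const_zero h₀)
  have hβ : (C (𝟙 _) (toMk₁ 0)).1 = SSet.yonedaEquiv β.map := by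
    change (c _ _ - _ : A.Fib _).1 = _
    rw [A.res_congr (toMk₁_zero (m + 1)),
      (A.res_eq_zero_iff _ _ rfl _).2 (hA.res_eq_zero_of_factors _ (δ 0) _), sub_zero]
    exact (congrArg (SSet.prismCell H (𝟙 _)) (toMk₁_zero (m + 1))).trans
      (SSet.prismCell_const_one h₁)
  exact ⟨h, ⟨z, hz₂.trans (hA.ev_val_congr _ _ hα), hz₀, hz₁⟩, z', hz₂',
    hz₀'.trans (hA.ev_val_congr _ _ hβ), hz₁'⟩

/-- The elements of `M` classify pointed simplices up to homotopy. A homotopy is a transport along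
a degenerate edge, so that the values at its ends are conjugate by an identity. -/
lemma nonempty_homotopy_iff (hA : EMStructure M A m) (hM : M.IsGroupoidModule) (hm : 0 < m)
    {x : A.tot _⦋0⦌} (α β : A.tot.PtSimplex (m + 1) x) :
    hA.evPt hM hm α = hA.evPt hM hm β ↔ Nonempty (SSet.RelativeMorphism.Homotopy α β) := by
  refine ⟨fun h => ?_, fun ⟨h⟩ => ?_⟩
  · rw [hA.evPt_injective hM hm h]
    exact ⟨.refl _⟩
  · have he (j : Fin 2) : A.tot.map (δ j).op (SSet.constSimplex 1 x) = x :=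
      (SSet.map_constSimplex _ _).trans (SSet.constSimplex_zero x)
    obtain ⟨g, ⟨z, hz₂, hz₀, hz₁⟩, z', hz₂', hz₀', hz₁'⟩ := hA.evPt_transport hM hm
      (SSet.constSimplex 1 x) (he 1) (he 0) α β h.h h.h₀ h.h₁ (by
        rw [h.rel]
        ext ⟨k⟩ ⟨a, b⟩
        induction k using SimplexCategory.rec with
        | mk k => exact (SSet.map_constSimplex (SSet.stdSimplex.objEquiv b) x).symm)
    have key (z : M.tot _⦋2⦌) (b c : M.Fib (SSet.constSimplex 1 (A.p.app _ x)))
        (h₂ : M.tot.map (δ 2).op z = b.1) (h₀ : M.tot.map (δ 0).op z = c.1) :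
        M.tot.map (δ 1).op z = (b + c).1 := by
      have hz : M.p.app _ z = SSet.constSimplex 2 (A.p.app _ x) := by
        refine hM.base.triangle_ext₀₂ ?_ ?_
        · exact (SSet.app_map M.p _ _).symm.trans ((congrArg _ h₀).trans
            (c.2.trans (SSet.map_constSimplex _ _).symm))
        · exact (SSet.app_map M.p _ _).symm.trans ((congrArg _ h₂).trans
            (b.2.trans (SSet.map_constSimplex _ _).symm))
      have := res_one_eq_add hM ⟨z, hz⟩
      rw [show M.res (δ 2) (SSet.map_constSimplex _ _) ⟨z, hz⟩ = b from Subtype.ext h₂,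
        show M.res (δ 0) (SSet.map_constSimplex _ _) ⟨z, hz⟩ = c from Subtype.ext h₀] at this
      exact congrArg Subtype.val this
    have hzero : M.zero.app _ (A.p.app _ (SSet.constSimplex 1 x)) =
        (0 : M.Fib (SSet.constSimplex 1 (A.p.app _ x))).1 := by
      rw [SSet.app_constSimplex]
      rfl
    have e₁ := key z _ 0 hz₂ (hz₀.trans hzero)
    have e₂ := key z' 0 _ (hz₂'.trans hzero) hz₀'
    rw [add_zero] at e₁
    rw [zero_add] at e₂
    exact Subtype.ext (e₁.symm.trans (hz₁.trans (hz₁'.symm.trans e₂)))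

end FibrewiseGroup.EMStructure

end TransportOfPointedSimplices

/-! ### Abelian group objects evaluated at set-valued functors -/

section Evaluation

/-- A set-valued functor preserves fibre powers if elements of the values at fibre powers are
tuples of elements with the same image. -/
structure PreservesFibrePowers {𝒟 : Type w} [Category.{v} 𝒟] [FibrePowers 𝒟] (F : 𝒟 ⥤ Type u) :
    Prop where
  exists_lift : ∀ {A X : 𝒟} (p : A ⟶ X) (k : ℕ) (x : F.obj X) (f : Fin k → F.obj A),
    (∀ i, F.map p (f i) = x) → ∃ t : F.obj (FibrePowers.pow p k),
      F.map (FibrePowers.base p k) t = x ∧ ∀ i, F.map (FibrePowers.proj p k i) t = f i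
  ext : ∀ {A X : 𝒟} (p : A ⟶ X) (k : ℕ) {s t : F.obj (FibrePowers.pow p k)},
    F.map (FibrePowers.base p k) s = F.map (FibrePowers.base p k) t →
    (∀ i, F.map (FibrePowers.proj p k i) s = F.map (FibrePowers.proj p k i) t) → s = t

namespace AbelianOver

variable {𝒟 : Type w} [Category.{v} 𝒟] {X : 𝒟} (A : AbelianOver X)
  {F G : 𝒟 ⥤ Type u} {Y Z : Type u}

/-- The elements of `F A` over an element of `F X`, where `F X` is identified with `Y`. -/
abbrev Fibre (A : AbelianOver X) (F : 𝒟 ⥤ Type u) (θ : F.obj X ≃ Y) (s : Y) : Type u :=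
  {a : F.obj A.obj // θ (F.map A.proj a) = s}

variable {A} in
/-- The element of the fibre given by a generalized element `f` of `A`. -/
def evalLift {θ : F.obj X ≃ Y} {T : 𝒟} {x : T ⟶ X} (f : LiftsAlong A.proj x) (τ : F.obj T) {s : Y}
    (h : θ (F.map x τ) = s) : A.Fibre F θ s :=
  ⟨F.map f.1 τ, by rw [← h, ← Functor.map_comp_apply, f.2]⟩

variable {A} in
lemma evalLift_comp {θ : F.obj X ≃ Y} {T T' : 𝒟} {x : T ⟶ X} {x' : T' ⟶ X} (t : T' ⟶ T)
    (hx : t ≫ x = x') (f : LiftsAlong A.proj x) (τ : F.obj T') {s : Y}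
    (h : θ (F.map x (F.map t τ)) = s) (h' : θ (F.map x' τ) = s) :
    evalLift f (F.map t τ) h = evalLift (A.precompHom t hx f) τ h' :=
  Subtype.ext (show F.map f.1 (F.map t τ) = F.map (t ≫ f.1) τ by rw [Functor.map_comp_apply])

variable [FibrePowers 𝒟] (hF : PreservesFibrePowers F) (θ : F.obj X ≃ Y) {s : Y}

include hF in
lemma exists_tuple (k : ℕ) (f : Fin k → A.Fibre F θ s) :
    ∃ t : F.obj (FibrePowers.pow A.proj k), θ (F.map (FibrePowers.base A.proj k) t) = s ∧
      ∀ i, F.map (FibrePowers.proj A.proj k i) t = (f i).1 := by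
  obtain ⟨t, ht, ht'⟩ := hF.exists_lift A.proj k (θ.symm s) (fun i => (f i).1)
    (fun i => by rw [Equiv.eq_symm_apply, (f i).2])
  exact ⟨t, by rw [ht, Equiv.apply_symm_apply], ht'⟩

/-- The tuple of elements of a fibre as an element of the fibre power. -/
def tuple (k : ℕ) (f : Fin k → A.Fibre F θ s) : F.obj (FibrePowers.pow A.proj k) :=
  (A.exists_tuple hF θ k f).choose

lemma base_tuple (k : ℕ) (f : Fin k → A.Fibre F θ s) :
    θ (F.map (FibrePowers.base A.proj k) (A.tuple hF θ k f)) = s :=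
  (A.exists_tuple hF θ k f).choose_spec.1

lemma proj_tuple (k : ℕ) (f : Fin k → A.Fibre F θ s) (i : Fin k) :
    F.map (FibrePowers.proj A.proj k i) (A.tuple hF θ k f) = (f i).1 :=
  (A.exists_tuple hF θ k f).choose_spec.2 i

lemma evalLift_coord (k : ℕ) (f : Fin k → A.Fibre F θ s) (i : Fin k) :
    evalLift (A.coord k i) (A.tuple hF θ k f) (A.base_tuple hF θ k f) = f i :=
  Subtype.ext (A.proj_tuple hF θ k f i)

lemma eq_tuple (k : ℕ) (f : Fin k → A.Fibre F θ s) (t : F.obj (FibrePowers.pow A.proj k))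
    (h : θ (F.map (FibrePowers.base A.proj k) t) = s)
    (h' : ∀ i, F.map (FibrePowers.proj A.proj k i) t = (f i).1) : t = A.tuple hF θ k f :=
  hF.ext A.proj k (θ.injective (h.trans (A.base_tuple hF θ k f).symm))
    (fun i => (h' i).trans (A.proj_tuple hF θ k f i).symm)

/-- Addition in a fibre, given by the addition of the two coordinates on the second fibre power. -/
def addFibre (a b : A.Fibre F θ s) : A.Fibre F θ s :=
  evalLift (A.coord 2 0 + A.coord 2 1) (A.tuple hF θ 2 ![a, b]) (A.base_tuple hF θ 2 _)

/-- Evaluation is additive: both sides factor through the universal case of the two coordinates on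
the second fibre power. -/
lemma evalLift_add {T : 𝒟} {x : T ⟶ X} (f g : LiftsAlong A.proj x) (τ : F.obj T)
    (h : θ (F.map x τ) = s) :
    evalLift (f + g) τ h = A.addFibre hF θ (evalLift f τ h) (evalLift g τ h) := by
  let t : T ⟶ FibrePowers.pow A.proj 2 := FibrePowers.lift A.proj 2 x ![f.1, g.1] (fun i => by
    fin_cases i
    · exact f.2
    · exact g.2)
  have ht : t ≫ FibrePowers.base A.proj 2 = x := FibrePowers.lift_base _ _ _ _ _
  have ht₀ : A.precompHom t ht (A.coord 2 0) = f := Subtype.ext (FibrePowers.lift_proj _ _ _ _ _ 0)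
  have ht₁ : A.precompHom t ht (A.coord 2 1) = g := Subtype.ext (FibrePowers.lift_proj _ _ _ _ _ 1)
  have hb : θ (F.map (FibrePowers.base A.proj 2) (F.map t τ)) = s := by
    rw [← Functor.map_comp_apply, ht, h]
  have key : F.map t τ = A.tuple hF θ 2 ![evalLift f τ h, evalLift g τ h] := by
    refine A.eq_tuple hF θ 2 _ _ hb fun i => ?_
    rw [← Functor.map_comp_apply, FibrePowers.lift_proj]
    fin_cases i <;> rfl
  have := evalLift_comp t ht (A.coord 2 0 + A.coord 2 1) τ hb h
  rw [map_add, ht₀, ht₁] at this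
  rw [← this]
  unfold addFibre
  congr 1

/-- The abelian group structure on the fibres. The axioms follow from those for the generalized
elements given by the coordinates on fibre powers. -/
@[reducible]
def addCommGroupFibre : AddCommGroup (A.Fibre F θ s) :=
  letI : Add (A.Fibre F θ s) := ⟨A.addFibre hF θ⟩
  letI : Zero (A.Fibre F θ s) := ⟨evalLift (0 : LiftsAlong A.proj (𝟙 X)) (θ.symm s) (by
    rw [F.map_id]
    exact θ.apply_symm_apply s)⟩
  letI : Neg (A.Fibre F θ s) := ⟨fun a =>
    evalLift (-A.coord 1 0) (A.tuple hF θ 1 fun _ => a) (A.base_tuple hF θ 1 _)⟩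
  have hadd {T : 𝒟} {x : T ⟶ X} (f g : LiftsAlong A.proj x) (τ : F.obj T) (h : θ (F.map x τ) = s) :
    evalLift (f + g) τ h = evalLift f τ h + evalLift g τ h := A.evalLift_add hF θ f g τ h
  have hzero {T : 𝒟} {x : T ⟶ X} (τ : F.obj T) (h : θ (F.map x τ) = s) :
      evalLift (0 : LiftsAlong A.proj x) τ h = 0 := by
    have h' : F.map x τ = θ.symm s := by rw [Equiv.eq_symm_apply, h]
    have := evalLift_comp x (Category.comp_id x) (0 : LiftsAlong A.proj (𝟙 X)) τ (s := s) (θ := θ)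
      (by rw [← Functor.map_comp_apply, Category.comp_id, h]) h
    rw [map_zero] at this
    rw [← this]
    exact Subtype.ext (congrArg (F.map A.unit) h')
  have htuple (k : ℕ) (f : Fin k → A.Fibre F θ s) :
      ∃ t h, ∀ i, evalLift (A.coord k i) t h = f i :=
    ⟨_, A.base_tuple hF θ k f, A.evalLift_coord hF θ k f⟩
  have hcomm (a b : A.Fibre F θ s) : a + b = b + a := by
    obtain ⟨t, h, ht⟩ := htuple 2 ![a, b]
    obtain rfl := ht 0
    obtain rfl := ht 1
    rw [← hadd, ← hadd, add_comm]
  have hassoc (a b c : A.Fibre F θ s) : a + b + c = a + (b + c) := by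
    obtain ⟨t, h, ht⟩ := htuple 3 ![a, b, c]
    obtain rfl := ht 0
    obtain rfl := ht 1
    obtain rfl := ht 2
    rw [← hadd, ← hadd, ← hadd, ← hadd, add_assoc]
  have hz (a : A.Fibre F θ s) : 0 + a = a := by
    obtain ⟨t, h, ht⟩ := htuple 1 ![a]
    obtain rfl := ht 0
    rw [← hzero t h, ← hadd, zero_add]
  have hneg (a : A.Fibre F θ s) : -a + a = 0 := by
    have h := A.evalLift_coord hF θ 1 (fun _ => a) 0
    refine (congrArg (-a + ·) h.symm).trans ?_
    refine (hadd _ _ _ _).symm.trans ?_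
    rw [neg_add_cancel, hzero]
  { AddGroup.ofLeftAxioms hassoc hz hneg with
    add_comm := hcomm }

/-- Evaluation of generalized elements at an element, as a homomorphism. -/
def evalHom {T : 𝒟} {x : T ⟶ X} (τ : F.obj T) (h : θ (F.map x τ) = s) :
    letI := A.addCommGroupFibre hF θ (s := s)
    LiftsAlong A.proj x →+ A.Fibre F θ s :=
  let _ := A.addCommGroupFibre hF θ (s := s)
  AddMonoidHom.mk' (fun f => evalLift f τ h) fun f g => A.evalLift_add hF θ f g τ h

/-- Addition in the fibres is compatible with natural transformations. -/
lemma app_add (hG : PreservesFibrePowers G) (θ' : G.obj X ≃ Z) (ν : F ⟶ G) {s : Y} {s' : Z}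
    (hs : ∀ x, θ x = s → θ' (ν.app X x) = s') (a b : A.Fibre F θ s) :
    letI := A.addCommGroupFibre hF θ (s := s)
    letI := A.addCommGroupFibre hG θ' (s := s')
    ν.app _ (a + b).1 = ((⟨ν.app _ a.1, by
        rw [← hs _ a.2, ← NatTrans.naturality_apply]⟩ + ⟨ν.app _ b.1, by
        rw [← hs _ b.2, ← NatTrans.naturality_apply]⟩ : A.Fibre G θ' s')).1 := by
  let _ := A.addCommGroupFibre hF θ (s := s)
  let _ := A.addCommGroupFibre hG θ' (s := s')
  set t := A.tuple hF θ 2 ![a, b]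
  have h : θ' (G.map (FibrePowers.base A.proj 2) (ν.app _ t)) = s' := by
    rw [← hs _ (A.base_tuple hF θ 2 ![a, b]), ← NatTrans.naturality_apply]
  refine (NatTrans.naturality_apply ν (A.coord 2 0 + A.coord 2 1).1 t).trans
    ((congrArg Subtype.val (_root_.map_add (A.evalHom hG θ' (ν.app _ t) h) (A.coord 2 0)
      (A.coord 2 1))).trans (congrArg Subtype.val (congrArg₂ (· + ·) ?_ ?_)))
  · exact Subtype.ext ((NatTrans.naturality_apply ν _ _).symm.trans
      (congrArg _ (A.proj_tuple hF θ 2 ![a, b] 0)))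
  · exact Subtype.ext ((NatTrans.naturality_apply ν _ _).symm.trans
      (congrArg _ (A.proj_tuple hF θ 2 ![a, b] 1)))

end AbelianOver

end Evaluation

/-! ### Mapping spaces of multisimplicial categories -/

section MappingSpaces

open Simplicial

namespace MultiSimplicial

variable {O : Type u} (a b : O)

/-- The mapping spaces of the diagonal of a multisimplicial category. -/
def mapSpaceDiag (m : ℕ) : MultiSimplicial (CatO O) m ⥤ SSet.{u} := diag m ⋙ mapSpace a b

/-- The simplices of a given dimension of the mapping spaces of the diagonal. -/
def simplices (m : ℕ) (k : SimplexCategory) : MultiSimplicial (CatO O) m ⥤ Type u :=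
  mapSpaceDiag a b m ⋙ (evaluation SimplexCategoryᵒᵖ (Type u)).obj (op k)

lemma preservesFibrePowers_simplices (k : SimplexCategory) (m : ℕ) :
    PreservesFibrePowers (simplices a b m k) := by
  induction m with
  | zero =>
    exact ⟨fun _ _ x f h => ⟨⟨(x, f), h⟩, rfl, fun _ => rfl⟩,
      fun _ _ _ _ h h' => Subtype.ext (Prod.ext h (funext h'))⟩
  | succ m ih =>
    exact ⟨fun p => ih.exists_lift (p.app (op k)), fun p => ih.ext (p.app (op k))⟩

variable {a b} {m : ℕ} {X : MultiSimplicial (CatO O) m} {S : SSet.{u}}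

/-- The fibrewise abelian group given by the mapping spaces of the diagonal of an abelian group
object. -/
def fibrewiseGroup (A : AbelianOver X) (θ : (mapSpaceDiag a b m).obj X ≅ S) :
    FibrewiseGroup S where
  tot := (mapSpaceDiag a b m).obj A.obj
  p := (mapSpaceDiag a b m).map A.proj ≫ θ.hom
  grp {k} _ := A.addCommGroupFibre (preservesFibrePowers_simplices a b ⦋k⦌ m)
    (θ.app (op ⦋k⦌)).toEquiv
  map_add {k l} f _ x y := A.app_add (preservesFibrePowers_simplices a b ⦋k⦌ m)
    (θ.app (op ⦋k⦌)).toEquiv (preservesFibrePowers_simplices a b ⦋l⦌ m)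
    (θ.app (op ⦋l⦌)).toEquiv
    (Functor.whiskerLeft (mapSpaceDiag a b m) ((evaluation SimplexCategoryᵒᵖ (Type u)).map f.op))
    (fun x hx => (SSet.app_map θ.hom f x).trans (congrArg _ hx)) x y

section

variable (A : AbelianOver X) (θ : (mapSpaceDiag a b m).obj X ≅ S) {k l : ℕ}

/-- Evaluation of generalized elements of `A` at a simplex, as a homomorphism to a fibre of the
corresponding fibrewise group. -/
def evalHom {T : MultiSimplicial (CatO O) m} {x : T ⟶ X}
    (τ : ((mapSpaceDiag a b m).obj T) _⦋k⦌) {s : S _⦋k⦌}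
    (h : θ.hom.app _ (((mapSpaceDiag a b m).map x).app _ τ) = s) :
    LiftsAlong A.proj x →+ (fibrewiseGroup A θ).Fib s :=
  A.evalHom (preservesFibrePowers_simplices a b ⦋k⦌ m) (θ.app (op ⦋k⦌)).toEquiv τ h

/-- Two elements of a fibre are simultaneously values of generalized elements. -/
lemma exists_add {s : S _⦋k⦌} (x y : (fibrewiseGroup A θ).Fib s) :
    ∃ (t : ((mapSpaceDiag a b m).obj (FibrePowers.pow A.proj 2)) _⦋k⦌)
      (h : θ.hom.app _ (((mapSpaceDiag a b m).map (FibrePowers.base A.proj 2)).app _ t) = s),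
      x = evalHom A θ t h (A.coord 2 0) ∧ y = evalHom A θ t h (A.coord 2 1) ∧
        x + y = evalHom A θ t h (A.coord 2 0 + A.coord 2 1) := by
  have hF := preservesFibrePowers_simplices a b ⦋k⦌ m
  let θ' := (θ.app (op ⦋k⦌)).toEquiv
  exact ⟨A.tuple hF θ' 2 ![x, y], A.base_tuple hF θ' 2 ![x, y],
    (A.evalLift_coord hF θ' 2 ![x, y] 0).symm, (A.evalLift_coord hF θ' 2 ![x, y] 1).symm, rfl⟩

end

end MultiSimplicial

end MappingSpaces

/-! ### The mapping spaces of a delooping -/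

section Deloopings

open Simplicial SimplexCategory

namespace AbelianOver

variable {𝒟 : Type w} [Category.{v} 𝒟] [FibrePowers 𝒟] {X : 𝒟} (A : AbelianOver X)

lemma components_add {T : SimplicialObject 𝒟} {x : T ⟶ (SimplicialObject.const 𝒟).obj X}
    (f g : LiftsAlong A.deloop.proj x) (k : SimplexCategoryᵒᵖ) (i : Fin k.unop.len) :
    A.components x (f + g) k i = A.components x f k i + A.components x g k i := by
  have h : A.componentsEquiv x (f + g) = A.componentsEquiv x f + A.componentsEquiv x g :=
    Equiv.apply_symm_apply _ _
  exact congrFun (congrFun (congrArg Subtype.val h) k) i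

end AbelianOver

namespace MultiSimplicial

variable {O : Type u} {a b : O} {m : ℕ} {X : MultiSimplicial (CatO O) m} {S : SSet.{u}}
  (A : AbelianOver X) (θ : (mapSpaceDiag a b m).obj X ≅ S)
  (θ' : (mapSpaceDiag a b (m + 1)).obj ((SimplicialObject.const (MultiSimplicial (CatO O) m)).obj X)
    ≅ S)

/-- The fibrewise abelian group given by the delooping. -/
abbrev deloopGroup : FibrewiseGroup S := fibrewiseGroup (m := m + 1) A.deloop θ'

variable (hθ : ∀ (k : ℕ) (x : ((mapSpaceDiag a b m).obj X) _⦋k⦌), θ'.hom.app (op ⦋k⦌) x =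
  θ.hom.app (op ⦋k⦌) x) {k l : ℕ} {s : S _⦋k⦌}

include hθ in
lemma base_entry (x : (deloopGroup A θ').Fib s) :
    θ.hom.app (op ⦋k⦌) (((mapSpaceDiag a b m).map (FibrePowers.base A.proj k)).app (op ⦋k⦌) x.1) =
      s :=
  (hθ k _).symm.trans x.2

lemma entry_evalHom {T : MultiSimplicial (CatO O) (m + 1)}
    {x : T ⟶ (SimplicialObject.const (MultiSimplicial (CatO O) m)).obj X}
    (τ : ((mapSpaceDiag a b (m + 1)).obj T) _⦋k⦌)
    (h : θ'.hom.app _ (((mapSpaceDiag a b (m + 1)).map x).app _ τ) = s)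
    (f : LiftsAlong A.deloop.proj x) (i : Fin k)
    (h₁ : θ.hom.app (op ⦋k⦌) (((mapSpaceDiag a b m).map (FibrePowers.base A.proj k)).app (op ⦋k⦌)
      (evalHom (m := m + 1) A.deloop θ' τ h f).1) = s)
    (h₂ : θ.hom.app (op ⦋k⦌) (((mapSpaceDiag a b m).map (x.app (op ⦋k⦌))).app (op ⦋k⦌) τ) = s) :
    evalHom A θ (evalHom (m := m + 1) A.deloop θ' τ h f).1 h₁ (A.coord k i) =
      evalHom A θ (T := T.obj (op ⦋k⦌)) τ h₂ (A.components x f (op ⦋k⦌) i) :=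
  Subtype.ext (by
    have := Functor.map_comp_apply (simplices a b m ⦋k⦌) (f.1.app (op ⦋k⦌))
      (FibrePowers.proj A.proj k i) τ
    exact this.symm)

/-- The entries of an element of the delooping, which is a tuple of elements of `A`. -/
def entry (i : Fin k) : (deloopGroup A θ').Fib s →+ (fibrewiseGroup A θ).Fib s :=
  let G (x : (deloopGroup A θ').Fib s) : (fibrewiseGroup A θ).Fib s :=
    evalHom A θ (T := FibrePowers.pow A.proj k) x.1 (base_entry A θ θ' hθ x) (A.coord k i)
  AddMonoidHom.mk' G fun x y => by
    obtain ⟨t, h, hx, hy, hxy⟩ := exists_add (m := m + 1) A.deloop θ' x y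
    have h₂ := (hθ k _).symm.trans h
    refine (congrArg G hxy).trans ((entry_evalHom A θ θ' t h _ i _ h₂).trans
      ((congrArg _ (A.components_add _ _ _ _)).trans ((map_add (evalHom A θ t h₂) _ _).trans
        (congrArg₂ (· + ·) ?_ ?_))))
    · exact (entry_evalHom A θ θ' t h _ i _ h₂).symm.trans (congrArg G hx).symm
    · exact (entry_evalHom A θ θ' t h _ i _ h₂).symm.trans (congrArg G hy).symm

lemma entry_res (f : ⦋l⦌ ⟶ ⦋k⦌) {t : S _⦋l⦌} (h : S.map f.op s = t)
    (x : (deloopGroup A θ').Fib s) (j : Fin l) :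
    entry A θ θ' hθ j ((deloopGroup A θ').res f h x) =
      ∑ i ∈ AbelianOver.segment f j, (fibrewiseGroup A θ).res f h (entry A θ θ' hθ i x) := by
  rw [← map_sum]
  refine Subtype.ext ?_
  have h₁ : (∑ i ∈ AbelianOver.segment f j, entry A θ θ' hθ i x) =
      evalHom A θ (T := FibrePowers.pow A.proj k) (x := FibrePowers.base A.proj k) x.1
        (base_entry A θ θ' hθ x) (∑ i ∈ AbelianOver.segment f j, A.coord k i) :=
    (map_sum (evalHom A θ (T := FibrePowers.pow A.proj k) (x := FibrePowers.base A.proj k) x.1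
      (base_entry A θ θ' hθ x)) _ _).symm
  rw [h₁]
  -- both sides are the image of `x` under the morphism adding up the entries in the segment
  have h₂ : A.deloopObj.map f.op ≫ FibrePowers.proj A.proj l j =
      (∑ i ∈ AbelianOver.segment f j, A.coord k i).1 := FibrePowers.lift_proj _ _ _ _ _ _
  have h₃ := Functor.map_comp_apply (simplices a b m ⦋k⦌) (A.deloopObj.map f.op)
    (FibrePowers.proj A.proj l j) x.1
  rw [h₂] at h₃
  refine Eq.trans ?_ (congrArg (((mapSpaceDiag a b m).obj A.obj).map f.op) h₃).symm
  exact SSet.app_map ((mapSpaceDiag a b m).map (FibrePowers.proj A.proj l j)) f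
    ((simplices a b m ⦋k⦌).map (A.deloopObj.map f.op) x.1)

lemma entry_ext {x y : (deloopGroup A θ').Fib s}
    (h : ∀ i, entry A θ θ' hθ i x = entry A θ θ' hθ i y) : x = y := by
  refine Subtype.ext ((preservesFibrePowers_simplices a b ⦋k⦌ m).ext A.proj k ?_ fun i =>
    congrArg Subtype.val (h i))
  exact (θ.app (op ⦋k⦌)).toEquiv.injective
    ((base_entry A θ θ' hθ x).trans (base_entry A θ θ' hθ y).symm)

lemma exists_entry (f : Fin k → (fibrewiseGroup A θ).Fib s) :
    ∃ x : (deloopGroup A θ').Fib s, ∀ i, entry A θ θ' hθ i x = f i := by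
  obtain ⟨t, ht, ht'⟩ := A.exists_tuple (preservesFibrePowers_simplices a b ⦋k⦌ m)
    (θ.app (op ⦋k⦌)).toEquiv k f
  exact ⟨⟨t, (hθ k _).trans ht⟩, fun i => Subtype.ext (ht' i)⟩

end MultiSimplicial

end Deloopings

/-! ### The delooping as a bar construction -/

section PartialSums

open Simplicial SimplexCategory

/-- The sum of the first `i` entries of a tuple. -/
def Fin.partialSumTo {G : Type*} [AddCommGroup G] {k : ℕ} (g : Fin k → G) (i : Fin (k + 1)) : G :=
  ∑ q ∈ Finset.univ.filter (fun q => q.castSucc < i), g q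

section

variable {G : Type*} [AddCommGroup G] {k l : ℕ}

lemma Fin.partialSumTo_zero (g : Fin k → G) : Fin.partialSumTo g 0 = 0 := by
  simp [Fin.partialSumTo]

lemma Fin.partialSumTo_succ (g : Fin k → G) (i : Fin k) :
    Fin.partialSumTo g i.succ = Fin.partialSumTo g i.castSucc + g i := by
  have : Finset.univ.filter (fun q : Fin k => q.castSucc < i.succ) =
      insert i (Finset.univ.filter fun q => q.castSucc < i.castSucc) := by
    ext q
    simp only [Finset.mem_filter, Finset.mem_univ, true_and, Finset.mem_insert,
      Fin.castSucc_lt_succ_iff, Fin.castSucc_lt_castSucc_iff]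
    exact le_iff_eq_or_lt
  rw [Fin.partialSumTo, this, Finset.sum_insert (by simp), add_comm]
  rfl

lemma Fin.partialSumTo_sub (P : Fin (k + 1) → G) (i : Fin (k + 1)) :
    Fin.partialSumTo (fun q => P q.succ - P q.castSucc) i = P i - P 0 := by
  induction i using Fin.induction with
  | zero => rw [Fin.partialSumTo_zero, sub_self]
  | succ i ih => rw [Fin.partialSumTo_succ, ih]; abel

lemma AbelianOver.sum_segment (f : ⦋l⦌ ⟶ ⦋k⦌) (g : Fin k → G) (j : Fin l) :
    ∑ i ∈ AbelianOver.segment f j, g i = Fin.partialSumTo g (f.toOrderHom j.succ) -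
      Fin.partialSumTo g (f.toOrderHom j.castSucc) := by
  have hle : f.toOrderHom j.castSucc ≤ f.toOrderHom j.succ :=
    f.toOrderHom.monotone (Fin.castSucc_lt_succ).le
  have hsub : Finset.univ.filter (fun q : Fin k => q.castSucc < f.toOrderHom j.castSucc) ⊆
      Finset.univ.filter (fun q : Fin k => q.castSucc < f.toOrderHom j.succ) := fun q hq => by
    simp only [Finset.mem_filter, Finset.mem_univ, true_and] at hq ⊢
    exact hq.trans_le hle
  unfold Fin.partialSumTo
  rw [← Finset.sum_sdiff_eq_sub hsub]
  congr 1
  ext q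
  simp only [AbelianOver.segment, Finset.mem_filter, Finset.mem_univ, true_and, Finset.mem_sdiff,
    not_lt]
  exact and_comm

end

end PartialSums

section DeloopingBar

open Simplicial SimplexCategory

namespace MultiSimplicial

variable {O : Type u} {a b : O} {m : ℕ} {X : MultiSimplicial (CatO O) m} {S : SSet.{u}}
  (A : AbelianOver X) (θ : (mapSpaceDiag a b m).obj X ≅ S)
  (θ' : (mapSpaceDiag a b (m + 1)).obj ((SimplicialObject.const (MultiSimplicial (CatO O) m)).obj X)
    ≅ S)
  (hθ : ∀ (k : ℕ) (x : ((mapSpaceDiag a b m).obj X) _⦋k⦌), θ'.hom.app (op ⦋k⦌) x =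
    θ.hom.app (op ⦋k⦌) x)

/-- The mapping spaces of the delooping are the diagonal of the bar construction. -/
def deloopBarStructure :
    FibrewiseGroup.BarStructure (fibrewiseGroup A θ) (deloopGroup A θ') where
  S i := AddMonoidHom.mk' (fun x => Fin.partialSumTo (fun q => entry A θ θ' hθ q x) i)
    fun x y => by simp only [Fin.partialSumTo, map_add, Finset.sum_add_distrib]
  S_zero _ := Fin.partialSumTo_zero _
  S_res {k l} f s t h i x := by
    have h₁ (j : Fin l) : entry A θ θ' hθ j ((deloopGroup A θ').res f h x) =
        (fibrewiseGroup A θ).res f h (Fin.partialSumTo _ _ - Fin.partialSumTo _ _) :=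
      (entry_res A θ θ' hθ f h x j).trans ((map_sum _ _ _).symm.trans
        (congrArg _ (AbelianOver.sum_segment f (fun q => entry A θ θ' hθ q x) j)))
    have h₂ := Fin.partialSumTo_sub (fun i => (fibrewiseGroup A θ).res f h
      (Fin.partialSumTo (fun q => entry A θ θ' hθ q x) (f.toOrderHom i))) i
    simp only [← map_sub] at h₂
    exact (congrArg (Fin.partialSumTo · i) (funext h₁)).trans h₂
  ext {k s x y} h := entry_ext A θ θ' hθ fun i => by
    have h₀ := h i.castSucc
    have h₁ := h i.succ
    change Fin.partialSumTo _ _ = Fin.partialSumTo _ _ at h₀ h₁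
    rw [Fin.partialSumTo_succ, Fin.partialSumTo_succ, h₀] at h₁
    exact add_left_cancel h₁
  exists_S {k s} P := by
    obtain ⟨x, hx⟩ := exists_entry A θ θ' hθ fun q => P q.succ - P q.castSucc
    refine ⟨x, fun i => ?_⟩
    change Fin.partialSumTo _ i = _
    rw [show (fun q => entry A θ θ' hθ q x) = fun q => P q.succ - P q.castSucc from funext hx,
      Fin.partialSumTo_sub]

lemma deloopBarStructure_S_one {k : ℕ} {s : S _⦋k + 1⦌} (x : (deloopGroup A θ').Fib s) :
    (deloopBarStructure A θ θ' hθ).S 1 x = entry A θ θ' hθ 0 x := by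
  change Fin.partialSumTo _ (Fin.succ 0) = _
  rw [Fin.partialSumTo_succ, Fin.castSucc_zero, Fin.partialSumTo_zero, zero_add]

end MultiSimplicial

end DeloopingBar

/-! ### Functors preserving multiple groupoids -/

section PreservationOfGroupoids

namespace CatO

variable {O : Type u}

lemma preservesLimit_cospan_homFunctor (a b : O) {A B X : CatO O} (F : A ⟶ X) (G : B ⟶ X) :
    PreservesLimit (cospan F G) (homFunctor a b) :=
  preservesLimit_of_preserves_limit_cone (isPullback_fibreProduct F G).isLimit
    ((isLimitMapConePullbackConeEquiv _ (isPullback_fibreProduct F G).w).symm (by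
      refine IsPullback.isLimit ?_
      refine (Types.isPullback_iff _ _ _ _).2 ⟨?_, ?_, ?_⟩
      · ext p
        exact p.2
      · exact fun p q h => Subtype.ext (Prod.ext h.1 h.2)
      · exact fun x y h => ⟨⟨(x, y), h⟩, rfl, rfl⟩))

instance (a b : O) : PreservesLimitsOfShape WalkingCospan (homFunctor a b) where
  preservesLimit {K} :=
    have := preservesLimit_cospan_homFunctor a b (K.map WalkingCospan.Hom.inl)
      (K.map WalkingCospan.Hom.inr)
    preservesLimit_of_iso_diagram _ (diagramIsoCospan K).symm

end CatO

lemma IsInternalGroupoid.map {𝒟 : Type*} [Category* 𝒟] {ℰ : Type*} [Category* ℰ]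
    {X : SimplicialObject 𝒟} (hX : IsInternalGroupoid X) (F : 𝒟 ⥤ ℰ)
    [PreservesLimitsOfShape WalkingCospan F] :
    IsInternalGroupoid (((SimplicialObject.whiskering 𝒟 ℰ).obj F).obj X) :=
  ⟨fun k => (hX.1 k).map F, hX.2.map F⟩

namespace MultiSimplicial

variable {𝒞 : Type (u + 1)} [Category.{u} 𝒞] {𝒞' : Type (u + 1)} [Category.{u} 𝒞']

lemma preservesLimitsOfShape_map [HasPullbacks 𝒞] (F : 𝒞 ⥤ 𝒞')
    [PreservesLimitsOfShape WalkingCospan F] (m : ℕ) :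
    PreservesLimitsOfShape WalkingCospan (map F m) := by
  induction m with
  | zero => exact inferInstanceAs (PreservesLimitsOfShape WalkingCospan
      ((Functor.whiskeringRight SimplexCategoryᵒᵖ 𝒞 𝒞').obj F))
  | succ m ih =>
    exact inferInstanceAs (PreservesLimitsOfShape WalkingCospan
      ((Functor.whiskeringRight SimplexCategoryᵒᵖ (MultiSimplicial 𝒞 m)
        (MultiSimplicial 𝒞' m)).obj (map F m)))

end MultiSimplicial

lemma IsMultiGroupoid.map {𝒞 : Type (u + 1)} [Category.{u} 𝒞] [HasPullbacks 𝒞]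
    {𝒞' : Type (u + 1)} [Category.{u} 𝒞'] (F : 𝒞 ⥤ 𝒞')
    [PreservesLimitsOfShape WalkingCospan F] {m : ℕ} {X : MultiSimplicial 𝒞 m}
    (hX : IsMultiGroupoid m X) : IsMultiGroupoid m ((MultiSimplicial.map F m).obj X) := by
  induction m with
  | zero => exact IsInternalGroupoid.map hX F
  | succ m ih =>
    have := MultiSimplicial.preservesLimitsOfShape_map F m
    exact ⟨fun k => ih (hX.1 k), IsInternalGroupoid.map hX.2 (MultiSimplicial.map F m)⟩

end PreservationOfGroupoids

/-! ### The Eilenberg–Mac Lane objects -/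

section EilenbergMacLaneObjects

open Simplicial SimplexCategory MultiSimplicial

variable {O : Type u} {Q : SimplicialObject (CatO O)} (M : GroupoidModule Q) (a b : O)

/-- The mapping spaces of the diagonal of the discrete multiple groupoid on `Q` are those of `Q`. -/
def mapSpaceDiagDisc (Q : SimplicialObject (CatO O)) (a b : O) (m : ℕ) :
    (mapSpaceDiag a b m).obj (disc Q m) ≅ (mapSpace a b).obj Q :=
  (mapSpace a b).mapIso (diagDisc Q m)

namespace GroupoidModule

/-- The fibrewise abelian group over a mapping space of `Q` given by the mapping spaces of
the diagonal of `eilenbergMacLane M m`. -/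
abbrev fibrewiseGroup (m : ℕ) : FibrewiseGroup ((mapSpace a b).obj Q) :=
  MultiSimplicial.fibrewiseGroup (eilenbergMacLane M m) (mapSpaceDiagDisc Q a b m)

lemma isGroupoidModule (hQ : IsInternalGroupoid Q) :
    (M.fibrewiseGroup a b 0).IsGroupoidModule where
  base := hQ.map (CatO.homFunctor a b)
  tot := M.isInternalGroupoid.map (CatO.homFunctor a b)
  subsingleton s := ⟨fun x y => Subtype.ext (by
    have := M.isIso_objects
    let f := M.toOver.hom.app (op ⦋0⦌)
    have h (z : (M.toOver.left _⦋0⦌).Hom a b) : CatO.mapHom (inv f) (CatO.mapHom f z) = z := by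
      rw [← CatO.mapHom_comp, IsIso.hom_inv_id, CatO.mapHom_id]
    have hxy : CatO.mapHom f x.1 = CatO.mapHom f y.1 := x.2.trans y.2.symm
    exact (h x.1).symm.trans ((congrArg (CatO.mapHom (inv f)) hxy).trans (h y.1)))⟩

/-- The mapping spaces of `eilenbergMacLane M m` are obtained by iterating the bar construction. -/
def emStructure (hQ : IsInternalGroupoid Q) (m : ℕ) :
    FibrewiseGroup.EMStructure (M.fibrewiseGroup a b 0) (M.fibrewiseGroup a b m) m :=
  match m with
  | 0 => (M.isGroupoidModule a b hQ).emStructure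
  | m + 1 => (deloopBarStructure (eilenbergMacLane M m) (mapSpaceDiagDisc Q a b m)
      (mapSpaceDiagDisc Q a b (m + 1)) fun _ _ => rfl).emStructure (M.isGroupoidModule a b hQ)
        (emStructure hQ m)

/-- The operation `ev` of the Eilenberg–Mac Lane structures, for all pairs of objects at once, as
a functor: it takes the first entry and then its face `δ 0` until `M` is reached. -/
def evFunctor (m : ℕ) :
    ((MultiSimplicial.diag m).obj (eilenbergMacLane M m).obj).obj (op ⦋m + 1⦌) ⟶
      M.toOver.left.obj (op ⦋1⦌) :=
  match m with
  | 0 => M.toOver.left.map (lastArrow 0).op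
  | m + 1 => ((MultiSimplicial.diag m).map
      (FibrePowers.proj (eilenbergMacLane M m).proj (m + 2) 0)).app (op ⦋m + 2⦌) ≫
      ((MultiSimplicial.diag m).obj (eilenbergMacLane M m).obj).map (δ 0).op ≫ evFunctor m

lemma emStructure_ev (hQ : IsInternalGroupoid Q) (m : ℕ) {s : ((mapSpace a b).obj Q) _⦋m + 1⦌}
    {t : ((mapSpace a b).obj Q) _⦋1⦌} (h : ((mapSpace a b).obj Q).map (lastArrow m).op s = t)
    (x : (M.fibrewiseGroup a b m).Fib s) :
    ((M.emStructure a b hQ m).ev h x).1 = CatO.mapHom (M.evFunctor m) x.1 := by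
  induction m with
  | zero => rfl
  | succ m ih =>
    let B := deloopBarStructure (eilenbergMacLane M m) (mapSpaceDiagDisc Q a b m)
      (mapSpaceDiagDisc Q a b (m + 1)) fun _ _ => rfl
    refine (ih _ ((M.fibrewiseGroup a b m).res (δ 0) rfl (B.S 1 x))).trans ?_
    exact congrArg (fun y => CatO.mapHom (M.evFunctor m)
      ((M.fibrewiseGroup a b m).res (δ 0) rfl y).1) (deloopBarStructure_S_one
        (eilenbergMacLane M m) (mapSpaceDiagDisc Q a b m) (mapSpaceDiagDisc Q a b (m + 1))
        (fun _ _ => rfl) x)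

end GroupoidModule

end EilenbergMacLaneObjects

/-! ### The homotopy module of an Eilenberg–Mac Lane object -/

section HomotopyModules

open Simplicial SimplexCategory MultiSimplicial

variable {O : Type u} {Q : SimplicialObject (CatO O)} (M : GroupoidModule Q) (a b : O)

lemma AbelianOver.unit_proj {𝒟 : Type w} [Category.{v} 𝒟] {X : 𝒟} (A : AbelianOver X) :
    A.unit ≫ A.proj = 𝟙 X :=
  (0 : LiftsAlong A.proj (𝟙 X)).2

lemma constSimplex_one {S : SSet.{u}} (x : S _⦋0⦌) :
    SSet.constSimplex 1 x = S.map (σ (0 : Fin 1)).op x :=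
  SSet.map_congr (by decide) x

namespace GroupoidModule

/-- The zero section of `M`, in terms of the unit of the group object `M`. -/
lemma zero_app {k : ℕ} (s : (Q _⦋k⦌).Hom a b) :
    (M.fibrewiseGroup a b 0).zero.app (op ⦋k⦌) s =
      CatO.mapHom ((η[M.toOver]).left.app (op ⦋k⦌)) s := by
  have h : (AbelianOver.ofOver (𝒟 := SimplicialObject (CatO O)) (X := Q) M.toOver).unit =
      (η[M.toOver]).left := by
    have h₁ : (1 : 𝟙_ (Over Q) ⟶ M.toOver) = η[M.toOver] := by
      rw [Hom.one_def, toUnit_unit, Category.id_comp]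
    exact congrArg CommaMorphism.left h₁
  exact congrArg (fun f : Q ⟶ M.toOver.left => CatO.mapHom (f.app (op ⦋k⦌)) s) h

/-- Addition in the fibres of `M`, in terms of the multiplication of the group object `M`. -/
lemma addRel {s : ((mapSpace a b).obj Q) _⦋1⦌} (x y : (M.fibrewiseGroup a b 0).Fib s) :
    AddRel M x.1 y.1 (x + y).1 := by
  obtain ⟨t, h, hx, hy, hxy⟩ := exists_add (m := 0) (eilenbergMacLane M 0)
    (mapSpaceDiagDisc Q a b 0) x y
  let A := AbelianOver.ofOver (𝒟 := SimplicialObject (CatO O)) (X := Q) M.toOver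
  let c (i : Fin 2) : Over.mk (FibrePowers.base A.proj 2) ⟶ M.toOver :=
    Over.homMk (A.coord 2 i).1 (A.coord 2 i).2
  refine ⟨CatO.mapHom ((lift (c 0) (c 1)).left.app (op ⦋1⦌)) t, ?_, ?_, ?_⟩
  · refine Eq.trans ?_ (congrArg Subtype.val hx).symm
    exact congrArg (fun f : Over.mk (FibrePowers.base A.proj 2) ⟶ M.toOver =>
      CatO.mapHom (f.left.app (op ⦋1⦌)) t) (lift_fst (c 0) (c 1))
  · refine Eq.trans ?_ (congrArg Subtype.val hy).symm
    exact congrArg (fun f : Over.mk (FibrePowers.base A.proj 2) ⟶ M.toOver =>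
      CatO.mapHom (f.left.app (op ⦋1⦌)) t) (lift_snd (c 0) (c 1))
  · exact (congrArg Subtype.val hxy).symm

/-- The isomorphism of `π_{m + 2}` of the Eilenberg–Mac Lane object with `M`. -/
def homotopyModuleIso (hQ : IsInternalGroupoid Q) (m : ℕ) :
    HomotopyModuleIso (m + 2) M
      ((MultiSimplicial.diag (m + 1)).obj (eilenbergMacLane M (m + 1)).obj)
      ((MultiSimplicial.diag (m + 1)).map (eilenbergMacLane M (m + 1)).proj ≫
        (diagDisc Q (m + 1)).hom) where
  toFun {a b x} α := ((M.emStructure a b hQ (m + 1)).evPt (M.isGroupoidModule a b hQ)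
    (Nat.succ_pos m) α).1
  over_id {a b x} α := ((M.emStructure a b hQ (m + 1)).evPt (M.isGroupoidModule a b hQ)
    (Nat.succ_pos m) α).2.trans (constSimplex_one _)
  eq_iff {a b x} α β := Subtype.ext_iff.symm.trans
    ((M.emStructure a b hQ (m + 1)).nonempty_homotopy_iff (M.isGroupoidModule a b hQ) _ α β)
  surjective {a b} x c hc := by
    obtain ⟨α, hα⟩ := (M.emStructure a b hQ (m + 1)).evPt_surjective (M.isGroupoidModule a b hQ)
      (Nat.succ_pos m) x ⟨c, hc.trans (constSimplex_one (S := (mapSpace a b).obj Q) _).symm⟩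
    exact ⟨α, congrArg Subtype.val hα⟩
  map_add {a b x} α β ω i h := by
    obtain ⟨h⟩ := h
    rw [(M.emStructure a b hQ (m + 1)).evPt_add (M.isGroupoidModule a b hQ) (Nat.succ_pos m)
      α β ω i h]
    exact M.addRel a b _ _
  map_transport {a b} e x y α β hx hy h := by
    obtain ⟨H, h₀, h₁, hH⟩ := h
    obtain ⟨h, ⟨z, hz₂, hz₀, hz₁⟩, z', hz₂', hz₀', hz₁'⟩ :=
      (M.emStructure a b hQ (m + 1)).evPt_transport (M.isGroupoidModule a b hQ) (Nat.succ_pos m)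
        e hx hy α β H h₀ h₁ hH
    exact ⟨h, ⟨z, hz₂, hz₀.trans (M.zero_app a b _), hz₁⟩, z', hz₂'.trans (M.zero_app a b _),
      hz₀', hz₁'⟩
  map_comp {a b c x y} α β ω h := by
    -- the values in `M` are given by a morphism of `CatO O`, which preserves composition
    have key {a b : O} {x} (α : PointedSimplex
        ((MultiSimplicial.diag (m + 1)).obj (eilenbergMacLane M (m + 1)).obj) (m + 2) (a := a)
          (b := b) x) :
        ((M.emStructure a b hQ (m + 1)).evPt (M.isGroupoidModule a b hQ) (Nat.succ_pos m) α).1 =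
          CatO.mapHom (M.evFunctor (m + 1)) α.simplex := M.emStructure_ev a b hQ (m + 1) _ _
    rw [key, key, key, h]
    exact CatO.Functor.map_comp (M.evFunctor (m + 1)) _ _

/-- The diagonal of the Eilenberg–Mac Lane object is an Eilenberg–Mac Lane simplicial category. -/
lemma isEilenbergMacLane (hQ : IsInternalGroupoid Q) (m : ℕ) :
    IsEilenbergMacLane (m + 2) M
      ((MultiSimplicial.diag (m + 1)).obj (eilenbergMacLane M (m + 1)).obj)
      ((MultiSimplicial.diag (m + 1)).map (eilenbergMacLane M (m + 1)).proj ≫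
        (diagDisc Q (m + 1)).hom) where
  kanComplex a b := FibrewiseGroup.HasFillers.kanComplex (A := M.fibrewiseGroup a b (m + 1))
    (M.emStructure a b hQ (m + 1)).hasFillers (M.isGroupoidModule a b hQ).base
  exists_section := ⟨(diagDisc Q (m + 1)).inv ≫
    (MultiSimplicial.diag (m + 1)).map (eilenbergMacLane M (m + 1)).unit, by
      rw [Category.assoc, ← Functor.map_comp_assoc, AbelianOver.unit_proj,
        CategoryTheory.Functor.map_id, Category.id_comp, Iso.inv_hom_id]⟩
  fundamentalGroupoid a b := (M.emStructure a b hQ (m + 1)).isIso_hoFunctor_map (Nat.succ_pos m)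
  homotopyGroup_trivial i hi hin {a b} x α β :=
    (M.emStructure a b hQ (m + 1)).nonempty_homotopy (M.isGroupoidModule a b hQ) hi hin α β
  homotopyModule := ⟨M.homotopyModuleIso hQ m⟩

end GroupoidModule

end HomotopyModules

/-! ### The iterated deloopings are multiple groupoids -/

section MultipleGroupoids

open Simplicial

variable {𝒟 : Type w} [Category.{v} 𝒟]

lemma isInternalGroupoid_const (X : 𝒟) :
    IsInternalGroupoid ((SimplicialObject.const 𝒟).obj X) :=
  ⟨fun _ => IsPullback.of_horiz_isIso (fst := 𝟙 X) (snd := 𝟙 X) (f := 𝟙 X) (g := 𝟙 X) ⟨rfl⟩,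
    IsPullback.of_horiz_isIso (fst := 𝟙 X) (snd := 𝟙 X) (f := 𝟙 X) (g := 𝟙 X) ⟨rfl⟩⟩

lemma isPullback_of_exists {P Y Z W : 𝒟} {fst : P ⟶ Y} {snd : P ⟶ Z} {f : Y ⟶ W} {g : Z ⟶ W}
    (w : fst ≫ f = snd ≫ g)
    (h : ∀ {T : 𝒟} (s : T ⟶ Y) (t : T ⟶ Z), s ≫ f = t ≫ g → ∃ l, l ≫ fst = s ∧ l ≫ snd = t)
    (h' : ∀ {T : 𝒟} (s t : T ⟶ P), s ≫ fst = t ≫ fst → s ≫ snd = t ≫ snd → s = t) :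
    IsPullback fst snd f g := by
  choose l hl hl' using @h
  exact ⟨⟨w⟩, ⟨PullbackCone.IsLimit.mk _ (fun s => l s.fst s.snd s.condition)
    (fun s => hl _ _ s.condition) (fun s => hl' _ _ s.condition)
    (fun s t h₁ h₂ => h' _ _ (h₁.trans (hl _ _ s.condition).symm)
      (h₂.trans (hl' _ _ s.condition).symm))⟩⟩

/-- The last vertex of the last face is the source of the last edge. -/
lemma δ_last_op_comp_const_op (k : ℕ) :
    (SimplexCategory.δ (Fin.last (k + 1))).op ≫
      (SimplexCategory.const ⦋0⦌ ⦋k⦌ (Fin.last k)).op =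
    (SimplexCategory.mkOfSucc (Fin.last k)).op ≫ (SimplexCategory.δ (n := 0) 1).op := by
  rw [← op_comp, ← op_comp]
  congr 1
  ext i
  fin_cases i
  simp [SimplexCategory.δ, SimplexCategory.mkOfSucc]

section FibrePowers

variable [FibrePowers 𝒟]

/-- Fibre powers of simplicial objects preserve pullback squares formed by simplicial operators. -/
lemma FibrePowers.isPullback_map {A X : SimplicialObject 𝒟} (p : A ⟶ X) (k : ℕ)
    {i₀ i₁ i₂ i₃ : SimplexCategoryᵒᵖ} {f : i₀ ⟶ i₁} {g : i₀ ⟶ i₂} {h : i₁ ⟶ i₃} {i : i₂ ⟶ i₃}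
    (hA : IsPullback (A.map f) (A.map g) (A.map h) (A.map i))
    (hX : IsPullback (X.map f) (X.map g) (X.map h) (X.map i)) (w : f ≫ h = g ≫ i) :
    IsPullback ((FibrePowers.pow p k).map f) ((FibrePowers.pow p k).map g)
      ((FibrePowers.pow p k).map h) ((FibrePowers.pow p k).map i) := by
  have base_nat {j j' : SimplexCategoryᵒᵖ} (φ : j ⟶ j') :
      (pow p k).map φ ≫ base (p.app j') k = base (p.app j) k ≫ X.map φ := lift_base _ _ _ _ _
  have proj_nat {j j' : SimplexCategoryᵒᵖ} (φ : j ⟶ j') (q : Fin k) :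
      (pow p k).map φ ≫ proj (p.app j') k q = proj (p.app j) k q ≫ A.map φ :=
    lift_proj _ _ _ _ _ _
  have base_cond {T : 𝒟} {s : T ⟶ (pow p k).obj i₁} {t : T ⟶ (pow p k).obj i₂}
      (e : s ≫ (pow p k).map h = t ≫ (pow p k).map i) :
      (s ≫ base (p.app i₁) k) ≫ X.map h = (t ≫ base (p.app i₂) k) ≫ X.map i := by
    rw [Category.assoc, Category.assoc, ← base_nat, ← base_nat, reassoc_of% e]
  have proj_cond {T : 𝒟} {s : T ⟶ (pow p k).obj i₁} {t : T ⟶ (pow p k).obj i₂}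
      (e : s ≫ (pow p k).map h = t ≫ (pow p k).map i) (q : Fin k) :
      (s ≫ proj (p.app i₁) k q) ≫ A.map h = (t ≫ proj (p.app i₂) k q) ≫ A.map i := by
    rw [Category.assoc, Category.assoc, ← proj_nat, ← proj_nat, reassoc_of% e]
  refine ⟨⟨by rw [← Functor.map_comp, w, Functor.map_comp]⟩, ⟨PullbackCone.IsLimit.mk _
    (fun s => lift (p.app i₀) k (hX.lift _ _ (base_cond s.condition))
      (fun q => hA.lift _ _ (proj_cond s.condition q)) (fun q => ?_)) ?_ ?_ ?_⟩⟩
  · apply hX.hom_ext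
    · rw [hX.lift_fst, Category.assoc, ← p.naturality, hA.lift_fst_assoc, Category.assoc,
        proj_comp]
    · rw [hX.lift_snd, Category.assoc, ← p.naturality, hA.lift_snd_assoc, Category.assoc,
        proj_comp]
  · intro s
    apply hom_ext (p.app i₁) k
    · rw [Category.assoc, base_nat, lift_base_assoc, hX.lift_fst]
    · intro q
      rw [Category.assoc, proj_nat, lift_proj_assoc, hA.lift_fst]
  · intro s
    apply hom_ext (p.app i₂) k
    · rw [Category.assoc, base_nat, lift_base_assoc, hX.lift_snd]
    · intro q
      rw [Category.assoc, proj_nat, lift_proj_assoc, hA.lift_snd]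
  · intro s t h₁ h₂
    apply hom_ext (p.app i₀) k
    · rw [lift_base]
      apply hX.hom_ext
      · rw [hX.lift_fst, Category.assoc, ← base_nat, ← h₁, Category.assoc]
      · rw [hX.lift_snd, Category.assoc, ← base_nat, ← h₂, Category.assoc]
    · intro q
      rw [lift_proj]
      apply hA.hom_ext
      · rw [hA.lift_fst, Category.assoc, ← proj_nat, ← h₁, Category.assoc]
      · rw [hA.lift_snd, Category.assoc, ← proj_nat, ← h₂, Category.assoc]

lemma IsInternalGroupoid.pow {A X : SimplicialObject 𝒟} (hA : IsInternalGroupoid A)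
    (hX : IsInternalGroupoid X) (p : A ⟶ X) (k : ℕ) :
    IsInternalGroupoid (FibrePowers.pow p k) := by
  exact ⟨fun n => FibrePowers.isPullback_map p k (hA.1 n) (hX.1 n) (δ_last_op_comp_const_op n),
    FibrePowers.isPullback_map p k hA.2 hX.2 (by decide)⟩

lemma IsMultiGroupoid.pow {𝒞 : Type (u + 1)} [Category.{u} 𝒞] [FibrePowers 𝒞] {m : ℕ}
    {A X : MultiSimplicial 𝒞 m} (hA : IsMultiGroupoid m A) (hX : IsMultiGroupoid m X)
    (p : A ⟶ X) (k : ℕ) : IsMultiGroupoid m (FibrePowers.pow p k) := by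
  induction m with
  | zero => exact IsInternalGroupoid.pow hA hX p k
  | succ m ih =>
    exact ⟨fun j => ih (hA.1 j) (hX.1 j) (NatTrans.app p j),
      IsInternalGroupoid.pow (𝒟 := MultiSimplicial 𝒞 m) hA.2 hX.2 p k⟩

lemma isMultiGroupoid_disc {𝒞 : Type (u + 1)} [Category.{u} 𝒞] {Q : SimplicialObject 𝒞}
    (hQ : IsInternalGroupoid Q) (m : ℕ) : IsMultiGroupoid m (MultiSimplicial.disc Q m) := by
  induction m with
  | zero => exact hQ
  | succ m ih => exact ⟨fun _ => ih, isInternalGroupoid_const _⟩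

namespace AbelianOver

variable {X : 𝒟} (A : AbelianOver X)

/-- The generalized element of the delooping in degree `k` with given components. -/
def tupleLift {k : ℕ} {T : 𝒟} {x : T ⟶ X} (f : Fin k → LiftsAlong A.proj x) :
    T ⟶ A.deloopObj.obj (op (SimplexCategory.mk k)) :=
  FibrePowers.lift A.proj k x (fun i => (f i).1) (fun i => (f i).2)

lemma exists_eq_tupleLift {k : ℕ} {T : 𝒟} (t : T ⟶ A.deloopObj.obj (op (SimplexCategory.mk k))) :
    ∃ (x : T ⟶ X) (f : Fin k → LiftsAlong A.proj x), t = A.tupleLift f := by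
  refine ⟨t ≫ FibrePowers.base A.proj k, fun i => A.precompHom t rfl (A.coord k i), ?_⟩
  exact FibrePowers.hom_ext A.proj k (FibrePowers.lift_base _ _ _ _ _).symm
    fun i => (FibrePowers.lift_proj A.proj k _ (fun i => t ≫ FibrePowers.proj A.proj k i) _ i).symm

lemma tupleLift_base {k : ℕ} {T : 𝒟} {x : T ⟶ X} (f : Fin k → LiftsAlong A.proj x) :
    A.tupleLift f ≫ FibrePowers.base A.proj k = x := FibrePowers.lift_base _ _ _ _ _

lemma eq_of_tupleLift_eq {k : ℕ} {T : 𝒟} {x y : T ⟶ X} {f : Fin k → LiftsAlong A.proj x}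
    {g : Fin k → LiftsAlong A.proj y} (h : A.tupleLift f = A.tupleLift g) : x = y := by
  rw [← A.tupleLift_base f, h, A.tupleLift_base]

lemma tupleLift_injective {k : ℕ} {T : 𝒟} {x : T ⟶ X} {f g : Fin k → LiftsAlong A.proj x}
    (h : A.tupleLift f = A.tupleLift g) : f = g := by
  funext i
  refine Subtype.ext ?_
  refine (FibrePowers.lift_proj A.proj k x (fun i => (f i).1) (fun i => (f i).2) i).symm.trans
    (Eq.trans ?_ (FibrePowers.lift_proj A.proj k x (fun i => (g i).1) (fun i => (g i).2) i))
  exact congrArg (· ≫ FibrePowers.proj A.proj k i) h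

/-- The simplicial operators of the delooping in terms of components. -/
lemma tupleLift_map {k l : ℕ} (α : SimplexCategory.mk l ⟶ SimplexCategory.mk k) {T : 𝒟}
    {x : T ⟶ X} (f : Fin k → LiftsAlong A.proj x) :
    A.tupleLift f ≫ A.deloopObj.map α.op =
      A.tupleLift (k := l) fun j => ∑ i ∈ segment α j, f i := by
  refine FibrePowers.hom_ext A.proj l ?_ fun j => ?_
  · exact (Category.assoc _ _ _).trans <|
      (congrArg (A.tupleLift f ≫ ·) (FibrePowers.lift_base A.proj l _ _ _)).trans
      ((A.tupleLift_base f).trans (A.tupleLift_base _).symm)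
  · refine (Category.assoc _ _ _).trans <|
      (congrArg (A.tupleLift f ≫ ·) (FibrePowers.lift_proj A.proj l _ _ _ j)).trans
      (Eq.trans ?_ (FibrePowers.lift_proj A.proj l _ _ _ j).symm)
    refine (A.comp_sum _ (A.tupleLift_base f) _ _).trans ?_
    congr 1
    refine Finset.sum_congr rfl fun i _ => Subtype.ext ?_
    exact FibrePowers.lift_proj A.proj k x (fun i => (f i).1) (fun i => (f i).2) i

lemma tupleLift_δ {k : ℕ} (i : Fin (k + 2)) {T : 𝒟} {x : T ⟶ X}
    (f : Fin (k + 1) → LiftsAlong A.proj x) :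
    A.tupleLift f ≫ A.deloopObj.δ i =
      A.tupleLift (k := k) fun j => ∑ i ∈ segment (SimplexCategory.δ i) j, f i :=
  A.tupleLift_map _ f

lemma segment_δ_last {k : ℕ} (j : Fin k) :
    segment (SimplexCategory.δ (Fin.last (k + 1))) j = {j.castSucc} := by
  ext i
  simp only [segment, Finset.mem_filter, Finset.mem_univ, true_and, Finset.mem_singleton]
  change (Fin.last (k + 1)).succAbove j.castSucc ≤ i.castSucc ∧
    i.castSucc < (Fin.last (k + 1)).succAbove j.succ ↔ _
  simp only [Fin.succAbove_last, Fin.le_def, Fin.lt_def, Fin.ext_iff, Fin.val_castSucc,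
    Fin.val_succ]
  omega

lemma segment_mkOfSucc_last {k : ℕ} (j : Fin 1) :
    segment (SimplexCategory.mkOfSucc (Fin.last k)) j = {Fin.last k} := by
  obtain rfl := Subsingleton.elim j 0
  ext i
  simp only [segment, Finset.mem_filter, Finset.mem_univ, true_and, Finset.mem_singleton]
  change (Fin.last k).castSucc ≤ i.castSucc ∧ i.castSucc < (Fin.last k).succ ↔ _
  simp only [Fin.le_def, Fin.lt_def, Fin.ext_iff, Fin.val_castSucc, Fin.val_succ]
  omega

lemma sum_segment_δ_two {G : Type*} [AddCommMonoid G] (f : Fin 2 → G) :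
    ∑ i ∈ segment (SimplexCategory.δ (2 : Fin 3)) 0, f i = f 0 :=
  (congrArg (Finset.sum · f) (by decide : _ = ({0} : Finset (Fin 2)))).trans
    (Finset.sum_singleton _ _)

lemma sum_segment_δ_one {G : Type*} [AddCommMonoid G] (f : Fin 2 → G) :
    ∑ i ∈ segment (SimplexCategory.δ (1 : Fin 3)) 0, f i = f 0 + f 1 :=
  (congrArg (Finset.sum · f) (by decide : _ = Finset.univ)).trans (Fin.sum_univ_two _)

/-- The nerve of the delooping is an internal groupoid: the Segal condition is the universal
property of fibre powers, and pairs `(f, f + g)` are arbitrary pairs of arrows over the same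
object. -/
lemma isInternalGroupoid_deloopObj : IsInternalGroupoid A.deloopObj := by
  refine ⟨fun k => isPullback_of_exists ?_ (fun s t hst => ?_) (fun s t h₁ h₂ => ?_),
    isPullback_of_exists ?_ (fun s t hst => ?_) (fun s t h₁ h₂ => ?_)⟩
  · exact (A.deloopObj.map_comp _ _).symm.trans
      ((congrArg A.deloopObj.map (δ_last_op_comp_const_op k)).trans (A.deloopObj.map_comp _ _))
  · obtain ⟨x, f, rfl⟩ := A.exists_eq_tupleLift s
    obtain ⟨y, g, rfl⟩ := A.exists_eq_tupleLift t
    obtain rfl : x = y := by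
      rw [A.tupleLift_map] at hst
      exact A.eq_of_tupleLift_eq (hst.trans (A.tupleLift_map _ g))
    refine ⟨A.tupleLift (Fin.snoc (α := fun _ => LiftsAlong A.proj x) f (g 0)),
      (A.tupleLift_map _ _).trans ?_, (A.tupleLift_map _ _).trans ?_⟩
    · congr 1
      funext j
      rw [segment_δ_last, Finset.sum_singleton, Fin.snoc_castSucc]
    · congr 1
      funext j
      rw [segment_mkOfSucc_last, Finset.sum_singleton, Fin.snoc_last, Subsingleton.elim j 0]
  · obtain ⟨x, f, rfl⟩ := A.exists_eq_tupleLift s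
    obtain ⟨y, g, rfl⟩ := A.exists_eq_tupleLift t
    replace h₁ := (A.tupleLift_map _ f).symm.trans (h₁.trans (A.tupleLift_map _ g))
    replace h₂ := (A.tupleLift_map _ f).symm.trans (h₂.trans (A.tupleLift_map _ g))
    obtain rfl := A.eq_of_tupleLift_eq h₁
    congr 1
    funext j
    induction j using Fin.lastCases with
    | last =>
      simpa [segment_mkOfSucc_last] using congrFun (A.tupleLift_injective h₂) 0
    | cast j =>
      simpa [segment_δ_last] using congrFun (A.tupleLift_injective h₁) j
  · exact (A.deloopObj.δ_comp_δ_self (n := 0) (i := 1)).symm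
  · obtain ⟨x, f, rfl⟩ := A.exists_eq_tupleLift s
    obtain ⟨y, g, rfl⟩ := A.exists_eq_tupleLift t
    obtain rfl : x = y :=
      A.eq_of_tupleLift_eq ((A.tupleLift_δ 1 f).symm.trans (hst.trans (A.tupleLift_δ 1 g)))
    -- the second arrow is the difference, so that its composite with `f` is `g`
    refine ⟨A.tupleLift ![f 0, g 0 - f 0],
      (A.tupleLift_δ 2 _).trans ?_, (A.tupleLift_δ 1 _).trans ?_⟩
    · congr 1
      funext j
      rw [Subsingleton.elim j 0, sum_segment_δ_two]
      rfl
    · congr 1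
      funext j
      rw [Subsingleton.elim j 0, sum_segment_δ_one]
      exact add_sub_cancel _ _
  · obtain ⟨x, f, rfl⟩ := A.exists_eq_tupleLift s
    obtain ⟨y, g, rfl⟩ := A.exists_eq_tupleLift t
    replace h₁ := (A.tupleLift_δ 2 f).symm.trans (h₁.trans (A.tupleLift_δ 2 g))
    replace h₂ := (A.tupleLift_δ 1 f).symm.trans (h₂.trans (A.tupleLift_δ 1 g))
    obtain rfl := A.eq_of_tupleLift_eq h₁
    have h₃ := congrFun (A.tupleLift_injective h₁) 0
    have h₄ := congrFun (A.tupleLift_injective h₂) 0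
    rw [sum_segment_δ_two, sum_segment_δ_two] at h₃
    rw [sum_segment_δ_one, sum_segment_δ_one, h₃] at h₄
    congr 1
    funext j
    fin_cases j
    · exact h₃
    · exact add_left_cancel h₄

end AbelianOver

end FibrePowers

/-- The iterated deloopings of a module over a groupoid are multiple groupoids. -/
lemma GroupoidModule.isMultiGroupoid {𝒞 : Type (u + 1)} [Category.{u} 𝒞] [HasPullbacks 𝒞]
    [FibrePowers 𝒞] {Q : SimplicialObject 𝒞} (hQ : IsInternalGroupoid Q) (M : GroupoidModule Q)
    (m : ℕ) : IsMultiGroupoid m (eilenbergMacLane M m).obj := by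
  induction m with
  | zero => exact M.isInternalGroupoid
  | succ m ih =>
    exact ⟨fun k => IsMultiGroupoid.pow ih (isMultiGroupoid_disc hQ m)
      (eilenbergMacLane M m).proj k.unop.len, (eilenbergMacLane M m).isInternalGroupoid_deloopObj⟩

end MultipleGroupoids

/-! ### Abelian group objects in slices as group objects -/

section GroupObjects

namespace AbelianOver

variable {𝒟 : Type w} [Category.{v} 𝒟] {X : 𝒟} (A : AbelianOver X)

/-- The presheaf of abelian groups on the slice over `X` defined by the generalized elements
of `A`. -/
def presheaf : (Over X)ᵒᵖ ⥤ CommGrpCat.{v} where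
  obj T := CommGrpCat.of (Multiplicative (LiftsAlong A.proj T.unop.hom))
  map t := CommGrpCat.ofHom (A.precompHom t.unop.left (Over.w t.unop)).toMultiplicative
  map_id T := by
    ext f
    exact congrArg Multiplicative.ofAdd (Subtype.ext (Category.id_comp _))
  map_comp s t := by
    ext f
    exact congrArg Multiplicative.ofAdd (Subtype.ext (Category.assoc _ _ _))

/-- The presheaf of generalized elements of `A` is represented by `A`. -/
def representableBy : (A.presheaf ⋙ forget _).RepresentableBy (Over.mk A.proj) where
  homEquiv :=
    { toFun f := Multiplicative.ofAdd ⟨f.left, Over.w f⟩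
      invFun f := Over.homMk f.toAdd.1 f.toAdd.2
      left_inv _ := rfl
      right_inv _ := rfl }
  homEquiv_comp _ _ := rfl

/-- The object of objects of the delooping of `A` is the base `X`. -/
lemma isIso_deloopProj_app_zero [FibrePowers 𝒟] :
    IsIso (A.deloopProj.app (op (SimplexCategory.mk 0))) :=
  ⟨FibrePowers.lift A.proj 0 (𝟙 X) Fin.elim0 (fun i => i.elim0),
    FibrePowers.hom_ext A.proj 0 ((Category.assoc _ _ _).trans
      ((congrArg (FibrePowers.base A.proj 0 ≫ ·) (FibrePowers.lift_base A.proj 0 _ _ _)).trans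
        ((Category.comp_id _).trans (Category.id_comp _).symm))) (fun i => i.elim0),
    FibrePowers.lift_base A.proj 0 _ _ _⟩

variable [HasPullbacks 𝒟]

/-- An abelian group object given in terms of generalized elements is a group object of the slice
category, by the Yoneda lemma. -/
@[reducible]
def grpObj : GrpObj (Over.mk A.proj) :=
  GrpObj.ofRepresentableBy _ (A.presheaf ⋙ forget₂ CommGrpCat GrpCat) A.representableBy

lemma isCommMonObj :
    let _ := A.grpObj
    IsCommMonObj (Over.mk A.proj) :=
  IsCommMonObj.ofRepresentableBy _ (A.presheaf ⋙ forget₂ CommGrpCat CommMonCat) A.representableBy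

lemma grpObj_one_left :
    let _ := A.grpObj
    (η[Over.mk A.proj]).left = A.unit := rfl

lemma lift_comp_grpObj_mul {T : 𝒟} (x : T ⟶ X) (f g : LiftsAlong A.proj x) :
    let _ := A.grpObj
    lift (Over.homMk f.1 f.2 : Over.mk x ⟶ Over.mk A.proj)
        (Over.homMk g.1 g.2 : Over.mk x ⟶ Over.mk A.proj) ≫ μ[Over.mk A.proj] =
      Over.homMk (f + g).1 (f + g).2 := by
  let _ := A.grpObj
  let f' : Over.mk x ⟶ Over.mk A.proj := Over.homMk f.1 f.2
  let g' : Over.mk x ⟶ Over.mk A.proj := Over.homMk g.1 g.2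
  let c {T : Over X} (s : T ⟶ Over.mk A.proj) : LiftsAlong A.proj T.hom := ⟨s.left, Over.w s⟩
  have hf : A.precompHom (lift f' g').left (Over.w (lift f' g')) (c (fst _ _)) = f :=
    Subtype.ext (congrArg CommaMorphism.left (lift_fst f' g'))
  have hg : A.precompHom (lift f' g').left (Over.w (lift f' g')) (c (snd _ _)) = g :=
    Subtype.ext (congrArg CommaMorphism.left (lift_snd f' g'))
  ext
  have h := _root_.map_add (A.precompHom (lift f' g').left (Over.w (lift f' g')))
    (c (fst _ _)) (c (snd _ _))
  exact congrArg Subtype.val (h.trans (congrArg₂ (· + ·) hf hg))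

end AbelianOver

end GroupObjects

end

theorem mainTheorem8 {O : Type u} (Q : SimplicialObject (CatO O)) (hQ : IsInternalGroupoid Q)
    (M : GroupoidModule Q) (m : ℕ) :
    -- `E^{(n)}(Q, M)` for `n = m + 2`, with its projection to `d^{(n)} Q`
    let E := eilenbergMacLane M (m + 1)
    -- (a) an `n`-fold groupoid in categories with object set `O`, equivalently a category
    -- enriched in `n`-fold groupoids
    (IsMultiGroupoid (m + 1) E.obj ∧
      ∀ a b : O, IsMultiGroupoid (m + 1)
        ((MultiSimplicial.map (CatO.homFunctor a b) (m + 1)).obj E.obj)) ∧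
    -- (b) the object of objects is `d^{(n - 1)} Q`, and it is an abelian group object over
    -- `d^{(n)} Q`, with the unit and the addition coming from the construction
    (IsIso ((MultiSimplicial.objects (CatO O) m).map E.proj) ∧
      ∃ (G : GrpObj (Over.mk E.proj)), IsCommMonObj (Over.mk E.proj) ∧
        (η[Over.mk E.proj]).left = E.unit ∧
        ∀ {T : MultiSimplicial (CatO O) (m + 1)} (x : T ⟶ MultiSimplicial.disc Q (m + 1))
          (f g : LiftsAlong E.proj x),
          lift (Over.homMk f.1 f.2 : Over.mk x ⟶ Over.mk E.proj)
              (Over.homMk g.1 g.2 : Over.mk x ⟶ Over.mk E.proj) ≫ μ[Over.mk E.proj] =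
            Over.homMk (f + g).1 (f + g).2) ∧
    -- (c) an Eilenberg–Mac Lane object of type `(M, n)`
    IsEilenbergMacLaneObject M E.proj := by
  intro E
  have hE : IsMultiGroupoid (m + 1) E.obj := M.isMultiGroupoid hQ (m + 1)
  exact ⟨⟨hE, fun a b => hE.map (CatO.homFunctor a b)⟩,
    ⟨(eilenbergMacLane M m).isIso_deloopProj_app_zero, E.grpObj, E.isCommMonObj,
      E.grpObj_one_left, fun x f g => E.lift_comp_grpObj_mul x f g⟩,
    hE, M.isEilenbergMacLane hQ m⟩
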